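/- Let $m\ge 1$ and let $\mathbb{C}_m$ be the complexification of the Clifford algebra $\mathbb{R}_{0,m}$, generated by $e_1,\dots,e_m$ with $e_je_k+e_ke_j=-2\delta_{jk}$. Write $r=|\underline{x}|$ and $\underline{\omega}=\underline{x}/|\underline{x}|=\sum_j e_jx_j/|\underline{x}|$ for $\underline{x}\in\mathbb{R}^m$, $\underline{\partial}=\sum_j e_j\partial_{x_j}$ for the Dirac operator, and $\sigma_{m+1}=2\pi^{\frac{m+1}{2}}/\Gamma(\frac{m+1}{2})$. Let $T_\lambda=\mathrm{Fp}\,r^\lambda$ and $U_\lambda=\mathrm{Fp}\,r^\lambda\underline{\omega}$ (Hadamard finite parts), and define the normalized tempered distributions $$T^*_\lambda=\pi^{\frac{\lambda+m}{2}}\frac{T_\lambda}{\Gamma(\frac{\lambda+m}{2})}\ (\lambda\neq -m-2l),\qquad T^*_{-m-2l}=\frac{\pi^{\frac m2-l}}{2^{2l}\Gamma(\frac m2+l)}(-\Delta)^l\delta,$$ $$U^*_\lambda=\pi^{\frac{\lambda+m+1}{2}}\frac{U_\lambda}{\Gamma(\frac{\lambda+m+1}{2})}\ (\lambda\neq -m-2l-1),\qquad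 U^*_{-m-2l-1}=-\frac{\pi^{\frac m2-l}}{2^{2l+1}\Gamma(\frac m2+l+1)}\underline{\partial}^{2l+1}\delta,$$ where $l=0,1,2,\dots$. For $\mu\in\mathbb{C}\setminus\{m,m+1,m+2,\dots\}$ put $$E_\mu=\underline{\partial}^{-\mu}\delta=\frac{1+e^{-i\pi\mu}}{2}\,\frac{2^{-\mu}\Gamma(\frac{m-\mu}{2})}{\pi^{\frac{m+\mu}{2}}}\,T^*_{-m+\mu}-\frac{1-e^{-i\pi\mu}}{2}\,\frac{2^{-\mu}\Gamma(\frac{m-\mu+1}{2})}{\pi^{\frac{m+\mu+1}{2}}}\,U^*_{-m+\mu},$$ $$F_\mu=\underline{\partial}^{-\mu}H=\frac{1-e^{-i\pi\mu}}{2}\,\frac{2^{-\mu}\Gamma(\frac{m-\mu}{2})}{\pi^{\frac{m+\mu}{2}}}\,T^*_{-m+\mu}-\frac{1+e^{-i\pi\mu}}{2}\,\frac{2^{-\mu}\Gamma(\frac{m-\mu+1}{2})}{\pi^{\frac{m+\mu+1}{2}}}\,U^*_{-m+\mu}.$$ Let $\mathcal{H}[u]=H*u$ be the Hilbert transform, with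 kernel $H=-\frac{2}{\sigma_{m+1}}U^*_{-m}=-\frac{2}{\sigma_{m+1}}\mathrm{Pv}\,\frac{\underline{x}}{|\underline{x}|^{m+1}}$. Here $H*u$ is the finite part, as $R\to\infty$, of $(\chi(\cdot/R)H)*u$, required to be the same for every smooth compactly supported $\chi$ that equals $1$ near the origin. Finite part means that, tested against any $\varphi\in\mathcal{S}(\mathbb{R}^m)$, the limit is taken after subtracting finitely many terms $a_zR^z$ with $z\in\mathbb{C}\setminus\{0\}$. Then for every $\mu\in\mathbb{C}\setminus\{m,m+1,m+2,\dots\}$, $E_\mu$ and $F_\mu$ form a Hilbert pair: $$\mathcal{H}[E_\mu]=F_\mu\quad\text{and}\quad\mathcal{H}[F_\mu]=E_\mu.$$ If moreover $\operatorname{Re}\mu<m$, both convolutions exist as ordinary limits: $(\chi(\cdot/R)H)*E_\mu\to F_\mu$ and $(\chi(\cdot/R)H)*F_\mu\to E_\mu$ in the sense of tempered distributions as $R\to\infty$, for every such $\chi$. -/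

import Mathlib

open Filter Topology MeasureTheory
open scoped SchwartzMap LineDeriv Laplacian

/-! ### Hadamard finite parts -/

section FinitePart

variable {F : Type*} [AddCommGroup F] [Module ℂ F] [TopologicalSpace F]

/-- `c` is the (Hadamard) finite part of `f` along `l` (with `l = 𝓝[>] 0` or `l = atTop`):
after subtraction of finitely many terms `t ^ z • a z` with exponents `z ≠ 0`, the function `f`
converges to `c`. If `f` converges, its finite part is its limit. -/
def HasFinitePart (l : Filter ℝ) (f : ℝ → F) (c : F) : Prop :=
  ∃ (s : Finset ℂ) (a : ℂ → F), (∀ z ∈ s, z ≠ 0) ∧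
    Tendsto (fun t : ℝ => f t - ∑ z ∈ s, ((t : ℂ) ^ z) • a z) l (𝓝 c)

theorem HasFinitePart.of_tendsto {l : Filter ℝ} {f : ℝ → F} {c : F}
    (h : Tendsto f l (𝓝 c)) : HasFinitePart l f c :=
  ⟨∅, 0, by simp, by simpa using h⟩

/-- A dilation `t ↦ r * t` with `r ^ z ≠ 1`. -/
theorem exists_dilation_cpow_ne_one {z : ℂ} (hz : z ≠ 0) :
    ∃ r : ℝ, 0 < r ∧ (r : ℂ) ^ z ≠ 1 := by
  have hn : (0 : ℝ) < ‖z‖ := norm_pos_iff.2 hz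
  refine ⟨Real.exp (1 / ‖z‖), Real.exp_pos _, fun h => ?_⟩
  have h0 : ((Real.exp (1 / ‖z‖) : ℝ) : ℂ) ≠ 0 := by
    exact_mod_cast (Real.exp_pos _).ne'
  rw [Complex.cpow_def_of_ne_zero h0, ← Complex.ofReal_log (Real.exp_pos _).le, Real.log_exp,
    Complex.exp_eq_one_iff] at h
  obtain ⟨n, hh⟩ := h
  have h1 := congrArg norm hh
  have h2 : ‖(((1 / ‖z‖ : ℝ) : ℂ)) * z‖ = 1 := by
    rw [norm_mul, Complex.norm_real, Real.norm_of_nonneg (by positivity)]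
    field_simp
  rw [h2] at h1
  simp only [norm_mul, Complex.norm_intCast, Complex.norm_ofNat, Complex.norm_real,
    Complex.norm_I, mul_one, Real.norm_of_nonneg Real.pi_pos.le] at h1
  have hpi := Real.pi_gt_three
  rcases eq_or_ne n 0 with rfl | hn0
  · simp at h1
  · have : (1 : ℝ) ≤ |(n : ℝ)| := by exact_mod_cast Int.one_le_abs hn0
    nlinarith

/-- The finite part is unique. -/
theorem HasFinitePart.unique [T2Space F] [IsTopologicalAddGroup F] [ContinuousConstSMul ℂ F]
    {l : Filter ℝ} [l.NeBot] (hpos : ∀ᶠ t in l, (0 : ℝ) < t)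
    (hdil : ∀ r : ℝ, 0 < r → Tendsto (fun t => r * t) l l)
    {f : ℝ → F} {c d : F} (hc : HasFinitePart l f c) (hd : HasFinitePart l f d) : c = d := by
  have key : ∀ (s : Finset ℂ) (a : ℂ → F) (c : F), (∀ z ∈ s, z ≠ 0) →
      Tendsto (fun t : ℝ => ∑ z ∈ s, ((t : ℂ) ^ z) • a z) l (𝓝 c) → c = 0 := by
    intro s
    induction s using Finset.induction_on with
    | empty => intro a c _ h; exact (tendsto_nhds_unique h (by simp)).trans rfl
    | insert w s hw ih =>
      intro a c hs h
      obtain ⟨r, hr, hrw⟩ := exists_dilation_cpow_ne_one (hs w (by simp))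
      have h1 := (h.comp (hdil r hr)).sub (h.const_smul ((r : ℂ) ^ w))
      have h2 := ih (fun z => ((r : ℂ) ^ z - (r : ℂ) ^ w) • a z) (c - ((r : ℂ) ^ w) • c)
        (fun z hz => hs z (by simp [hz])) (h1.congr' ?_)
      · have h3 : (1 - (r : ℂ) ^ w) • c = 0 := by rw [sub_smul, one_smul]; exact h2
        exact (smul_eq_zero.1 h3).resolve_left (sub_ne_zero.2 hrw.symm)
      · filter_upwards [hpos] with t ht
        simp only [Function.comp, Finset.sum_insert hw, Complex.ofReal_mul,
          Complex.mul_cpow_ofReal_nonneg hr.le ht.le, smul_add, Finset.smul_sum, smul_smul]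
        rw [add_sub_add_comm, sub_self, zero_add, ← Finset.sum_sub_distrib]
        refine Finset.sum_congr rfl fun z _ => ?_
        rw [← sub_smul]
        congr 1
        ring
  classical
  obtain ⟨s, a, hs, ha⟩ := hc
  obtain ⟨s', a', hs', ha'⟩ := hd
  have := key (s ∪ s') (fun z => (if z ∈ s' then a' z else 0) - (if z ∈ s then a z else 0))
    (c - d) (fun z hz => (Finset.mem_union.1 hz).elim (hs z) (hs' z)) ((ha.sub ha').congr ?_)
  · exact sub_eq_zero.1 this
  · intro t
    simp only [smul_sub, Finset.sum_sub_distrib, smul_ite, smul_zero]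
    rw [Finset.sum_ite_mem, Finset.sum_ite_mem, Finset.union_inter_cancel_right,
      Finset.union_inter_cancel_left]
    abel

end FinitePart

noncomputable section

namespace DiracHilbert

/-! ### The complex Clifford algebra and Clifford-valued tempered distributions -/

/-- Euclidean space `ℝ^m`. -/
abbrev Space (m : ℕ) : Type := EuclideanSpace ℝ (Fin m)

/-- The quadratic form `v ↦ -∑ j, v j ^ 2`. -/
abbrev negQ (m : ℕ) : QuadraticForm ℂ (Fin m → ℂ) :=
  QuadraticMap.weightedSumSquares ℂ (fun _ : Fin m => (-1 : ℂ))

/-- The complexification of the Clifford algebra `ℝ_{0,m}`: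
`e_j e_k + e_k e_j = -2 δ_{jk}`. -/
abbrev Cl (m : ℕ) : Type := CliffordAlgebra (negQ m)

/-- The basis vector `e_j` in the Clifford algebra. -/
def e {m : ℕ} (j : Fin m) : Cl m := CliffordAlgebra.ι (negQ m) (Pi.single j 1)

theorem e_mul_self {m : ℕ} (j : Fin m) : (e j : Cl m) * e j = -1 := by
  rw [e, CliffordAlgebra.ι_sq_scalar, QuadraticMap.weightedSumSquares_apply,
    Finset.sum_eq_single j (fun k _ hk => by simp [hk]) (by simp)]
  simp

theorem e_mul_e_add {m : ℕ} {j k : Fin m} (h : j ≠ k) : (e j : Cl m) * e k + e k * e j = 0 := by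
  rw [e, e, CliffordAlgebra.ι_mul_ι_add_swap, QuadraticMap.polar]
  simp only [QuadraticMap.weightedSumSquares_apply, ← Finset.sum_sub_distrib]
  rw [Finset.sum_eq_zero, map_zero]
  intro i _
  rcases eq_or_ne i j with rfl | hj
  · simp [h]
  · simp [hj]

/-- The usual topology of the (finite-dimensional) complex vector space `Cl m`. -/
instance (m : ℕ) : TopologicalSpace (Cl m) := moduleTopology ℂ (Cl m)

instance (m : ℕ) : IsModuleTopology ℂ (Cl m) := ⟨rfl⟩

instance (m : ℕ) : IsTopologicalAddGroup (Cl m) :=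
  IsModuleTopology.topologicalAddGroup ℂ (Cl m)

/-- A scalar distribution times a Clifford number. -/
def tensor {m : ℕ} (T : 𝓢'(Space m, ℂ)) (a : Cl m) : 𝓢'(Space m, Cl m) :=
  PointwiseConvergenceCLM.postcomp 𝓢(Space m, ℂ)
    (⟨LinearMap.toSpanSingleton ℂ (Cl m) a, IsModuleTopology.continuous_of_linearMap _⟩ :
      ℂ →L[ℂ] Cl m) T

/-- Left multiplication of a Clifford-valued distribution by a Clifford number. -/
def leftMul {m : ℕ} (a : Cl m) (u : 𝓢'(Space m, Cl m)) : 𝓢'(Space m, Cl m) :=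
  PointwiseConvergenceCLM.postcomp 𝓢(Space m, ℂ)
    (⟨LinearMap.mulLeft ℂ a, IsModuleTopology.continuous_of_linearMap _⟩ : Cl m →L[ℂ] Cl m) u

theorem tensor_apply {m : ℕ} (T : 𝓢'(Space m, ℂ)) (a : Cl m) (φ : 𝓢(Space m, ℂ)) :
    tensor T a φ = T φ • a := rfl

theorem leftMul_apply {m : ℕ} (a : Cl m) (u : 𝓢'(Space m, Cl m)) (φ : 𝓢(Space m, ℂ)) :
    leftMul a u φ = a * u φ := rfl

/-- The Dirac operator `∂ = ∑ j, e_j ∂_{x_j}` on Clifford-valued distributions. -/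
def dirac {m : ℕ} (u : 𝓢'(Space m, Cl m)) : 𝓢'(Space m, Cl m) :=
  ∑ j : Fin m, leftMul (e j) (∂_{(EuclideanSpace.single j (1 : ℝ) : Space m)} u)

/-! ### The families `T_λ`, `U_λ` and their normalizations -/

open Classical in
/-- The tempered distribution `Fp k`: its value at `φ` is the finite part for `ε → 0+` of
`∫_{|x| > ε} k(x) φ(x) dx`. (It is `0` if these finite parts do not define a tempered
distribution.) -/
def fpDist {m : ℕ} (k : Space m → ℂ) : 𝓢'(Space m, ℂ) :=
  if h : ∃ T : 𝓢'(Space m, ℂ), ∀ φ : 𝓢(Space m, ℂ),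
      HasFinitePart (𝓝[>] (0 : ℝ)) (fun ε => ∫ x in {x : Space m | ε < ‖x‖}, k x * φ x) (T φ)
  then h.choose else 0

/-- `T_s = Fp r^s`. -/
def T (m : ℕ) (s : ℂ) : 𝓢'(Space m, ℂ) := fpDist fun x => (‖x‖ : ℂ) ^ s

/-- `U_s = Fp r^s ω`, where `ω = x / |x| = ∑ j, e_j x_j / |x|`. -/
def U (m : ℕ) (s : ℂ) : 𝓢'(Space m, Cl m) :=
  ∑ j : Fin m, tensor (fpDist fun x => (‖x‖ : ℂ) ^ s * ((x j / ‖x‖ : ℝ) : ℂ)) (e j)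

/-- The scalar distribution `(-Δ)^l δ`. -/
def negLaplaceDelta (m l : ℕ) : 𝓢'(Space m, ℂ) :=
  (fun u : 𝓢'(Space m, ℂ) => -Δ u)^[l] (TemperedDistribution.delta 0)

/-- The Clifford-valued distribution `∂^n δ`, for `n` a natural number. -/
def diracIterDelta (m n : ℕ) : 𝓢'(Space m, Cl m) :=
  dirac^[n] (tensor (TemperedDistribution.delta 0) 1)

open Classical in
/-- The normalized distribution `T*_s`. -/
def Tstar (m : ℕ) (s : ℂ) : 𝓢'(Space m, ℂ) :=
  if h : ∃ l : ℕ, s = -(m : ℂ) - 2 * l then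
    ((Real.pi : ℂ) ^ ((m : ℂ) / 2 - h.choose) /
      (2 ^ (2 * h.choose) * Complex.Gamma ((m : ℂ) / 2 + h.choose))) • negLaplaceDelta m h.choose
  else
    ((Real.pi : ℂ) ^ ((s + m) / 2) / Complex.Gamma ((s + m) / 2)) • T m s

open Classical in
/-- The normalized distribution `U*_s`. -/
def Ustar (m : ℕ) (s : ℂ) : 𝓢'(Space m, Cl m) :=
  if h : ∃ l : ℕ, s = -(m : ℂ) - 2 * l - 1 then
    (-((Real.pi : ℂ) ^ ((m : ℂ) / 2 - h.choose) /
      (2 ^ (2 * h.choose + 1) * Complex.Gamma ((m : ℂ) / 2 + h.choose + 1)))) •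
        diracIterDelta m (2 * h.choose + 1)
  else
    ((Real.pi : ℂ) ^ ((s + m + 1) / 2) / Complex.Gamma ((s + m + 1) / 2)) • U m s

/-! ### Convolution and the Hilbert transform -/

/-- Smooth compactly supported functions that are `1` in a neighbourhood of the origin. -/
structure IsCutoff {m : ℕ} (χ : Space m → ℝ) : Prop where
  smooth : ContDiff ℝ (⊤ : ℕ∞) χ
  compact : HasCompactSupport χ
  eq_one : ∀ᶠ y in 𝓝 (0 : Space m), χ y = 1

/-- The test function `y ↦ χ(y / R) φ(x + y)`. -/
def cutShift {m : ℕ} (χ : Space m → ℝ) (R : ℝ) (φ : 𝓢(Space m, ℂ)) (x : Space m) :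
    𝓢(Space m, ℂ) :=
  SchwartzMap.smulLeftCLM ℂ (fun y : Space m => (χ (R⁻¹ • y) : ℂ))
    (SchwartzMap.compSubConstCLM ℂ (-x) φ)

theorem cutShift_apply {m : ℕ} {χ : Space m → ℝ} (hχ : IsCutoff χ) {R : ℝ} (hR : 0 < R)
    (φ : 𝓢(Space m, ℂ)) (x y : Space m) :
    cutShift χ R φ x y = χ (R⁻¹ • y) * φ (x + y) := by
  have hd : ContDiff ℝ (⊤ : ℕ∞) (fun y : Space m => (χ (R⁻¹ • y) : ℂ)) :=
    Complex.ofRealCLM.contDiff.comp (hχ.smooth.comp (contDiff_const_smul _))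
  have hs : HasCompactSupport (fun y : Space m => (χ (R⁻¹ • y) : ℂ)) :=
    (hχ.compact.comp_smul (inv_ne_zero hR.ne')).comp_left (g := fun t : ℝ => (t : ℂ)) (by simp)
  have ht : (fun y : Space m => (χ (R⁻¹ • y) : ℂ)).HasTemperateGrowth :=
    (hs.toSchwartzMap hd).hasTemperateGrowth
  simp [cutShift, SchwartzMap.smulLeftCLM_apply_apply ht, add_comm]

/-- `v` is the value at the test function `φ` of the convolution `(χ(· / R) K) ∗ u` of the
compactly supported distribution `χ(· / R) K` with `u`. That is, `v = ⟨u(x), g(x)⟩`, where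
`g(x) = ⟨K(y), χ(y / R) φ(x + y)⟩` is a Clifford-valued test function; the pairing is taken
coefficientwise, with the Clifford numbers coming from `K` on the left. -/
def IsTruncConv {m : ℕ} (K u : 𝓢'(Space m, Cl m)) (χ : Space m → ℝ) (R : ℝ)
    (φ : 𝓢(Space m, ℂ)) (v : Cl m) : Prop :=
  ∃ (n : ℕ) (g : Fin n → 𝓢(Space m, ℂ)) (c : Fin n → Cl m),
    (∀ x, K (cutShift χ R φ x) = ∑ i, g i x • c i) ∧ v = ∑ i, c i * u (g i)

/-- `w = K ∗ u` in the ordinary sense: `(χ(· / R) K) ∗ u` converges to `w` for `R → ∞`, for each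
cutoff function `χ`. -/
def IsOrdinaryConv {m : ℕ} (K u w : 𝓢'(Space m, Cl m)) : Prop :=
  ∀ χ : Space m → ℝ, IsCutoff χ → ∀ φ : 𝓢(Space m, ℂ), ∃ f : ℝ → Cl m,
    (∀ R : ℝ, 0 < R → IsTruncConv K u χ R φ (f R)) ∧ Tendsto f atTop (𝓝 (w φ))

/-- `w = K ∗ u` in the sense of finite parts: `w` is the finite part of `(χ(· / R) K) ∗ u` for
`R → ∞`, for each cutoff function `χ`. -/
def IsConv {m : ℕ} (K u w : 𝓢'(Space m, Cl m)) : Prop :=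
  ∀ χ : Space m → ℝ, IsCutoff χ → ∀ φ : 𝓢(Space m, ℂ), ∃ f : ℝ → Cl m,
    (∀ R : ℝ, 0 < R → IsTruncConv K u χ R φ (f R)) ∧ HasFinitePart atTop f (w φ)

/-- The area `2 π^(n/2) / Γ(n/2)` of the unit sphere in `ℝ^n`. -/
def sphereArea (n : ℕ) : ℝ := 2 * Real.pi ^ ((n : ℝ) / 2) / Real.Gamma ((n : ℝ) / 2)

/-- The convolution kernel `H = -(2 / σ_{m+1}) U*_{-m}` of the Hilbert transform. -/
def hilbertKernel (m : ℕ) : 𝓢'(Space m, Cl m) :=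
  ((-(2 / sphereArea (m + 1)) : ℝ) : ℂ) • Ustar m (-(m : ℂ))

/-- `w` is the Hilbert transform `H ∗ u` of `u`. -/
def IsHilbertTransform {m : ℕ} (u w : 𝓢'(Space m, Cl m)) : Prop :=
  IsConv (hilbertKernel m) u w

/-- `u` and `w` are each other's Hilbert transform. -/
def IsHilbertPair {m : ℕ} (u w : 𝓢'(Space m, Cl m)) : Prop :=
  IsHilbertTransform u w ∧ IsHilbertTransform w u

/-! ### The kernels of the two operators and their fundamental solutions -/

/-- The kernel `∂^ν δ` of the complex power `∂^ν` of the Dirac operator. -/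
def diracPow (m : ℕ) (ν : ℂ) : 𝓢'(Space m, Cl m) :=
  ((1 + Complex.exp (Complex.I * Real.pi * ν)) / 2 *
      ((2 : ℂ) ^ ν * Complex.Gamma ((m + ν) / 2) / (Real.pi : ℂ) ^ ((m - ν) / 2))) •
    tensor (Tstar m (-m - ν)) 1 -
  ((1 - Complex.exp (Complex.I * Real.pi * ν)) / 2 *
      ((2 : ℂ) ^ ν * Complex.Gamma ((m + ν + 1) / 2) / (Real.pi : ℂ) ^ ((m - ν + 1) / 2))) •
    Ustar m (-m - ν)

/-- The kernel `∂^ν H` of the operator `^νℋ`. -/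
def diracPowH (m : ℕ) (ν : ℂ) : 𝓢'(Space m, Cl m) :=
  ((1 - Complex.exp (Complex.I * Real.pi * ν)) / 2 *
      ((2 : ℂ) ^ ν * Complex.Gamma ((m + ν) / 2) / (Real.pi : ℂ) ^ ((m - ν) / 2))) •
    tensor (Tstar m (-m - ν)) 1 -
  ((1 + Complex.exp (Complex.I * Real.pi * ν)) / 2 *
      ((2 : ℂ) ^ ν * Complex.Gamma ((m + ν + 1) / 2) / (Real.pi : ℂ) ^ ((m - ν + 1) / 2))) •
    Ustar m (-m - ν)

/-- `E_μ = ∂^{-μ} δ`. -/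
def fundE (m : ℕ) (μ : ℂ) : 𝓢'(Space m, Cl m) := diracPow m (-μ)

/-- `F_μ = ∂^{-μ} H`. -/
def fundF (m : ℕ) (μ : ℂ) : 𝓢'(Space m, Cl m) := diracPowH m (-μ)

end DiracHilbert

end

/-! ### Algebra of finite parts -/

namespace HasFinitePart

variable {F : Type*} [AddCommGroup F] [Module ℂ F] [TopologicalSpace F] {l : Filter ℝ}

theorem congr' {f g : ℝ → F} {c : F} (h : HasFinitePart l f c) (hfg : f =ᶠ[l] g) :
    HasFinitePart l g c := by
  obtain ⟨s, a, hs, ha⟩ := h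
  refine ⟨s, a, hs, ha.congr' ?_⟩
  filter_upwards [hfg] with t ht
  rw [ht]

theorem add [IsTopologicalAddGroup F] {f g : ℝ → F} {c d : F}
    (hf : HasFinitePart l f c) (hg : HasFinitePart l g d) :
    HasFinitePart l (fun t => f t + g t) (c + d) := by
  classical
  obtain ⟨s, a, hs, ha⟩ := hf
  obtain ⟨s', a', hs', ha'⟩ := hg
  refine ⟨s ∪ s', fun z => (if z ∈ s then a z else 0) + (if z ∈ s' then a' z else 0),
    fun z hz => (Finset.mem_union.1 hz).elim (hs z) (hs' z), (ha.add ha').congr fun t => ?_⟩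
  simp only [smul_add, Finset.sum_add_distrib, smul_ite, smul_zero]
  rw [Finset.sum_ite_mem, Finset.sum_ite_mem, Finset.union_inter_cancel_left,
    Finset.union_inter_cancel_right]
  abel

theorem map {G : Type*} [AddCommGroup G] [Module ℂ G] [TopologicalSpace G]
    {f : ℝ → F} {c : F} (hf : HasFinitePart l f c) (L : F →L[ℂ] G) :
    HasFinitePart l (fun t => L (f t)) (L c) := by
  obtain ⟨s, a, hs, ha⟩ := hf
  refine ⟨s, fun z => L (a z), hs, ((L.continuous.tendsto _).comp ha).congr fun t => ?_⟩
  simp [map_sum]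

theorem const_smul [ContinuousConstSMul ℂ F] {f : ℝ → F} {c : F} (b : ℂ)
    (hf : HasFinitePart l f c) : HasFinitePart l (fun t => b • f t) (b • c) :=
  hf.map (b • ContinuousLinearMap.id ℂ F)

theorem smul_const [ContinuousSMul ℂ F] {f : ℝ → ℂ} {c : ℂ}
    (hf : HasFinitePart l f c) (v : F) : HasFinitePart l (fun t => f t • v) (c • v) :=
  hf.map (ContinuousLinearMap.toSpanSingleton ℂ v)

theorem zero : HasFinitePart l (fun _ => (0 : F)) 0 :=
  HasFinitePart.of_tendsto tendsto_const_nhds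

theorem sum [IsTopologicalAddGroup F] {ι : Type*} {S : Finset ι} {f : ι → ℝ → F} {c : ι → F}
    (hf : ∀ i ∈ S, HasFinitePart l (f i) (c i)) :
    HasFinitePart l (fun t => ∑ i ∈ S, f i t) (∑ i ∈ S, c i) := by
  classical
  induction S using Finset.induction_on with
  | empty => simpa using zero
  | insert i S hi ih =>
    simp only [Finset.sum_insert hi]
    exact (hf i (by simp)).add (ih fun j hj => hf j (by simp [hj]))

/-- A pure power `t ^ z` with `z ≠ 0` has finite part zero. -/
theorem cpow_smul {z : ℂ} (hz : z ≠ 0) (v : F) :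
    HasFinitePart l (fun t : ℝ => ((t : ℂ) ^ z) • v) 0 :=
  ⟨{z}, fun _ => v, by simpa using hz, by simpa using tendsto_const_nhds⟩

theorem comp_mul {f : ℝ → F} {c : F} {R : ℝ} (hR : 0 < R)
    (hf : HasFinitePart (𝓝[>] (0 : ℝ)) f c) :
    HasFinitePart (𝓝[>] (0 : ℝ)) (fun ε => f (R * ε)) c := by
  obtain ⟨s, a, hs, ha⟩ := hf
  have hdil : Tendsto (fun ε : ℝ => R * ε) (𝓝[>] 0) (𝓝[>] 0) := by
    refine tendsto_nhdsWithin_iff.2 ⟨?_, ?_⟩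
    · refine Tendsto.mono_left ?_ nhdsWithin_le_nhds
      simpa using (continuous_const_mul R).tendsto (0 : ℝ)
    · filter_upwards [self_mem_nhdsWithin] with ε hε
      exact mul_pos hR hε
  refine ⟨s, fun z => ((R : ℂ) ^ z) • a z, hs, (ha.comp hdil).congr' ?_⟩
  filter_upwards [self_mem_nhdsWithin] with ε hε
  simp only [Function.comp]
  congr 1
  refine Finset.sum_congr rfl fun z _ => ?_
  rw [Complex.ofReal_mul, Complex.mul_cpow_ofReal_nonneg hR.le (le_of_lt hε), smul_smul, mul_comm]

/-- Uniqueness of the finite part at `0`. -/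
theorem unique_zero [T2Space F] [IsTopologicalAddGroup F] [ContinuousConstSMul ℂ F]
    {f : ℝ → F} {c d : F} (hc : HasFinitePart (𝓝[>] (0 : ℝ)) f c)
    (hd : HasFinitePart (𝓝[>] (0 : ℝ)) f d) : c = d := by
  refine HasFinitePart.unique (l := 𝓝[>] (0 : ℝ)) self_mem_nhdsWithin (fun R hR => ?_) hc hd
  refine tendsto_nhdsWithin_iff.2 ⟨?_, ?_⟩
  · refine Tendsto.mono_left ?_ nhdsWithin_le_nhds
    simpa using (continuous_const_mul R).tendsto (0 : ℝ)
  · filter_upwards [self_mem_nhdsWithin] with ε hε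
    exact mul_pos hR hε

end HasFinitePart

namespace DiracHilbert

/-! ### Functions homogeneous of degree zero and polar coordinates -/

/-- Bounded measurable functions that are positively homogeneous of degree zero. -/
structure IsAngular {m : ℕ} (A : Space m → ℂ) : Prop where
  measurable : Measurable A
  bounded : ∃ C, ∀ x, ‖A x‖ ≤ C
  smul_eq : ∀ (t : ℝ) (x : Space m), 0 < t → A (t • x) = A x

variable {m : ℕ}

theorem IsAngular.mul {A B : Space m → ℂ} (hA : IsAngular A) (hB : IsAngular B) :
    IsAngular (fun x => A x * B x) where
  measurable := hA.measurable.mul hB.measurable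
  bounded := by
    obtain ⟨C, hC⟩ := hA.bounded
    obtain ⟨D, hD⟩ := hB.bounded
    refine ⟨C * D, fun x => ?_⟩
    rw [norm_mul]
    exact mul_le_mul (hC x) (hD x) (norm_nonneg _) ((norm_nonneg _).trans (hC x))
  smul_eq t x ht := by rw [hA.smul_eq t x ht, hB.smul_eq t x ht]

theorem IsAngular.sub {A B : Space m → ℂ} (hA : IsAngular A) (hB : IsAngular B) :
    IsAngular (fun x => A x - B x) where
  measurable := hA.measurable.sub hB.measurable
  bounded := by
    obtain ⟨C, hC⟩ := hA.bounded
    obtain ⟨D, hD⟩ := hB.bounded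
    exact ⟨C + D, fun x => (norm_sub_le _ _).trans (add_le_add (hC x) (hD x))⟩
  smul_eq t x ht := by rw [hA.smul_eq t x ht, hB.smul_eq t x ht]

theorem IsAngular.const (c : ℂ) : IsAngular (fun _ : Space m => c) :=
  ⟨measurable_const, ⟨‖c‖, fun _ => le_rfl⟩, fun _ _ _ => rfl⟩

/-- The integral over the unit sphere. -/
noncomputable def sphereIntegral (A : Space m → ℂ) : ℂ :=
  ∫ θ, A θ ∂(volume : Measure (Space m)).toSphere

theorem integral_norm_mul_angular [NeZero m] (g : ℝ → ℂ) {A : Space m → ℂ}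
    (hA : IsAngular A) :
    ∫ x : Space m, g ‖x‖ * A x =
      sphereIntegral A * ∫ r in Set.Ioi (0 : ℝ), (r : ℂ) ^ (m - 1) * g r := by
  have hdim : Module.finrank ℝ (Space m) = m := by simp
  have : Nontrivial (Space m) :=
    Module.nontrivial_of_finrank_pos (R := ℝ) (by rw [hdim]; exact Nat.pos_of_ne_zero (NeZero.ne m))
  have h1 : ∫ x : Space m, g ‖x‖ * A x =
      ∫ x : ({(0)}ᶜ : Set (Space m)), g ‖x.1‖ * A x.1 ∂(volume.comap Subtype.val) := by
    rw [integral_subtype_comap (measurableSet_singleton _).compl fun x : Space m => g ‖x‖ * A x,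
      restrict_compl_singleton]
  have h2 : ∫ x : ({(0)}ᶜ : Set (Space m)), g ‖x.1‖ * A x.1 ∂(volume.comap Subtype.val) =
      ∫ p : Metric.sphere (0 : Space m) 1 × Set.Ioi (0 : ℝ), A p.1 * g p.2
        ∂((volume : Measure (Space m)).toSphere.prod (.volumeIoiPow (m - 1))) := by
    have := (volume : Measure (Space m)).measurePreserving_homeomorphUnitSphereProd.integral_comp
      (Homeomorph.measurableEmbedding _)
      (fun p : Metric.sphere (0 : Space m) 1 × Set.Ioi (0 : ℝ) => A p.1 * g p.2)
    rw [hdim] at this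
    rw [← this]
    refine integral_congr_ae (Eventually.of_forall fun x => ?_)
    have hx : (x : Space m) ≠ 0 := x.2
    simp only [homeomorphUnitSphereProd_apply_snd_coe, homeomorphUnitSphereProd_apply_fst_coe]
    rw [hA.smul_eq _ _ (inv_pos.2 (norm_pos_iff.2 hx)), mul_comm]
  rw [h1, h2, integral_prod_mul (fun θ : Metric.sphere (0 : Space m) 1 => A θ)
    (fun r : Set.Ioi (0 : ℝ) => g r), sphereIntegral]
  congr 1
  rw [Measure.volumeIoiPow, integral_withDensity_eq_integral_toReal_smul₀]
  · rw [← integral_subtype_comap measurableSet_Ioi fun r : ℝ => (r : ℂ) ^ (m - 1) * g r]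
    refine integral_congr_ae (Eventually.of_forall fun r => ?_)
    have : (0 : ℝ) < r := r.2
    simp only
    rw [ENNReal.toReal_ofReal (by positivity), Complex.real_smul]
    push_cast
    rfl
  · exact (ENNReal.measurable_ofReal.comp (measurable_subtype_coe.pow_const _)).aemeasurable
  · exact Eventually.of_forall fun _ => ENNReal.ofReal_lt_top

theorem integrable_norm_rpow_ball [NeZero m] {σ : ℝ} (hσ : 0 < σ) :
    IntegrableOn (fun x : Space m => ‖x‖ ^ (σ - m)) (Metric.ball 0 1) := by
  have hdim : Module.finrank ℝ (Space m) = m := by simp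
  have : Nontrivial (Space m) :=
    Module.nontrivial_of_finrank_pos (R := ℝ) (by rw [hdim]; exact Nat.pos_of_ne_zero (NeZero.ne m))
  rw [integrableOn_fun_norm_addHaar volume (f := fun r : ℝ => r ^ (σ - m)), hdim]
  have h1 : IntegrableOn (fun r : ℝ => r ^ (σ - 1)) (Set.Ioo 0 1) := by
    have := (intervalIntegral.intervalIntegrable_rpow' (a := 0) (b := 1) (r := σ - 1) (by linarith))
    rw [intervalIntegrable_iff_integrableOn_Ioo_of_le zero_le_one] at this
    exact this
  refine h1.congr_fun (fun r hr => ?_) measurableSet_Ioo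
  simp only [smul_eq_mul]
  rw [← Real.rpow_natCast, ← Real.rpow_add hr.1]
  congr 1
  rw [Nat.cast_sub (Nat.one_le_iff_ne_zero.2 (NeZero.ne m))]
  push_cast; ring

theorem integrable_norm_rpow_compl_ball [NeZero m] {σ : ℝ} (hσ : σ < 0) :
    IntegrableOn (fun x : Space m => ‖x‖ ^ (σ - m)) (Metric.ball 0 1)ᶜ := by
  have hdim : Module.finrank ℝ (Space m) = m := by simp
  have : Nontrivial (Space m) :=
    Module.nontrivial_of_finrank_pos (R := ℝ) (by rw [hdim]; exact Nat.pos_of_ne_zero (NeZero.ne m))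
  rw [← integrable_indicator_iff Metric.isOpen_ball.measurableSet.compl]
  have h : ((Metric.ball (0 : Space m) 1)ᶜ).indicator (fun x : Space m => ‖x‖ ^ (σ - m)) =
      fun x => (Set.Ici (1 : ℝ)).indicator (fun r : ℝ => r ^ (σ - m)) ‖x‖ := by
    ext x
    by_cases hx : 1 ≤ ‖x‖
    · rw [Set.indicator_of_mem (by simpa using hx), Set.indicator_of_mem (by simpa using hx)]
    · rw [Set.indicator_of_notMem (by simpa using hx), Set.indicator_of_notMem (by simpa using hx)]
  rw [h, integrable_fun_norm_addHaar volume, hdim]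
  have h1 : IntegrableOn (fun r : ℝ => r ^ (σ - 1)) (Set.Ici 1) := by
    rw [integrableOn_Ici_iff_integrableOn_Ioi]
    exact integrableOn_Ioi_rpow_of_lt (by linarith) one_pos
  rw [← integrable_indicator_iff measurableSet_Ici] at h1
  refine (h1.integrableOn (s := Set.Ioi 0)).congr_fun (fun r hr => ?_) measurableSet_Ioi
  have hr' : (0 : ℝ) < r := hr
  by_cases hx : 1 ≤ r
  · simp only [smul_eq_mul]
    rw [Set.indicator_of_mem (by simpa using hx), Set.indicator_of_mem (by simpa using hx),
      ← Real.rpow_natCast, ← Real.rpow_add hr']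
    congr 1
    rw [Nat.cast_sub (Nat.one_le_iff_ne_zero.2 (NeZero.ne m))]
    push_cast; ring
  · simp only [smul_eq_mul]
    rw [Set.indicator_of_notMem (by simpa using hx), Set.indicator_of_notMem (by simpa using hx),
      mul_zero]

/-- An angular function that is odd has vanishing spherical integral. -/
theorem sphereIntegral_eq_zero_of_odd [NeZero m] {A : Space m → ℂ} (hA : IsAngular A)
    (hodd : ∀ x, A (-x) = -A x) : sphereIntegral A = 0 := by
  have hm : 0 < m := Nat.pos_of_ne_zero (NeZero.ne m)
  have h1 := integral_norm_mul_angular ((Set.Iio (1 : ℝ)).indicator fun _ => 1) hA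
  have h2 : ∫ x : Space m, (Set.Iio (1 : ℝ)).indicator (fun _ => (1 : ℂ)) ‖x‖ * A x = 0 := by
    have := integral_neg_eq_self
      (fun x : Space m => (Set.Iio (1 : ℝ)).indicator (fun _ => (1 : ℂ)) ‖x‖ * A x) volume
    simp only [norm_neg, hodd, mul_neg, integral_neg] at this
    exact self_eq_neg.1 this.symm
  have h3 : ∫ r in Set.Ioi (0 : ℝ),
      (r : ℂ) ^ (m - 1) * (Set.Iio (1 : ℝ)).indicator (fun _ => (1 : ℂ)) r ≠ 0 := by
    have : ∀ r : ℝ, (r : ℂ) ^ (m - 1) * (Set.Iio (1 : ℝ)).indicator (fun _ => (1 : ℂ)) r =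
        (Set.Iio (1 : ℝ)).indicator (fun r : ℝ => (r : ℂ) ^ (m - 1)) r := fun r => by
      by_cases h : r ∈ Set.Iio (1 : ℝ) <;> simp [h]
    simp_rw [this]
    rw [setIntegral_indicator measurableSet_Iio, Set.Ioi_inter_Iio, ← integral_Ioc_eq_integral_Ioo,
      ← intervalIntegral.integral_of_le zero_le_one]
    simp_rw [← Complex.ofReal_pow]
    rw [intervalIntegral.integral_ofReal, integral_pow]
    have : m - 1 + 1 ≠ 0 := by omega
    simp only [ne_eq, Complex.ofReal_eq_zero]
    rw [Nat.sub_add_cancel hm, zero_pow hm.ne', one_pow]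
    positivity
  rw [h2] at h1
  exact (mul_eq_zero.1 h1.symm).resolve_right h3

/-! ### Regularization of radial singularities -/

theorem norm_norm_cpow {x : Space m} (hx : x ≠ 0) (z : ℂ) :
    ‖(‖x‖ : ℂ) ^ z‖ = ‖x‖ ^ z.re :=
  Complex.norm_cpow_eq_rpow_re_of_pos (norm_pos_iff.2 hx) z

theorem measurable_norm_cpow (z : ℂ) : Measurable fun x : Space m => (‖x‖ : ℂ) ^ z :=
  (Complex.measurable_ofReal.comp measurable_norm).pow_const z

theorem ae_ne_zero [NeZero m] : ∀ᵐ x : Space m, x ≠ 0 := by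
  have hdim : Module.finrank ℝ (Space m) = m := by simp
  have : Nontrivial (Space m) :=
    Module.nontrivial_of_finrank_pos (R := ℝ) (by rw [hdim]; exact Nat.pos_of_ne_zero (NeZero.ne m))
  exact compl_mem_ae_iff.2 (measure_singleton 0)

/-- `F = O(|x| ^ N)` at the origin, and `F` decays rapidly at infinity. -/
structure RadialBound (F : Space m → ℂ) (N : ℕ) : Prop where
  measurable : Measurable F
  near : ∃ C, ∀ x, x ≠ 0 → ‖x‖ < 1 → ‖F x‖ ≤ C * ‖x‖ ^ N
  far : ∀ M : ℕ, ∃ C, ∀ x, 1 ≤ ‖x‖ → ‖x‖ ^ M * ‖F x‖ ≤ C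

theorem RadialBound.integrable_rpow [NeZero m] {F : Space m → ℂ} {N : ℕ} (hF : RadialBound F N)
    {σ : ℝ} (hσ : -(N : ℝ) < σ) : Integrable fun x => ‖x‖ ^ (σ - m) * ‖F x‖ := by
  have hmeas : AEStronglyMeasurable (fun x : Space m => ‖x‖ ^ (σ - m) * ‖F x‖) volume :=
    ((measurable_norm.pow_const _).mul hF.measurable.norm).aestronglyMeasurable
  rw [← integrableOn_univ, ← Set.union_compl_self (Metric.ball (0 : Space m) 1),
    integrableOn_union]
  constructor
  · obtain ⟨C, hC⟩ := hF.near
    refine Integrable.mono' ((integrable_norm_rpow_ball (m := m) (σ := σ + N) (by linarith)).const_mul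
      C) hmeas.restrict ?_
    filter_upwards [ae_restrict_of_ae ae_ne_zero, ae_restrict_mem measurableSet_ball] with x hx hb
    have hx' := norm_pos_iff.2 hx
    rw [Real.norm_of_nonneg (by positivity)]
    calc ‖x‖ ^ (σ - m) * ‖F x‖ ≤ ‖x‖ ^ (σ - m) * (C * ‖x‖ ^ N) := by
          gcongr; exact hC x hx (by simpa using hb)
      _ = C * (‖x‖ ^ (σ - m) * ‖x‖ ^ (N : ℝ)) := by rw [Real.rpow_natCast]; ring
      _ = C * ‖x‖ ^ (σ + N - m) := by rw [← Real.rpow_add hx']; ring_nf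
  · obtain ⟨M, hM⟩ := exists_nat_gt σ
    obtain ⟨C, hC⟩ := hF.far M
    refine Integrable.mono' ((integrable_norm_rpow_compl_ball (m := m) (σ := σ - M)
      (by linarith)).const_mul C) hmeas.restrict ?_
    filter_upwards [ae_restrict_mem measurableSet_ball.compl] with x hb
    have hx1 : 1 ≤ ‖x‖ := by simpa using hb
    have hx' : 0 < ‖x‖ := by linarith
    rw [Real.norm_of_nonneg (by positivity)]
    calc ‖x‖ ^ (σ - m) * ‖F x‖ = ‖x‖ ^ (σ - M - m) * (‖x‖ ^ M * ‖F x‖) := by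
          rw [show σ - m = σ - M - m + M by ring, Real.rpow_add hx', Real.rpow_natCast]; ring
      _ ≤ ‖x‖ ^ (σ - M - m) * C := by gcongr; exact hC x hx1
      _ = _ := mul_comm _ _

theorem RadialBound.integrable [NeZero m] {F : Space m → ℂ} {N : ℕ} (hF : RadialBound F N)
    {s : ℂ} (hs : -(N : ℝ) < s.re) : Integrable fun x => (‖x‖ : ℂ) ^ (s - m) * F x := by
  refine (hF.integrable_rpow hs).mono'
    ((measurable_norm_cpow _).mul hF.measurable).aestronglyMeasurable ?_
  filter_upwards [ae_ne_zero] with x hx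
  rw [norm_mul, norm_norm_cpow hx]
  simp

theorem RadialBound.mul_angular {F : Space m → ℂ} {N : ℕ} (hF : RadialBound F N)
    {A : Space m → ℂ} (hA : IsAngular A) : RadialBound (fun x => A x * F x) N where
  measurable := hA.measurable.mul hF.measurable
  near := by
    obtain ⟨D, hD⟩ := hA.bounded
    obtain ⟨C, hC⟩ := hF.near
    refine ⟨D * C, fun x hx hx1 => ?_⟩
    rw [norm_mul, mul_assoc]
    exact mul_le_mul (hD x) (hC x hx hx1) (norm_nonneg _) ((norm_nonneg _).trans (hD x))
  far M := by
    obtain ⟨D, hD⟩ := hA.bounded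
    obtain ⟨C, hC⟩ := hF.far M
    refine ⟨D * C, fun x hx => ?_⟩
    rw [norm_mul, mul_left_comm]
    exact mul_le_mul (hD x) (hC x hx) (by positivity) ((norm_nonneg _).trans (hD x))

theorem abs_log_le_rpow_add {r δ : ℝ} (hr : 0 < r) (hδ : 0 < δ) :
    |Real.log r| ≤ (r ^ δ + r ^ (-δ)) / δ := by
  have h1 := Real.log_le_rpow_div hr.le hδ
  have h2 := Real.log_le_rpow_div (inv_pos.2 hr).le hδ
  rw [Real.log_inv, Real.inv_rpow hr.le, ← Real.rpow_neg hr.le] at h2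
  have h3 : 0 < r ^ δ / δ := by positivity
  have h4 : 0 < r ^ (-δ) / δ := by positivity
  rw [abs_le, add_div]
  constructor <;> linarith

theorem rpow_le_of_abs_sub_le {r σ σ' δ : ℝ} (hr : 0 < r) (h : |σ' - σ| ≤ δ) :
    r ^ σ' ≤ r ^ σ * (r ^ δ + r ^ (-δ)) := by
  rw [mul_add, ← Real.rpow_add hr, ← Real.rpow_add hr]
  have h0 := abs_le.1 h
  have h3 : 0 < r ^ (σ + δ) := by positivity
  have h4 : 0 < r ^ (σ + -δ) := by positivity
  rcases le_total 1 r with h1 | h1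
  · have := Real.rpow_le_rpow_of_exponent_le h1 (show σ' ≤ σ + δ by linarith)
    linarith
  · have := Real.rpow_le_rpow_of_exponent_ge hr h1 (show σ + -δ ≤ σ' by linarith)
    linarith

theorem RadialBound.differentiableAt [NeZero m] {F : Space m → ℂ} {N : ℕ} (hF : RadialBound F N)
    {s : ℂ} (hs : -(N : ℝ) < s.re) :
    DifferentiableAt ℂ (fun s : ℂ => ∫ x, (‖x‖ : ℂ) ^ (s - m) * F x) s := by
  obtain ⟨δ, hδ, hδs⟩ : ∃ δ : ℝ, 0 < δ ∧ -(N : ℝ) < s.re - 2 * δ :=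
    ⟨(s.re + N) / 3, by linarith, by linarith⟩
  set bound : Space m → ℝ := fun x => δ⁻¹ * (‖x‖ ^ (s.re + 2 * δ - m) * ‖F x‖ +
    2 * (‖x‖ ^ (s.re - m) * ‖F x‖) + ‖x‖ ^ (s.re - 2 * δ - m) * ‖F x‖) with hbound
  have hbi : Integrable bound :=
    (((hF.integrable_rpow (by linarith)).add ((hF.integrable_rpow hs).const_mul 2)).add
      (hF.integrable_rpow hδs)).const_mul δ⁻¹
  refine (hasDerivAt_integral_of_dominated_loc_of_deriv_le (μ := volume) (bound := bound)
    (F := fun (s : ℂ) (x : Space m) => (‖x‖ : ℂ) ^ (s - m) * F x)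
    (F' := fun (s : ℂ) (x : Space m) => (‖x‖ : ℂ) ^ (s - m) * Complex.log ‖x‖ * F x)
    (Metric.ball_mem_nhds s hδ) (Eventually.of_forall fun z =>
      ((measurable_norm_cpow _).mul hF.measurable).aestronglyMeasurable) (hF.integrable hs) ?_ ?_
    hbi ?_).2.differentiableAt
  · exact (((measurable_norm_cpow _).mul (Complex.measurable_log.comp
      (Complex.measurable_ofReal.comp measurable_norm))).mul hF.measurable).aestronglyMeasurable
  · filter_upwards [ae_ne_zero] with x hx z hz
    have hr := norm_pos_iff.2 hx
    have hz' : |(z.re - m) - (s.re - m)| ≤ δ := by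
      have := Complex.abs_re_le_norm (z - s)
      rw [Complex.sub_re] at this
      rw [sub_sub_sub_cancel_right]
      exact this.trans (by simpa [dist_eq_norm] using (Metric.mem_ball.1 hz).le)
    rw [norm_mul, norm_mul, norm_norm_cpow hx, ← Complex.ofReal_log hr.le, Complex.norm_real,
      Real.norm_eq_abs]
    have e1 := rpow_le_of_abs_sub_le hr hz'
    have e2 := abs_log_le_rpow_add hr hδ
    calc ‖x‖ ^ (z - m : ℂ).re * |Real.log ‖x‖| * ‖F x‖
        ≤ ‖x‖ ^ (s.re - m) * (‖x‖ ^ δ + ‖x‖ ^ (-δ)) * ((‖x‖ ^ δ + ‖x‖ ^ (-δ)) / δ) * ‖F x‖ := by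
          gcongr
          simpa using e1
      _ = bound x := by
          have a1 : ‖x‖ ^ (s.re + 2 * δ - m) = ‖x‖ ^ (s.re - m) * (‖x‖ ^ δ * ‖x‖ ^ δ) := by
            rw [← Real.rpow_add hr, ← Real.rpow_add hr]; ring_nf
          have a2 : ‖x‖ ^ (s.re - 2 * δ - m) = ‖x‖ ^ (s.re - m) * (‖x‖ ^ (-δ) * ‖x‖ ^ (-δ)) := by
            rw [← Real.rpow_add hr, ← Real.rpow_add hr]; ring_nf
          have a3 : ‖x‖ ^ δ * ‖x‖ ^ (-δ) = 1 := by rw [← Real.rpow_add hr]; simp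
          simp only [hbound]
          rw [a1, a2, div_eq_mul_inv]
          linear_combination (2 * δ⁻¹ * ‖x‖ ^ (s.re - m) * ‖F x‖) * a3
  · filter_upwards [ae_ne_zero] with x hx z _
    have hr : (‖x‖ : ℂ) ≠ 0 := by simpa using hx
    have := ((hasDerivAt_id z).sub_const (m : ℂ)).const_cpow (c := (‖x‖ : ℂ)) (Or.inl hr)
    simpa using this.mul_const (F x)

theorem measurableSet_norm_gt (ε : ℝ) : MeasurableSet {x : Space m | ε < ‖x‖} :=
  measurableSet_lt measurable_const measurable_norm

theorem tendsto_setIntegral_norm_gt [NeZero m] {G : Space m → ℂ} (hG : Integrable G) :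
    Tendsto (fun ε : ℝ => ∫ x in {x : Space m | ε < ‖x‖}, G x) (𝓝[>] 0) (𝓝 (∫ x, G x)) := by
  simp_rw [← integral_indicator (measurableSet_norm_gt _)]
  refine tendsto_integral_filter_of_dominated_convergence (fun x => ‖G x‖)
    (Eventually.of_forall fun ε => hG.aestronglyMeasurable.indicator (measurableSet_norm_gt ε))
    (Eventually.of_forall fun ε => Eventually.of_forall fun x => norm_indicator_le_norm_self _ _)
    hG.norm ?_
  filter_upwards [ae_ne_zero] with x hx
  refine tendsto_const_nhds.congr' ?_
  have : ∀ᶠ ε in 𝓝[>] (0 : ℝ), ε < ‖x‖ :=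
    nhdsWithin_le_nhds (eventually_lt_nhds (norm_pos_iff.2 hx))
  filter_upwards [this] with ε hε
  rw [Set.indicator_of_mem (by exact hε)]

/-- The finite part at the origin of `∫ |x| ^ (s - m) f(x) dx`. -/
def HasRadialFinitePart (f : Space m → ℂ) (s v : ℂ) : Prop :=
  HasFinitePart (𝓝[>] (0 : ℝ))
    (fun ε => ∫ x in {x : Space m | ε < ‖x‖}, (‖x‖ : ℂ) ^ (s - m) * f x) v

theorem HasRadialFinitePart.unique {f : Space m → ℂ} {s v w : ℂ}
    (hv : HasRadialFinitePart f s v) (hw : HasRadialFinitePart f s w) : v = w :=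
  HasFinitePart.unique_zero hv hw

theorem RadialBound.hasRadialFinitePart [NeZero m] {F : Space m → ℂ} {N : ℕ}
    (hF : RadialBound F N) {s : ℂ} (hs : -(N : ℝ) < s.re) :
    HasRadialFinitePart F s (∫ x, (‖x‖ : ℂ) ^ (s - m) * F x) :=
  HasFinitePart.of_tendsto (tendsto_setIntegral_norm_gt (hF.integrable hs))

theorem setIntegral_annulus_cpow [NeZero m] {A : Space m → ℂ} (hA : IsAngular A) {z : ℂ}
    {ε : ℝ} (hε : 0 < ε) (hε1 : ε < 1) :
    ∫ x in {x : Space m | ε < ‖x‖}, (‖x‖ : ℂ) ^ (z - m) * (Metric.ball 0 1).indicator A x =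
      sphereIntegral A * ∫ r in ε..1, (r : ℂ) ^ (z - 1) := by
  have h := integral_norm_mul_angular
    ((Set.Ioo ε 1).indicator fun r : ℝ => (r : ℂ) ^ (z - m)) hA
  rw [← integral_indicator (measurableSet_norm_gt _)]
  have e1 : ∫ x : Space m, (Set.Ioo ε 1).indicator (fun r : ℝ => (r : ℂ) ^ (z - m)) ‖x‖ * A x =
      ∫ x, {x : Space m | ε < ‖x‖}.indicator
        (fun x => (‖x‖ : ℂ) ^ (z - m) * (Metric.ball 0 1).indicator A x) x := by
    congr 1
    ext x
    by_cases h1 : ε < ‖x‖ <;> by_cases h2 : ‖x‖ < 1 <;> simp [Set.indicator, h1, h2]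
  rw [← e1, h]
  congr 1
  rw [intervalIntegral.integral_of_le hε1.le, integral_Ioc_eq_integral_Ioo,
    ← integral_indicator measurableSet_Ioi, ← integral_indicator measurableSet_Ioo]
  congr 1
  ext r
  by_cases h1 : r ∈ Set.Ioo ε 1
  · have hr : 0 < r := hε.trans h1.1
    rw [Set.indicator_of_mem (show r ∈ Set.Ioi 0 from hr), Set.indicator_of_mem h1,
      Set.indicator_of_mem h1, ← Complex.cpow_natCast, ← Complex.cpow_add _ _ (by exact_mod_cast hr.ne')]
    congr 1
    rw [Nat.cast_sub (Nat.one_le_iff_ne_zero.2 (NeZero.ne m))]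
    push_cast; ring
  · by_cases h2 : r ∈ Set.Ioi (0 : ℝ) <;> simp [h1, h2]

theorem hasRadialFinitePart_indicator_angular [NeZero m] {A : Space m → ℂ} (hA : IsAngular A)
    {z : ℂ} (hz : z = 0 → sphereIntegral A = 0) :
    HasRadialFinitePart ((Metric.ball 0 1).indicator A) z (sphereIntegral A / z) := by
  have hev : ∀ᶠ ε in 𝓝[>] (0 : ℝ), 0 < ε ∧ ε < 1 := by
    filter_upwards [Ioo_mem_nhdsGT (zero_lt_one (α := ℝ))] with ε hε using hε
  by_cases h0 : z = 0
  · rw [hz h0, zero_div]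
    refine HasFinitePart.zero.congr' ?_
    filter_upwards [hev] with ε hε
    rw [setIntegral_annulus_cpow hA hε.1 hε.2, hz h0, zero_mul]
  · have h1 : HasFinitePart (𝓝[>] (0 : ℝ)) (fun ε : ℝ => sphereIntegral A / z +
        ((ε : ℂ) ^ z) • (-(sphereIntegral A / z))) (sphereIntegral A / z + 0) :=
      (HasFinitePart.of_tendsto tendsto_const_nhds).add (HasFinitePart.cpow_smul h0 _)
    rw [add_zero] at h1
    refine h1.congr' ?_
    filter_upwards [hev] with ε hε
    rw [setIntegral_annulus_cpow hA hε.1 hε.2, integral_cpow, sub_add_cancel, Complex.ofReal_one,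
      Complex.one_cpow, smul_eq_mul]
    · ring
    · refine Or.inr ⟨fun h => h0 (by linear_combination h), fun h => ?_⟩
      rw [Set.uIcc_of_le hε.2.le] at h
      exact absurd h.1 (not_le.2 hε.1)

/-- `f` has the asymptotic expansion `∑ |x| ^ n A n` at the origin, with `A n` homogeneous of degree
zero, and decays rapidly at infinity. -/
structure HasRadialExpansion (f : Space m → ℂ) (A : ℕ → Space m → ℂ) : Prop where
  measurable : Measurable f
  angular : ∀ n, IsAngular (A n)
  near : ∀ N : ℕ, ∃ C, ∀ x, x ≠ 0 → ‖x‖ < 1 →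
    ‖f x - ∑ n ∈ Finset.range N, (‖x‖ : ℂ) ^ n * A n x‖ ≤ C * ‖x‖ ^ N
  far : ∀ M : ℕ, ∃ C, ∀ x, 1 ≤ ‖x‖ → ‖x‖ ^ M * ‖f x‖ ≤ C

/-- The remainder of order `N` of the expansion. -/
noncomputable def radialRemainder (N : ℕ) (f : Space m → ℂ) (A : ℕ → Space m → ℂ) (x : Space m) :
    ℂ :=
  f x - ∑ n ∈ Finset.range N, (‖x‖ : ℂ) ^ n * (Metric.ball 0 1).indicator (A n) x

theorem HasRadialExpansion.radialBound {f : Space m → ℂ} {A : ℕ → Space m → ℂ}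
    (h : HasRadialExpansion f A) (N : ℕ) : RadialBound (radialRemainder N f A) N where
  measurable := by
    refine h.measurable.sub (Finset.measurable_sum _ fun n _ => ?_)
    exact ((Complex.measurable_ofReal.comp measurable_norm).pow_const n).mul
      ((h.angular n).measurable.indicator measurableSet_ball)
  near := by
    obtain ⟨C, hC⟩ := h.near N
    refine ⟨C, fun x hx hx1 => ?_⟩
    have hb : x ∈ Metric.ball (0 : Space m) 1 := by simpa using hx1
    simpa [radialRemainder, Set.indicator_of_mem hb] using hC x hx hx1
  far M := by
    obtain ⟨C, hC⟩ := h.far M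
    refine ⟨C, fun x hx1 => ?_⟩
    have hb : x ∉ Metric.ball (0 : Space m) 1 := by simpa using hx1
    simpa [radialRemainder, Set.indicator_of_notMem hb] using hC x hx1

theorem HasRadialExpansion.mul_angular {f : Space m → ℂ} {A : ℕ → Space m → ℂ}
    (h : HasRadialExpansion f A) {B : Space m → ℂ} (hB : IsAngular B) :
    HasRadialExpansion (fun x => B x * f x) (fun n x => B x * A n x) where
  measurable := hB.measurable.mul h.measurable
  angular n := hB.mul (h.angular n)
  near N := by
    obtain ⟨D, hD⟩ := hB.bounded
    obtain ⟨C, hC⟩ := h.near N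
    refine ⟨D * C, fun x hx hx1 => ?_⟩
    have : B x * f x - ∑ n ∈ Finset.range N, (‖x‖ : ℂ) ^ n * (B x * A n x) =
        B x * (f x - ∑ n ∈ Finset.range N, (‖x‖ : ℂ) ^ n * A n x) := by
      rw [mul_sub, Finset.mul_sum]
      congr 1
      exact Finset.sum_congr rfl fun n _ => by ring
    rw [this, norm_mul, mul_assoc]
    exact mul_le_mul (hD x) (hC x hx hx1) (norm_nonneg _) ((norm_nonneg _).trans (hD x))
  far M := by
    obtain ⟨D, hD⟩ := hB.bounded
    obtain ⟨C, hC⟩ := h.far M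
    refine ⟨D * C, fun x hx => ?_⟩
    rw [norm_mul, mul_left_comm]
    exact mul_le_mul (hD x) (hC x hx) (by positivity) ((norm_nonneg _).trans (hD x))

/-- The explicit value of the finite part of `∫ |x| ^ (s - m) f(x) dx`, for `Re s > -N`. -/
noncomputable def radialValue (N : ℕ) (f : Space m → ℂ) (A : ℕ → Space m → ℂ) (s : ℂ) : ℂ :=
  (∫ x, (‖x‖ : ℂ) ^ (s - m) * radialRemainder N f A x) +
    ∑ n ∈ Finset.range N, sphereIntegral (A n) / (s + n)

theorem integrableOn_norm_gt [NeZero m] {f : Space m → ℂ} (hf : Measurable f) {s : ℂ} {ε : ℝ}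
    (hε : 0 < ε) (hb : ∃ C, ∀ x, ε < ‖x‖ → ‖x‖ < 1 → ‖f x‖ ≤ C)
    (hfar : ∀ M : ℕ, ∃ C, ∀ x, 1 ≤ ‖x‖ → ‖x‖ ^ M * ‖f x‖ ≤ C) :
    IntegrableOn (fun x => (‖x‖ : ℂ) ^ (s - m) * f x) {x : Space m | ε < ‖x‖} := by
  obtain ⟨N, hN⟩ := exists_nat_gt (-s.re)
  have hF : RadialBound ({x : Space m | ε < ‖x‖}.indicator f) N := by
    refine ⟨hf.indicator (measurableSet_norm_gt ε), ?_, fun M => ?_⟩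
    · obtain ⟨C, hC⟩ := hb
      refine ⟨|C| * (ε ^ N)⁻¹, fun x hx hx1 => ?_⟩
      by_cases h : ε < ‖x‖
      · rw [Set.indicator_of_mem (by exact h)]
        have : 1 ≤ (ε ^ N)⁻¹ * ‖x‖ ^ N := by
          rw [← div_eq_inv_mul, one_le_div (by positivity)]
          gcongr
        calc ‖f x‖ ≤ |C| * 1 := by rw [mul_one]; exact (hC x h hx1).trans (le_abs_self C)
          _ ≤ _ := by rw [mul_assoc]; gcongr
      · rw [Set.indicator_of_notMem (by exact h)]
        simp only [norm_zero]
        positivity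
    · obtain ⟨C, hC⟩ := hfar M
      refine ⟨C, fun x hx => le_trans ?_ (hC x hx)⟩
      gcongr
      exact norm_indicator_le_norm_self _ _
  have := hF.integrable (s := s) (by linarith)
  rw [← integrable_indicator_iff (measurableSet_norm_gt ε)]
  refine this.congr (Eventually.of_forall fun x => ?_)
  simp only [Set.indicator]
  split_ifs <;> simp

theorem HasRadialExpansion.hasRadialFinitePart [NeZero m] {f : Space m → ℂ}
    {A : ℕ → Space m → ℂ} (h : HasRadialExpansion f A) {N : ℕ} {s : ℂ} (hs : -(N : ℝ) < s.re)
    (h0 : ∀ n : ℕ, s + n = 0 → sphereIntegral (A n) = 0) :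
    HasRadialFinitePart f s (radialValue N f A s) := by
  have h1 := ((h.radialBound N).hasRadialFinitePart hs).add
    (HasFinitePart.sum (S := Finset.range N) fun n _ =>
      hasRadialFinitePart_indicator_angular (h.angular n) (h0 n))
  refine h1.congr' ?_
  filter_upwards [self_mem_nhdsWithin] with ε hε
  have hε' : (0 : ℝ) < ε := hε
  have hi : ∀ n : ℕ, IntegrableOn
      (fun x => (‖x‖ : ℂ) ^ (s + n - m) * (Metric.ball 0 1).indicator (A n) x)
      {x : Space m | ε < ‖x‖} := fun n => by
    obtain ⟨C, hC⟩ := (h.angular n).bounded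
    refine integrableOn_norm_gt ((h.angular n).measurable.indicator measurableSet_ball) hε'
      ⟨C, fun x _ _ => (norm_indicator_le_norm_self _ _).trans (hC x)⟩ fun M => ⟨0, fun x hx => ?_⟩
    rw [Set.indicator_of_notMem (by simpa using hx)]
    simp
  rw [← integral_finsetSum _ fun n _ => hi n, ← integral_add
    (((h.radialBound N).integrable hs).integrableOn) (integrable_finsetSum _ fun n _ => hi n)]
  refine setIntegral_congr_fun (measurableSet_norm_gt ε) fun x hx => ?_
  have hx0 : (‖x‖ : ℂ) ≠ 0 := by exact_mod_cast (hε'.trans hx).ne'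
  simp only [radialRemainder, mul_sub, Finset.mul_sum]
  rw [← eq_sub_iff_add_eq', sub_sub_cancel]
  refine Finset.sum_congr rfl fun n _ => ?_
  rw [← mul_assoc, show s + n - m = (s - m) + n by ring, Complex.cpow_add _ _ hx0,
    Complex.cpow_natCast]

theorem HasRadialExpansion.differentiableAt [NeZero m] {f : Space m → ℂ}
    {A : ℕ → Space m → ℂ} (h : HasRadialExpansion f A) {N : ℕ} {s : ℂ} (hs : -(N : ℝ) < s.re)
    (h0 : ∀ n : ℕ, s + n = 0 → sphereIntegral (A n) = 0) :
    DifferentiableAt ℂ (radialValue N f A) s := by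
  refine ((h.radialBound N).differentiableAt hs).add ?_
  refine DifferentiableAt.fun_sum fun n _ => ?_
  by_cases hn : s + n = 0
  · simp only [h0 n hn, zero_div]
    exact differentiableAt_const _
  · exact (differentiableAt_const _).div (by fun_prop) hn

/-- The finite part of `∫ |x| ^ (s - m) f(x) dx`, as a function of `s`. -/
noncomputable def radialFp (f : Space m → ℂ) (A : ℕ → Space m → ℂ) (s : ℂ) : ℂ :=
  radialValue (⌊|s.re|⌋₊ + 1) f A s

theorem neg_floor_add_one_lt (x : ℝ) : -((⌊|x|⌋₊ + 1 : ℕ) : ℝ) < x := by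
  have := Nat.lt_floor_add_one |x|
  have := neg_abs_le x
  push_cast
  linarith

theorem HasRadialExpansion.hasRadialFinitePart_radialFp [NeZero m] {f : Space m → ℂ}
    {A : ℕ → Space m → ℂ} (h : HasRadialExpansion f A) {s : ℂ}
    (h0 : ∀ n : ℕ, s + n = 0 → sphereIntegral (A n) = 0) :
    HasRadialFinitePart f s (radialFp f A s) :=
  h.hasRadialFinitePart (neg_floor_add_one_lt _) h0

theorem isOpen_setOf_add_natCast (κ : ℕ → ℂ) :
    IsOpen {s : ℂ | ∀ n : ℕ, s + n = 0 → κ n = 0} := by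
  have h2 : Topology.IsClosedEmbedding (fun n : ℤ => (n : ℂ)) := Complex.isClosedEmbedding_intCast
  have h3 : {s : ℂ | ∀ n : ℕ, s + n = 0 → κ n = 0}ᶜ =
      (fun n : ℤ => (n : ℂ)) '' {k | ∃ n : ℕ, k = -(n : ℤ) ∧ κ n ≠ 0} := by
    ext s
    simp only [Set.mem_compl_iff, Set.mem_ofPred_eq, not_forall, Set.mem_image]
    constructor
    · rintro ⟨n, hn, hk⟩
      exact ⟨-n, ⟨n, rfl, hk⟩, by push_cast; linear_combination -hn⟩
    · rintro ⟨_, ⟨n, rfl, hk⟩, rfl⟩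
      exact ⟨n, by push_cast; ring, hk⟩
  rw [← isClosed_compl_iff, h3]
  exact h2.isClosedMap _ (isClosed_discrete _)

theorem countable_compl_setOf_add_natCast (κ : ℕ → ℂ) :
    {s : ℂ | ∀ n : ℕ, s + n = 0 → κ n = 0}ᶜ.Countable := by
  refine (Set.countable_range fun n : ℕ => -(n : ℂ)).mono fun s hs => ?_
  simp only [Set.mem_compl_iff, Set.mem_ofPred_eq, not_forall] at hs
  obtain ⟨n, hn, _⟩ := hs
  exact ⟨n, by linear_combination -hn⟩

theorem HasRadialExpansion.differentiableAt_radialFp [NeZero m] {f : Space m → ℂ}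
    {A : ℕ → Space m → ℂ} (h : HasRadialExpansion f A) {s : ℂ}
    (h0 : ∀ n : ℕ, s + n = 0 → sphereIntegral (A n) = 0) :
    DifferentiableAt ℂ (radialFp f A) s := by
  refine (h.differentiableAt (neg_floor_add_one_lt s.re) h0).congr_of_eventuallyEq ?_
  have e2 : ∀ᶠ z in 𝓝 s, -((⌊|s.re|⌋₊ + 1 : ℕ) : ℝ) < z.re :=
    Complex.continuous_re.continuousAt.eventually (lt_mem_nhds (neg_floor_add_one_lt s.re))
  filter_upwards [(isOpen_setOf_add_natCast fun n => sphereIntegral (A n)).mem_nhds h0, e2]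
    with z hz hz2
  exact (h.hasRadialFinitePart_radialFp hz).unique (h.hasRadialFinitePart hz2 hz)

/-- Analytic continuation of an identity between two radial integrals from the strip of
convergence. -/
theorem radialFp_continuation [NeZero m] {f g : Space m → ℂ} {A B : ℕ → Space m → ℂ}
    (hf : HasRadialExpansion f A) (hg : HasRadialExpansion g B) {a b : ℂ → ℂ}
    (ha : Differentiable ℂ a) (hb : Differentiable ℂ b)
    (hstrip : ∀ μ : ℂ, 0 < μ.re → μ.re < m →
      a μ * ∫ x, (‖x‖ : ℂ) ^ (μ - m) * f x = b μ * ∫ x, (‖x‖ : ℂ) ^ (m - μ - m) * g x)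
    {μ : ℂ} (h0 : ∀ n : ℕ, μ + n = 0 → sphereIntegral (A n) = 0)
    (h1 : ∀ n : ℕ, m - μ + n = 0 → sphereIntegral (B n) = 0) :
    a μ * radialFp f A μ = b μ * radialFp g B (m - μ) := by
  have hm : (0 : ℝ) < m := by exact_mod_cast Nat.pos_of_ne_zero (NeZero.ne m)
  have hc : Continuous fun s : ℂ => (m : ℂ) - s := by fun_prop
  set U : Set ℂ := {s : ℂ | ∀ n : ℕ, s + n = 0 → sphereIntegral (A n) = 0} ∩
    (fun s : ℂ => (m : ℂ) - s) ⁻¹' {s : ℂ | ∀ n : ℕ, s + n = 0 → sphereIntegral (B n) = 0}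
    with hU
  have hUo : IsOpen U := (isOpen_setOf_add_natCast _).inter
    ((isOpen_setOf_add_natCast _).preimage hc)
  have hUc : Uᶜ.Countable := by
    rw [hU, Set.compl_inter, ← Set.preimage_compl]
    refine (countable_compl_setOf_add_natCast _).union
      ((countable_compl_setOf_add_natCast _).preimage fun x y h => ?_)
    simpa using h
  have hUp : IsPreconnected U := by
    have := hUc.isConnected_compl_of_one_lt_rank (by simp)
    rw [compl_compl] at this
    exact this.isPreconnected
  have hA : AnalyticOnNhd ℂ (fun s => a s * radialFp f A s) U := by
    refine DifferentiableOn.analyticOnNhd (fun s hs => ?_) hUo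
    exact ((ha s).mul (hf.differentiableAt_radialFp hs.1)).differentiableWithinAt
  have hB : AnalyticOnNhd ℂ (fun s => b s * radialFp g B (m - s)) U := by
    refine DifferentiableOn.analyticOnNhd (fun s hs => ?_) hUo
    exact ((hb s).mul (DifferentiableAt.comp (g := radialFp g B) s
      (hg.differentiableAt_radialFp hs.2) (by fun_prop))).differentiableWithinAt
  have hre : ∀ (s : ℂ) (n : ℕ), 0 < s.re → s + n ≠ 0 := fun s n hs h => by
    have := congrArg Complex.re h
    simp only [Complex.add_re, Complex.natCast_re, Complex.zero_re] at this
    have : (0 : ℝ) ≤ n := n.cast_nonneg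
    linarith
  have hstrip' : ∀ s : ℂ, 0 < s.re → s.re < m →
      s ∈ U ∧ a s * radialFp f A s = b s * radialFp g B (m - s) := fun s hs0 hs1 => by
    have hs1' : 0 < ((m : ℂ) - s).re := by simpa using hs1
    have k0 : ∀ n : ℕ, s + n = 0 → sphereIntegral (A n) = 0 := fun n h => absurd h (hre s n hs0)
    have k1 : ∀ n : ℕ, m - s + n = 0 → sphereIntegral (B n) = 0 :=
      fun n h => absurd h (hre _ n hs1')
    refine ⟨⟨k0, k1⟩, ?_⟩
    have e : ∀ h : Space m → ℂ, ∀ D, radialRemainder 0 h D = h := fun h D => by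
      ext x; simp [radialRemainder]
    have e1 := (hf.radialBound 0).hasRadialFinitePart (s := s) (by simpa using hs0)
    have e2 := (hg.radialBound 0).hasRadialFinitePart (s := m - s) (by simpa using hs1)
    rw [e] at e1 e2
    rw [(hf.hasRadialFinitePart_radialFp k0).unique e1,
      (hg.hasRadialFinitePart_radialFp k1).unique e2]
    exact hstrip s hs0 hs1
  have hm1 : 0 < ((m / 2 : ℝ) : ℂ).re := by rw [Complex.ofReal_re]; linarith
  have hm2 : ((m / 2 : ℝ) : ℂ).re < m := by rw [Complex.ofReal_re]; linarith
  have hz : ((m / 2 : ℝ) : ℂ) ∈ U := (hstrip' _ hm1 hm2).1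
  refine hA.eqOn_of_preconnected_of_eventuallyEq hB hUp hz ?_ ⟨h0, h1⟩
  have o1 : ∀ᶠ s : ℂ in 𝓝 ((m / 2 : ℝ) : ℂ), 0 < s.re :=
    Complex.continuous_re.continuousAt.eventually (lt_mem_nhds hm1)
  have o2 : ∀ᶠ s : ℂ in 𝓝 ((m / 2 : ℝ) : ℂ), s.re < m :=
    Complex.continuous_re.continuousAt.eventually (gt_mem_nhds hm2)
  filter_upwards [o1, o2] with s h1 h2 using (hstrip' s h1 h2).2

/-! ### Taylor expansion of smooth functions -/

/-- The Taylor coefficients of `f` at the origin, as functions homogeneous of degree zero. -/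
noncomputable def taylorAngular (f : Space m → ℂ) (n : ℕ) (x : Space m) : ℂ :=
  ((n.factorial : ℝ)⁻¹ • iteratedFDeriv ℝ n f 0 fun _ => x) / (‖x‖ : ℂ) ^ n

theorem taylorAngular_mul_pow (f : Space m → ℂ) (n : ℕ) {x : Space m} (hx : x ≠ 0) :
    (‖x‖ : ℂ) ^ n * taylorAngular f n x =
      (n.factorial : ℝ)⁻¹ • iteratedFDeriv ℝ n f 0 fun _ => x := by
  have : (‖x‖ : ℂ) ≠ 0 := by simpa using hx
  rw [taylorAngular]
  field_simp

theorem isAngular_taylorAngular (f : Space m → ℂ) (n : ℕ) : IsAngular (taylorAngular f n) where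
  measurable := by
    have h : Continuous fun x : Space m => iteratedFDeriv ℝ n f 0 fun _ : Fin n => x :=
      (iteratedFDeriv ℝ n f 0).cont.comp (continuous_pi fun _ => continuous_id)
    exact (h.const_smul (n.factorial : ℝ)⁻¹).measurable.div
      ((Complex.measurable_ofReal.comp measurable_norm).pow_const n)
  bounded := by
    refine ⟨(n.factorial : ℝ)⁻¹ * ‖iteratedFDeriv ℝ n f 0‖, fun x => ?_⟩
    rw [taylorAngular, norm_div, norm_smul, norm_pow, Complex.norm_real, norm_norm,
      Real.norm_of_nonneg (by positivity)]
    refine div_le_of_le_mul₀ (by positivity) (by positivity) ?_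
    rw [mul_assoc]
    gcongr
    simpa using (iteratedFDeriv ℝ n f 0).le_opNorm fun _ => x
  smul_eq t x ht := by
    have h := (iteratedFDeriv ℝ n f 0).map_smul_univ (fun _ => t) (fun _ => x)
    simp only [Finset.prod_const, Finset.card_univ, Fintype.card_fin] at h
    have ht' : (t : ℂ) ≠ 0 := by exact_mod_cast ht.ne'
    simp only [taylorAngular]
    rw [h, norm_smul, Real.norm_of_nonneg ht.le, smul_comm, Complex.ofReal_mul, mul_pow,
      Complex.real_smul, Complex.ofReal_pow, mul_div_mul_left _ _ (pow_ne_zero _ ht')]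

theorem taylorAngular_neg (f : Space m → ℂ) (n : ℕ) (x : Space m) :
    taylorAngular f n (-x) = (-1) ^ n * taylorAngular f n x := by
  have h := (iteratedFDeriv ℝ n f 0).map_smul_univ (fun _ => (-1 : ℝ)) (fun _ => x)
  simp only [Finset.prod_const, Finset.card_univ, Fintype.card_fin, neg_smul, one_smul] at h
  simp only [taylorAngular]
  rw [h, norm_neg, smul_comm, Complex.real_smul]
  push_cast
  ring

theorem exists_norm_sub_taylor_le {f : Space m → ℂ} (hf : ContDiff ℝ (⊤ : ℕ∞) f) (N : ℕ) :
    ∃ C, ∀ x, x ≠ 0 → ‖x‖ < 1 →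
      ‖f x - ∑ n ∈ Finset.range N, (‖x‖ : ℂ) ^ n * taylorAngular f n x‖ ≤ C * ‖x‖ ^ N := by
  have hcont : Continuous (iteratedFDeriv ℝ N f) :=
    hf.continuous_iteratedFDeriv (by exact_mod_cast le_top)
  obtain ⟨C, hC⟩ := (isCompact_closedBall (0 : Space m) 1).exists_bound_of_continuousOn
    hcont.continuousOn
  have hC0 : 0 ≤ C := (norm_nonneg _).trans (hC 0 (by simp))
  rcases N with _ | k
  · refine ⟨C, fun x _ hx1 => ?_⟩
    simpa using hC x (by simpa using hx1.le)
  · refine ⟨(k.factorial : ℝ)⁻¹ * C, fun x hx hx1 => ?_⟩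
    have h := map_add_eq_sum_add_integral_iteratedFDeriv (f := f) (x := 0) (y := x) (n := k)
      fun t _ => (hf.of_le (by exact_mod_cast le_top)).contDiffAt
    simp only [zero_add] at h
    rw [Finset.sum_congr rfl fun n _ => taylorAngular_mul_pow f n hx, sub_eq_of_eq_add' h,
      norm_smul, Real.norm_of_nonneg (by positivity), mul_assoc]
    gcongr
    have := intervalIntegral.norm_integral_le_of_norm_le_const (a := 0) (b := 1)
      (C := C * ‖x‖ ^ (k + 1))
      (f := fun t : ℝ => (1 - t) ^ k • iteratedFDeriv ℝ (k + 1) f (t • x) fun _ => x) ?_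
    · simpa using this
    · intro t ht
      rw [Set.uIoc_of_le zero_le_one] at ht
      have h1 : ‖(1 - t) ^ k‖ ≤ 1 := by
        rw [norm_pow]
        refine pow_le_one₀ (norm_nonneg _) ?_
        rw [Real.norm_eq_abs, abs_le]
        constructor <;> linarith [ht.1, ht.2]
      have h2 : ‖iteratedFDeriv ℝ (k + 1) f (t • x)‖ ≤ C := by
        refine hC _ ?_
        rw [mem_closedBall_zero_iff, norm_smul, Real.norm_of_nonneg ht.1.le]
        nlinarith [ht.1, ht.2, norm_nonneg x]
      rw [norm_smul]
      calc _ ≤ 1 * (‖iteratedFDeriv ℝ (k + 1) f (t • x)‖ * ∏ _i : Fin (k + 1), ‖x‖) := by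
            gcongr
            exact (iteratedFDeriv ℝ (k + 1) f (t • x)).le_opNorm _
        _ ≤ _ := by
            rw [one_mul, Finset.prod_const, Finset.card_univ, Fintype.card_fin]
            gcongr

theorem hasRadialExpansion_schwartz (φ : 𝓢(Space m, ℂ)) :
    HasRadialExpansion φ (taylorAngular φ) where
  measurable := φ.continuous.measurable
  angular := isAngular_taylorAngular φ
  near := exists_norm_sub_taylor_le (φ.smooth ⊤)
  far M := by
    obtain ⟨C, hC⟩ := φ.decay M 0
    exact ⟨C, fun x _ => by simpa using hC.2 x⟩

theorem radialBound_schwartz (φ : 𝓢(Space m, ℂ)) : RadialBound φ 0 where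
  measurable := φ.continuous.measurable
  near := by simpa using exists_norm_sub_taylor_le (φ.smooth ⊤) 0
  far := (hasRadialExpansion_schwartz φ).far

/-- The coordinate `x j / |x|` of the direction of `x`. -/
noncomputable def direction (j : Fin m) (x : Space m) : ℂ := ((x j / ‖x‖ : ℝ) : ℂ)

theorem abs_apply_le_norm (x : Space m) (j : Fin m) : |x j| ≤ ‖x‖ := by
  simpa using PiLp.norm_apply_le x j

theorem isAngular_direction (j : Fin m) : IsAngular (direction (m := m) j) where
  measurable := by
    refine Complex.measurable_ofReal.comp (Measurable.div ?_ measurable_norm)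
    exact (EuclideanSpace.proj (𝕜 := ℝ) j).continuous.measurable
  bounded := by
    refine ⟨1, fun x => ?_⟩
    rw [direction, Complex.norm_real, norm_div, norm_norm, Real.norm_eq_abs]
    exact div_le_one_of_le₀ (abs_apply_le_norm x j) (norm_nonneg x)
  smul_eq t x ht := by
    simp only [direction, PiLp.smul_apply, smul_eq_mul, norm_smul, Real.norm_of_nonneg ht.le]
    rw [mul_div_mul_left _ _ ht.ne']

theorem direction_neg (j : Fin m) (x : Space m) : direction j (-x) = -direction j x := by
  simp [direction, neg_div]

theorem sphereIntegral_taylorAngular_of_odd [NeZero m] (f : Space m → ℂ) {n : ℕ} (hn : Odd n) :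
    sphereIntegral (taylorAngular f n) = 0 :=
  sphereIntegral_eq_zero_of_odd (isAngular_taylorAngular f n) fun x => by
    rw [taylorAngular_neg, hn.neg_one_pow]; ring

theorem sphereIntegral_direction_mul_taylorAngular_of_even [NeZero m] (f : Space m → ℂ) {n : ℕ}
    (hn : Even n) (j : Fin m) :
    sphereIntegral (fun x => direction j x * taylorAngular f n x) = 0 :=
  sphereIntegral_eq_zero_of_odd ((isAngular_direction j).mul (isAngular_taylorAngular f n))
    fun x => by rw [taylorAngular_neg, hn.neg_one_pow, direction_neg]; ring

open FourierTransform

/-! ### Gaussian integrals and the functional equation in the strip -/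

/-- The integral of `p` against the Gaussian `exp (-π t |x| ^ 2)`. -/
noncomputable def gaussianIntegral (p : Space m → ℂ) (t : ℝ) : ℂ :=
  ∫ x, p x * Complex.exp (-(Real.pi * t) * ‖x‖ ^ 2)

theorem integrableOn_rpow_mul_exp_neg {a r : ℝ} (ha : 0 < a) (hr : 0 < r) :
    IntegrableOn (fun t : ℝ => t ^ (a - 1) * Real.exp (-(r * t))) (Set.Ioi 0) := by
  by_contra h
  have h1 := Real.integral_rpow_mul_exp_neg_mul_Ioi ha hr
  rw [integral_undef h] at h1
  have : 0 < (1 / r) ^ a * Real.Gamma a := by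
    have := Real.Gamma_pos_of_pos ha
    positivity
  linarith

theorem mellin_gaussianIntegral [NeZero m] {p : Space m → ℂ} (hp : Measurable p) {a : ℂ}
    (ha : 0 < a.re) (hi : Integrable fun x => ‖x‖ ^ (-(2 * a.re)) * ‖p x‖) :
    mellin (gaussianIntegral p) a =
      Complex.Gamma a * (Real.pi : ℂ) ^ (-a) * ∫ x, (‖x‖ : ℂ) ^ (-(2 * a)) * p x := by
  have hexp : ∀ (t : ℝ) (x : Space m), Complex.exp (-(Real.pi * t) * ‖x‖ ^ 2) =
      Complex.exp (-((Real.pi * ‖x‖ ^ 2 : ℝ) * t)) := fun t x => by push_cast; ring_nf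
  set f : ℝ → Space m → ℂ := fun t x =>
    (t : ℂ) ^ (a - 1) * (p x * Complex.exp (-(Real.pi * t) * ‖x‖ ^ 2)) with hf
  have hnorm : ∀ (x : Space m) (t : ℝ), 0 < t → ‖f t x‖ =
      ‖p x‖ * (t ^ (a.re - 1) * Real.exp (-(Real.pi * ‖x‖ ^ 2 * t))) := fun x t ht => by
    simp only [hf]
    rw [hexp, norm_mul, norm_mul, Complex.norm_cpow_eq_rpow_re_of_pos ht, ← Complex.ofReal_mul,
      ← Complex.ofReal_neg, Complex.norm_exp_ofReal]
    simp only [Complex.sub_re, Complex.one_re]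
    ring
  have hmeas : Measurable (Function.uncurry f) := by
    simp only [hf, Function.uncurry_def]
    refine Measurable.mul ?_ ((hp.comp measurable_snd).mul ?_)
    · exact (Complex.measurable_ofReal.comp measurable_fst).pow_const _
    · refine Complex.measurable_exp.comp ?_
      have h1 : Measurable fun q : ℝ × Space m => (q.1 : ℂ) :=
        Complex.measurable_ofReal.comp measurable_fst
      have h2 : Measurable fun q : ℝ × Space m => (‖q.2‖ : ℂ) :=
        Complex.measurable_ofReal.comp (measurable_norm.comp measurable_snd)
      exact ((h1.const_mul _).neg).mul (h2.pow_const 2)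
  have hint : Integrable (Function.uncurry f) ((volume.restrict (Set.Ioi 0)).prod volume) := by
    rw [integrable_prod_iff' hmeas.aestronglyMeasurable]
    have hr : ∀ x : Space m, x ≠ 0 → 0 < Real.pi * ‖x‖ ^ 2 := fun x hx => by
      have := norm_pos_iff.2 hx
      have := Real.pi_pos
      positivity
    constructor
    · filter_upwards [ae_ne_zero] with x hx
      refine ((integrableOn_rpow_mul_exp_neg ha (hr x hx)).const_mul ‖p x‖).mono'
        (hmeas.comp measurable_prodMk_right).aestronglyMeasurable ?_
      filter_upwards [ae_restrict_mem measurableSet_Ioi] with t ht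
      exact (hnorm x t ht).le
    · refine (hi.const_mul (Real.pi ^ (-a.re) * Real.Gamma a.re)).congr ?_
      filter_upwards [ae_ne_zero] with x hx
      have h1 : ∫ t in Set.Ioi (0 : ℝ), ‖f t x‖ = ∫ t in Set.Ioi (0 : ℝ),
          ‖p x‖ * (t ^ (a.re - 1) * Real.exp (-(Real.pi * ‖x‖ ^ 2 * t))) :=
        setIntegral_congr_fun measurableSet_Ioi fun t ht => hnorm x t ht
      simp only [Function.uncurry]
      rw [h1, integral_const_mul, Real.integral_rpow_mul_exp_neg_mul_Ioi ha (hr x hx), one_div,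
        Real.inv_rpow (hr x hx).le, ← Real.rpow_neg (hr x hx).le,
        Real.mul_rpow Real.pi_pos.le (by positivity), ← Real.rpow_natCast, ← Real.rpow_mul
        (norm_nonneg _)]
      push_cast
      ring_nf
  have h1 : mellin (gaussianIntegral p) a = ∫ t in Set.Ioi (0 : ℝ), ∫ x, f t x := by
    simp only [mellin, gaussianIntegral, hf, smul_eq_mul]
    congr 1
    ext t
    rw [integral_const_mul]
  rw [h1, integral_integral_swap hint, ← integral_const_mul]
  refine integral_congr_ae ?_
  filter_upwards [ae_ne_zero] with x hx
  have hx' := norm_pos_iff.2 hx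
  have hr : 0 < Real.pi * ‖x‖ ^ 2 := by have := Real.pi_pos; positivity
  have h2 : ∫ t in Set.Ioi (0 : ℝ), f t x = p x * ∫ t in Set.Ioi (0 : ℝ),
      (t : ℂ) ^ (a - 1) * Complex.exp (-((Real.pi * ‖x‖ ^ 2 : ℝ) * t)) := by
    rw [← integral_const_mul]
    congr 1
    ext t
    simp only [hf]
    rw [hexp]
    ring
  rw [h2, Complex.integral_cpow_mul_exp_neg_mul_Ioi ha hr, ← Complex.ofReal_one,
    ← Complex.ofReal_div, one_div, Complex.ofReal_inv, Complex.inv_cpow _ _ (by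
      rw [Complex.arg_ofReal_of_nonneg hr.le]; exact Real.pi_pos.ne), ← Complex.cpow_neg,
    Complex.ofReal_mul, Complex.mul_cpow_ofReal_nonneg Real.pi_pos.le (by positivity),
    Complex.ofReal_pow, neg_mul_eq_mul_neg 2 a]
  rw [show ((‖x‖ : ℂ) ^ 2) ^ (-a) = (‖x‖ : ℂ) ^ (2 * -a) by
    rw [show (2 : ℂ) * -a = ((2 : ℕ) : ℂ) * (-a) by norm_num, Complex.cpow_nat_mul' (x := ‖x‖)]
    · rw [Complex.arg_ofReal_of_nonneg hx'.le]; simpa using Real.pi_pos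
    · rw [Complex.arg_ofReal_of_nonneg hx'.le]; simpa using Real.pi_pos.le]
  ring

theorem integrable_gaussian {t : ℝ} (ht : 0 < t) :
    Integrable fun x : Space m => Complex.exp (-(Real.pi * t) * ‖x‖ ^ 2) := by
  have h : 0 < ((Real.pi : ℂ) * t).re := by
    rw [← Complex.ofReal_mul, Complex.ofReal_re]; exact mul_pos Real.pi_pos ht
  simpa using GaussianFourier.integrable_cexp_neg_mul_sq_norm_add h 0 (0 : Space m)

theorem gaussianIntegral_fourier (φ : 𝓢(Space m, ℂ)) {t : ℝ} (ht : 0 < t) :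
    gaussianIntegral (𝓕 φ : 𝓢(Space m, ℂ)) t = (t : ℂ) ^ (-((m : ℂ) / 2)) * gaussianIntegral φ t⁻¹ := by
  have hb : 0 < ((Real.pi : ℂ) * t).re := by
    rw [← Complex.ofReal_mul, Complex.ofReal_re]; exact mul_pos Real.pi_pos ht
  have ht' : (t : ℂ) ≠ 0 := by exact_mod_cast ht.ne'
  have hpi : (Real.pi : ℂ) ≠ 0 := by exact_mod_cast Real.pi_pos.ne'
  have h1 : ∫ ξ, 𝓕 (φ : Space m → ℂ) ξ * Complex.exp (-(Real.pi * t) * ‖ξ‖ ^ 2) =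
      ∫ x, φ x * 𝓕 (fun ξ : Space m => Complex.exp (-(Real.pi * t) * ‖ξ‖ ^ 2)) x := by
    simpa using! VectorFourier.integral_bilin_fourierIntegral_eq_flip (.mul ℂ ℂ)
      (L := innerₗ (Space m)) Real.continuous_fourierChar continuous_inner φ.integrable
      (integrable_gaussian ht)
  rw [gaussianIntegral, SchwartzMap.fourier_coe, h1, gaussianIntegral, ← integral_const_mul]
  congr 1
  ext x
  rw [fourier_gaussian_innerProductSpace hb, finrank_euclideanSpace_fin]
  have e1 : ((Real.pi : ℂ) / (Real.pi * t)) = ((t⁻¹ : ℝ) : ℂ) := by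
    push_cast; field_simp
  rw [e1, Complex.ofReal_inv, Complex.inv_cpow _ _ (by
      rw [Complex.arg_ofReal_of_nonneg ht.le]; exact Real.pi_pos.ne), ← Complex.cpow_neg]
  have e2 : -(Real.pi : ℂ) ^ 2 * (‖x‖ : ℂ) ^ 2 / (Real.pi * t) =
      -(Real.pi * (t : ℂ)⁻¹) * (‖x‖ : ℂ) ^ 2 := by field_simp
  rw [e2]
  ring

theorem hasFDerivAt_gaussian (t : ℝ) (x : Space m) :
    HasFDerivAt (fun x : Space m => Complex.exp (-(Real.pi * t) * ‖x‖ ^ 2))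
      (Complex.exp (-(Real.pi * t) * ‖x‖ ^ 2) •
        ((-(Real.pi * t) : ℂ) • (Complex.ofRealCLM.comp (2 • innerSL ℝ x)))) x := by
  have h1 : HasFDerivAt (fun x : Space m => ((‖x‖ ^ 2 : ℝ) : ℂ))
      (Complex.ofRealCLM.comp (2 • innerSL ℝ x)) x :=
    Complex.ofRealCLM.hasFDerivAt.comp x (hasStrictFDerivAt_norm_sq x).hasFDerivAt
  have h2 := (h1.const_mul (-(Real.pi * t) : ℂ)).cexp
  simpa using h2

theorem integral_coord_gaussian (φ : 𝓢(Space m, ℂ)) (j : Fin m) {t : ℝ} (ht : 0 < t) :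
    gaussianIntegral (∂_{EuclideanSpace.single j (1 : ℝ)} φ : 𝓢(Space m, ℂ)) t =
      2 * Real.pi * t * gaussianIntegral (fun x => (x j : ℂ) * φ x) t := by
  set v : Space m := EuclideanSpace.single j 1 with hv
  set G : Space m → ℂ := fun x => Complex.exp (-(Real.pi * t) * ‖x‖ ^ 2) with hG
  have hGd : ∀ x, fderiv ℝ G x v = -(2 * Real.pi * t) * (x j * G x) := fun x => by
    rw [(hasFDerivAt_gaussian t x).fderiv]
    simp [hG, hv, EuclideanSpace.inner_single_right]
    ring
  have hGb : ∀ x, ‖G x‖ ≤ 1 := fun x => by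
    simp only [hG]
    rw [← Complex.ofReal_mul, ← Complex.ofReal_neg, ← Complex.ofReal_pow, ← Complex.ofReal_mul,
      Complex.norm_exp_ofReal, Real.exp_le_one_iff]
    have := Real.pi_pos
    have : 0 ≤ Real.pi * t * ‖x‖ ^ 2 := by positivity
    linarith
  have hGc : Continuous G := by fun_prop
  have hbd : ∀ f : Space m → ℂ, Integrable f → Integrable fun x => f x * G x := fun f hf =>
    hf.mul_bdd (c := 1) hGc.aestronglyMeasurable (Eventually.of_forall hGb)
  have hxφ : Integrable fun x : Space m => (x j : ℂ) * φ x := by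
    refine (φ.integrable_pow_mul volume 1).mono' ?_ (Eventually.of_forall fun x => ?_)
    · have : Continuous fun x : Space m => x j := (EuclideanSpace.proj (𝕜 := ℝ) j).continuous
      exact ((Complex.continuous_ofReal.comp this).mul φ.continuous).aestronglyMeasurable
    · rw [norm_mul, Complex.norm_real, pow_one]
      gcongr
      exact abs_apply_le_norm x j
  have hparts := integral_mul_fderiv_eq_neg_fderiv_mul_of_integrable (μ := volume) (f := φ)
    (g := G) (v := v) ?_ ?_ ?_ (fun x _ => φ.differentiableAt)
    (fun x _ => (hasFDerivAt_gaussian t x).differentiableAt)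
  · have e1 : gaussianIntegral (∂_{v} φ : 𝓢(Space m, ℂ)) t = ∫ x, fderiv ℝ φ x v * G x := rfl
    rw [e1, ← neg_eq_iff_eq_neg.2 hparts, gaussianIntegral, ← integral_const_mul, ← integral_neg]
    congr 1
    ext x
    rw [hGd]
    simp only [hG]
    ring
  · exact hbd _ (∂_{v} φ : 𝓢(Space m, ℂ)).integrable
  · refine ((hbd _ hxφ).const_mul (-(2 * Real.pi * t))).congr (Eventually.of_forall fun x => ?_)
    simp only [hGd]
    ring
  · exact hbd _ φ.integrable

theorem fourier_lineDeriv_single (φ : 𝓢(Space m, ℂ)) (j : Fin m) (ξ : Space m) :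
    𝓕 (∂_{EuclideanSpace.single j (1 : ℝ)} φ : 𝓢(Space m, ℂ)) ξ =
      2 * Real.pi * Complex.I * (ξ j * 𝓕 φ ξ) := by
  rw [SchwartzMap.fourier_lineDerivOp_eq, smul_apply,
    SchwartzMap.smulLeftCLM_apply_apply (by fun_prop)]
  simp [EuclideanSpace.inner_single_right]

theorem gaussianIntegral_coord_fourier (φ : 𝓢(Space m, ℂ)) (j : Fin m) {t : ℝ} (ht : 0 < t) :
    gaussianIntegral (fun ξ => (ξ j : ℂ) * 𝓕 φ ξ) t =
      (t : ℂ) ^ (-((m : ℂ) / 2 + 1)) *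
        (-Complex.I * gaussianIntegral (fun x => (x j : ℂ) * φ x) t⁻¹) := by
  have h1 := gaussianIntegral_fourier
    (∂_{EuclideanSpace.single j (1 : ℝ)} φ : 𝓢(Space m, ℂ)) ht
  rw [integral_coord_gaussian φ j (inv_pos.2 ht)] at h1
  have h2 : gaussianIntegral (𝓕 (∂_{EuclideanSpace.single j (1 : ℝ)} φ : 𝓢(Space m, ℂ)) : 𝓢(Space m, ℂ)) t =
      2 * Real.pi * Complex.I * gaussianIntegral (fun ξ => (ξ j : ℂ) * 𝓕 φ ξ) t := by
    rw [gaussianIntegral, gaussianIntegral, ← integral_const_mul]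
    congr 1
    ext ξ
    rw [fourier_lineDeriv_single]
    ring
  have ht' : (t : ℂ) ≠ 0 := by exact_mod_cast ht.ne'
  have hpi : (Real.pi : ℂ) ≠ 0 := by exact_mod_cast Real.pi_pos.ne'
  rw [h2] at h1
  rw [neg_add, Complex.cpow_add _ _ ht', Complex.cpow_neg_one]
  have h3 : (2 * Real.pi * Complex.I : ℂ) ≠ 0 := by simp [hpi]
  refine mul_left_cancel₀ h3 (h1.trans ?_)
  push_cast
  linear_combination (2 * Real.pi * (t : ℂ) ^ (-((m : ℂ) / 2)) * (t : ℂ)⁻¹ *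
    gaussianIntegral (fun x => (x j : ℂ) * φ x) t⁻¹) * Complex.I_mul_I

theorem mellin_congr_Ioi {f g : ℝ → ℂ} (h : ∀ t, 0 < t → f t = g t) (s : ℂ) :
    mellin f s = mellin g s :=
  setIntegral_congr_fun measurableSet_Ioi fun t ht => by simp only [h t ht]

theorem Gamma_inv_mul_cancel {x y : ℂ} {a b c d : ℂ} (ha : 0 < a.re) (hb : 0 < b.re)
    (h : Complex.Gamma a * (Real.pi : ℂ) ^ (-a) * x =
      c * (Complex.Gamma b * (Real.pi : ℂ) ^ (-b) * y)) (hd : d * c = 1) :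
    (Real.pi : ℂ) ^ b * (Complex.Gamma b)⁻¹ * (d * x) =
      (Real.pi : ℂ) ^ a * (Complex.Gamma a)⁻¹ * y := by
  have hpi : (Real.pi : ℂ) ≠ 0 := by exact_mod_cast Real.pi_pos.ne'
  have g1 := Complex.Gamma_ne_zero_of_re_pos ha
  have g2 := Complex.Gamma_ne_zero_of_re_pos hb
  have p1 : (Real.pi : ℂ) ^ a ≠ 0 := by simp [Complex.cpow_eq_zero_iff, hpi]
  have p2 : (Real.pi : ℂ) ^ b ≠ 0 := by simp [Complex.cpow_eq_zero_iff, hpi]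
  rw [Complex.cpow_neg, Complex.cpow_neg] at h
  field_simp at h ⊢
  linear_combination d * h + Complex.Gamma b * y * (Real.pi : ℂ) ^ a * hd

theorem riesz_strip [NeZero m] (φ : 𝓢(Space m, ℂ)) {μ : ℂ} (h0 : 0 < μ.re) (h1 : μ.re < m) :
    (Real.pi : ℂ) ^ (μ / 2) * (Complex.Gamma (μ / 2))⁻¹ *
        ∫ x, (‖x‖ : ℂ) ^ (μ - m) * φ x =
      (Real.pi : ℂ) ^ ((m - μ) / 2) * (Complex.Gamma ((m - μ) / 2))⁻¹ *
        ∫ x, (‖x‖ : ℂ) ^ (m - μ - m) * 𝓕 φ x := by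
  have ha : 0 < (μ / 2).re := by simpa using h0
  have hb : 0 < (((m : ℂ) - μ) / 2).re := by simpa using h1
  have e1 := mellin_gaussianIntegral (𝓕 φ : 𝓢(Space m, ℂ)).continuous.measurable ha (by
    refine ((radialBound_schwartz (𝓕 φ)).integrable_rpow (σ := m - μ.re) (by
      simpa using h1)).congr (Eventually.of_forall fun x => ?_)
    simp only [Complex.div_ofNat_re]
    ring_nf)
  have e2 := mellin_gaussianIntegral φ.continuous.measurable hb (by
    refine ((radialBound_schwartz φ).integrable_rpow (σ := μ.re) (by
      simpa using h0)).congr (Eventually.of_forall fun x => ?_)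
    simp only [Complex.div_ofNat_re, Complex.sub_re, Complex.natCast_re]
    ring_nf)
  have e3 : mellin (gaussianIntegral (𝓕 φ : 𝓢(Space m, ℂ))) (μ / 2) =
      mellin (gaussianIntegral φ) ((m - μ) / 2) := by
    rw [mellin_congr_Ioi (fun t ht => gaussianIntegral_fourier φ ht)]
    have := mellin_cpow_smul (fun t => gaussianIntegral φ t⁻¹) (μ / 2) (-((m : ℂ) / 2))
    simp only [smul_eq_mul] at this
    rw [this, mellin_comp_inv]
    ring_nf
  rw [e1, e2] at e3
  have := Gamma_inv_mul_cancel (c := 1) (d := 1) ha hb (by rw [e3, one_mul]) (by ring)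
  rw [one_mul] at this
  rw [show (m : ℂ) - μ - m = -(2 * (μ / 2)) by ring, this,
    show μ - (m : ℂ) = -(2 * ((m - μ) / 2)) by ring]

theorem radialBound_coord (φ : 𝓢(Space m, ℂ)) (j : Fin m) :
    RadialBound (fun x => (x j : ℂ) * φ x) 1 where
  measurable := (Complex.measurable_ofReal.comp
    (EuclideanSpace.proj (𝕜 := ℝ) j).continuous.measurable).mul φ.continuous.measurable
  near := by
    obtain ⟨C, hC⟩ := (radialBound_schwartz φ).near
    refine ⟨C, fun x hx hx1 => ?_⟩
    rw [norm_mul, Complex.norm_real, Real.norm_eq_abs, mul_comm]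
    have := hC x hx hx1
    rw [pow_zero, mul_one] at this
    rw [pow_one]
    exact mul_le_mul this (abs_apply_le_norm x j) (abs_nonneg _) ((norm_nonneg _).trans this)
  far M := by
    obtain ⟨C, hC⟩ := (radialBound_schwartz φ).far (M + 1)
    refine ⟨C, fun x hx => le_trans ?_ (hC x hx)⟩
    rw [norm_mul, Complex.norm_real, Real.norm_eq_abs, pow_succ, mul_assoc]
    gcongr
    exact abs_apply_le_norm x j

theorem integral_cpow_direction [NeZero m] (φ : Space m → ℂ) (j : Fin m) (z : ℂ) :
    ∫ x, (‖x‖ : ℂ) ^ z * (direction j x * φ x) = ∫ x, (‖x‖ : ℂ) ^ (z - 1) * ((x j : ℂ) * φ x) := by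
  refine integral_congr_ae ?_
  filter_upwards [ae_ne_zero] with x hx
  have : (‖x‖ : ℂ) ≠ 0 := by simpa using hx
  rw [Complex.cpow_sub _ _ this, Complex.cpow_one, direction]
  push_cast
  field_simp

theorem riesz_direction_strip [NeZero m] (φ : 𝓢(Space m, ℂ)) (j : Fin m) {μ : ℂ}
    (h0 : 0 < μ.re) (h1 : μ.re < m) :
    (Real.pi : ℂ) ^ ((μ + 1) / 2) * (Complex.Gamma ((μ + 1) / 2))⁻¹ *
        ∫ x, (‖x‖ : ℂ) ^ (μ - m) * (direction j x * φ x) =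
      Complex.I * ((Real.pi : ℂ) ^ ((m + 1 - μ) / 2) * (Complex.Gamma ((m + 1 - μ) / 2))⁻¹) *
        ∫ x, (‖x‖ : ℂ) ^ (m - μ - m) * (direction j x * 𝓕 φ x) := by
  have ha : 0 < ((μ + 1) / 2).re := by
    rw [Complex.div_ofNat_re, Complex.add_re, Complex.one_re]; linarith
  have hb : 0 < (((m : ℂ) + 1 - μ) / 2).re := by
    rw [Complex.div_ofNat_re, Complex.sub_re, Complex.add_re, Complex.one_re, Complex.natCast_re]
    linarith
  have e1 := mellin_gaussianIntegral (radialBound_coord (𝓕 φ) j).measurable ha (by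
    refine ((radialBound_coord (𝓕 φ) j).integrable_rpow (σ := m - μ.re - 1) (by
      push_cast; linarith)).congr (Eventually.of_forall fun x => ?_)
    simp only [Complex.div_ofNat_re, Complex.add_re, Complex.one_re]
    ring_nf)
  have e2 := mellin_gaussianIntegral (radialBound_coord φ j).measurable hb (by
    refine ((radialBound_coord φ j).integrable_rpow (σ := μ.re - 1) (by
      push_cast; linarith)).congr (Eventually.of_forall fun x => ?_)
    simp only [Complex.div_ofNat_re, Complex.sub_re, Complex.natCast_re, Complex.add_re,
      Complex.one_re]
    ring_nf)
  have e3 : mellin (gaussianIntegral fun ξ => (ξ j : ℂ) * 𝓕 φ ξ) ((μ + 1) / 2) =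
      -Complex.I * mellin (gaussianIntegral fun x => (x j : ℂ) * φ x) ((m + 1 - μ) / 2) := by
    rw [mellin_congr_Ioi (fun t ht => gaussianIntegral_coord_fourier φ j ht)]
    have := mellin_cpow_smul
      (fun t => -Complex.I * gaussianIntegral (fun x => (x j : ℂ) * φ x) t⁻¹)
      ((μ + 1) / 2) (-((m : ℂ) / 2 + 1))
    simp only [smul_eq_mul] at this
    have h2 := mellin_const_smul (fun t => gaussianIntegral (fun x => (x j : ℂ) * φ x) t⁻¹)
      ((μ + 1) / 2 + -((m : ℂ) / 2 + 1)) (-Complex.I)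
    simp only [smul_eq_mul] at h2
    rw [this, h2, mellin_comp_inv]
    ring_nf
  rw [e1, e2] at e3
  have := Gamma_inv_mul_cancel (d := Complex.I) ha hb e3 (by
    rw [mul_neg, Complex.I_mul_I, neg_neg])
  rw [integral_cpow_direction, integral_cpow_direction,
    show (m : ℂ) - μ - m - 1 = -(2 * ((μ + 1) / 2)) by ring,
    show μ - (m : ℂ) - 1 = -(2 * ((m + 1 - μ) / 2)) by ring, ← this]
  ring

/-! ### The homogeneous distributions on the Fourier side -/

theorem exists_distribution_of_weight {w : Space m → ℂ} (hw : Measurable w) (k : ℕ)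
    (hi : Integrable fun x => ((1 + ‖x‖) ^ k)⁻¹ * ‖w x‖) :
    ∃ L : 𝓢(Space m, ℂ) →L[ℂ] ℂ, ∀ φ, L φ = ∫ x, w x * φ x := by
  have hb : ∀ (φ : 𝓢(Space m, ℂ)) (x : Space m), ‖w x * φ x‖ ≤
      2 ^ k * (Finset.Iic (k, 0)).sup (schwartzSeminormFamily ℂ (Space m) ℂ) φ *
        (((1 + ‖x‖) ^ k)⁻¹ * ‖w x‖) := fun φ x => by
    have h := SchwartzMap.one_add_le_sup_seminorm_apply (𝕜 := ℂ) (m := (k, 0)) (k := k) (n := 0)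
      le_rfl le_rfl φ x
    simp only [norm_iteratedFDeriv_zero] at h
    have hp : 0 < (1 + ‖x‖) ^ k := by positivity
    have h2 : ‖φ x‖ ≤ 2 ^ k *
        (Finset.Iic (k, 0)).sup (schwartzSeminormFamily ℂ (Space m) ℂ) φ * ((1 + ‖x‖) ^ k)⁻¹ := by
      rw [← div_eq_mul_inv, le_div_iff₀ hp, mul_comm]
      exact h
    rw [norm_mul]
    calc ‖w x‖ * ‖φ x‖ ≤ ‖w x‖ * (2 ^ k *
        (Finset.Iic (k, 0)).sup (schwartzSeminormFamily ℂ (Space m) ℂ) φ * ((1 + ‖x‖) ^ k)⁻¹) := by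
          gcongr
      _ = _ := by ring
  have hint : ∀ φ : 𝓢(Space m, ℂ), Integrable fun x => w x * φ x := fun φ =>
    (hi.const_mul _).mono' (hw.mul φ.continuous.measurable).aestronglyMeasurable
      (Eventually.of_forall (hb φ))
  refine ⟨SchwartzMap.mkCLMtoNormedSpace (fun φ => ∫ x, w x * φ x) (fun φ ψ => ?_) (fun a φ => ?_)
    ⟨Finset.Iic (k, 0), 2 ^ k * ∫ x, ((1 + ‖x‖) ^ k)⁻¹ * ‖w x‖, by positivity, fun φ => ?_⟩,
    fun φ => rfl⟩
  · simp only [add_apply, mul_add]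
    exact integral_add (hint φ) (hint ψ)
  · simp only [smul_apply, smul_eq_mul, RingHom.id_apply]
    rw [← integral_const_mul]
    congr 1
    ext x
    ring
  · refine (norm_integral_le_of_norm_le (hi.const_mul _) (Eventually.of_forall (hb φ))).trans ?_
    rw [integral_const_mul]
    exact le_of_eq (by ring)

theorem integrable_inv_one_add_pow_mul [NeZero m] {A : Space m → ℂ} (hA : IsAngular A) {s : ℂ}
    (hs : 0 < s.re) :
    ∃ k : ℕ, Integrable fun x => ((1 + ‖x‖) ^ k)⁻¹ * ‖(‖x‖ : ℂ) ^ (s - m) * A x‖ := by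
  obtain ⟨k, hk⟩ := exists_nat_gt s.re
  obtain ⟨C, hC⟩ := hA.bounded
  have hC0 : 0 ≤ C := (norm_nonneg _).trans (hC 0)
  have hmeas : AEStronglyMeasurable
      (fun x : Space m => ((1 + ‖x‖) ^ k)⁻¹ * ‖(‖x‖ : ℂ) ^ (s - m) * A x‖) volume :=
    (((measurable_const.add measurable_norm).pow_const k).inv.mul
      ((measurable_norm_cpow _).mul hA.measurable).norm).aestronglyMeasurable
  refine ⟨k, ?_⟩
  rw [← integrableOn_univ, ← Set.union_compl_self (Metric.ball (0 : Space m) 1),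
    integrableOn_union]
  constructor
  · refine Integrable.mono' ((integrable_norm_rpow_ball (m := m) hs).const_mul C) hmeas.restrict ?_
    filter_upwards [ae_restrict_of_ae ae_ne_zero] with x hx
    rw [Real.norm_of_nonneg (by positivity), norm_mul, norm_norm_cpow hx]
    have h1 : ((1 + ‖x‖) ^ k)⁻¹ ≤ 1 :=
      inv_le_one_of_one_le₀ (one_le_pow₀ (by linarith [norm_nonneg x]))
    calc _ ≤ 1 * (‖x‖ ^ (s - m).re * C) := by gcongr; exact hC x
      _ = _ := by simp [mul_comm]
  · refine Integrable.mono' ((integrable_norm_rpow_compl_ball (m := m) (σ := s.re - k)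
      (by linarith)).const_mul C) hmeas.restrict ?_
    filter_upwards [ae_restrict_mem measurableSet_ball.compl] with x hb
    have hx1 : 1 ≤ ‖x‖ := by simpa using hb
    have hx' : 0 < ‖x‖ := by linarith
    rw [Real.norm_of_nonneg (by positivity), norm_mul, norm_norm_cpow (norm_pos_iff.1 hx')]
    have h1 : ((1 + ‖x‖) ^ k)⁻¹ ≤ (‖x‖ ^ k)⁻¹ := by gcongr; linarith
    calc _ ≤ (‖x‖ ^ k)⁻¹ * (‖x‖ ^ (s - m).re * C) := by gcongr; exact hC x
      _ = _ := by
        rw [show s.re - k - m = (s - m).re + (-(k : ℝ)) by simp; ring, Real.rpow_add hx',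
          Real.rpow_neg hx'.le, Real.rpow_natCast]
        ring

theorem exists_distribution_cpow_mul_angular [NeZero m] {A : Space m → ℂ} (hA : IsAngular A)
    {s : ℂ} (hs : 0 < s.re) :
    ∃ L : 𝓢(Space m, ℂ) →L[ℂ] ℂ, ∀ φ, L φ = ∫ x, (‖x‖ : ℂ) ^ (s - m) * (A x * φ x) := by
  obtain ⟨k, hk⟩ := integrable_inv_one_add_pow_mul hA hs
  obtain ⟨L, hL⟩ := exists_distribution_of_weight ((measurable_norm_cpow _).mul hA.measurable) k hk
  refine ⟨L, fun φ => ?_⟩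
  rw [hL]
  congr 1
  ext x
  simp only [Pi.mul_apply]
  ring

theorem fpDist_apply {k : Space m → ℂ} (L : 𝓢(Space m, ℂ) →L[ℂ] ℂ)
    (hL : ∀ φ : 𝓢(Space m, ℂ), HasFinitePart (𝓝[>] (0 : ℝ))
      (fun ε => ∫ x in {x : Space m | ε < ‖x‖}, k x * φ x) (L φ)) (φ : 𝓢(Space m, ℂ)) :
    fpDist k φ = L φ := by
  have h : ∃ T : 𝓢'(Space m, ℂ), ∀ φ : 𝓢(Space m, ℂ),
      HasFinitePart (𝓝[>] (0 : ℝ)) (fun ε => ∫ x in {x : Space m | ε < ‖x‖}, k x * φ x) (T φ) :=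
    ⟨ContinuousLinearMap.toPointwiseConvergenceCLM _ _ _ _ L, hL⟩
  rw [fpDist, dif_pos h]
  exact (h.choose_spec φ).unique_zero (hL φ)

theorem hasRadialExpansion_angular_mul_schwartz {A : Space m → ℂ} (hA : IsAngular A)
    (φ : 𝓢(Space m, ℂ)) :
    HasRadialExpansion (fun x => A x * φ x) (fun n x => A x * taylorAngular φ n x) :=
  (hasRadialExpansion_schwartz φ).mul_angular hA

/-- The finite part of `∫ |x| ^ (s - m) A(x) φ(x) dx`. -/
noncomputable def angularFp (A : Space m → ℂ) (φ : 𝓢(Space m, ℂ)) (s : ℂ) : ℂ :=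
  radialFp (fun x => A x * φ x) (fun n x => A x * taylorAngular φ n x) s

theorem hasRadialFinitePart_angularFp [NeZero m] {A : Space m → ℂ} (hA : IsAngular A)
    (φ : 𝓢(Space m, ℂ)) {s : ℂ}
    (h0 : ∀ n : ℕ, s + n = 0 → sphereIntegral (fun x => A x * taylorAngular φ n x) = 0) :
    HasRadialFinitePart (fun x => A x * φ x) s (angularFp A φ s) :=
  (hasRadialExpansion_angular_mul_schwartz hA φ).hasRadialFinitePart_radialFp h0

theorem add_natCast_ne_zero {s : ℂ} (hs : 0 < s.re) (n : ℕ) : s + n ≠ 0 := fun h => by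
  have := congrArg Complex.re h
  simp only [Complex.add_re, Complex.natCast_re, Complex.zero_re] at this
  have : (0 : ℝ) ≤ n := n.cast_nonneg
  linarith

theorem angularFp_eq_integral [NeZero m] {A : Space m → ℂ} (hA : IsAngular A)
    (φ : 𝓢(Space m, ℂ)) {s : ℂ} (hs : 0 < s.re) :
    angularFp A φ s = ∫ x, (‖x‖ : ℂ) ^ (s - m) * (A x * φ x) :=
  (hasRadialFinitePart_angularFp hA φ fun n h => absurd h (add_natCast_ne_zero hs n)).unique
    (((radialBound_schwartz φ).mul_angular hA).hasRadialFinitePart (by simpa using hs))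

/-- The finite part distribution of a homogeneous kernel, on the Fourier side. -/
theorem fpDist_cpow_mul_angular [NeZero m] {A : Space m → ℂ} (hA : IsAngular A) {μ a b : ℂ}
    (h0 : ∀ (φ : 𝓢(Space m, ℂ)) (n : ℕ), μ + n = 0 →
      sphereIntegral (fun x => A x * taylorAngular φ n x) = 0) (ha : a ≠ 0)
    (hF : ∀ φ : 𝓢(Space m, ℂ), a * angularFp A φ μ = b * angularFp A (𝓕 φ) (m - μ))
    (φ : 𝓢(Space m, ℂ)) :
    a * fpDist (fun x => (‖x‖ : ℂ) ^ (μ - m) * A x) φ = b * angularFp A (𝓕 φ) (m - μ) := by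
  obtain ⟨L, hL⟩ : ∃ L : 𝓢(Space m, ℂ) →L[ℂ] ℂ, ∀ φ, L φ = angularFp A φ μ := by
    rcases lt_or_ge 0 μ.re with h | h
    · obtain ⟨L, hL⟩ := exists_distribution_cpow_mul_angular hA h
      exact ⟨L, fun φ => by rw [hL, angularFp_eq_integral hA φ h]⟩
    · have h' : 0 < ((m : ℂ) - μ).re := by
        have : (0 : ℝ) < m := by exact_mod_cast Nat.pos_of_ne_zero (NeZero.ne m)
        rw [Complex.sub_re, Complex.natCast_re]
        linarith
      obtain ⟨L, hL⟩ := exists_distribution_cpow_mul_angular hA h'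
      refine ⟨(a⁻¹ * b) • (L.comp (fourierCLM ℂ 𝓢(Space m, ℂ))), fun φ => ?_⟩
      rw [smul_apply, ContinuousLinearMap.comp_apply, fourierCLM_apply, hL,
        ← angularFp_eq_integral hA _ h', smul_eq_mul, mul_assoc, ← hF φ, ← mul_assoc,
        inv_mul_cancel₀ ha, one_mul]
  rw [fpDist_apply L, hL, hF]
  intro ψ
  rw [hL]
  have := hasRadialFinitePart_angularFp hA ψ (h0 ψ)
  unfold HasRadialFinitePart at this
  simpa only [mul_assoc] using this

theorem differentiable_pi_cpow_mul_Gamma_inv {f : ℂ → ℂ} (hf : Differentiable ℂ f) :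
    Differentiable ℂ fun μ => (Real.pi : ℂ) ^ f μ * (Complex.Gamma (f μ))⁻¹ := by
  have hpi : (Real.pi : ℂ) ≠ 0 := by exact_mod_cast Real.pi_pos.ne'
  refine Differentiable.mul (fun μ => ?_) (Complex.differentiable_one_div_Gamma.comp hf)
  exact (hf μ).const_cpow (Or.inl hpi)

theorem pi_cpow_mul_Gamma_inv_ne_zero {z : ℂ} (hz : ∀ l : ℕ, z ≠ -l) :
    (Real.pi : ℂ) ^ z * (Complex.Gamma z)⁻¹ ≠ 0 := by
  have hpi : (Real.pi : ℂ) ≠ 0 := by exact_mod_cast Real.pi_pos.ne'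
  exact mul_ne_zero (by simp [Complex.cpow_eq_zero_iff, hpi])
    (inv_ne_zero (Complex.Gamma_ne_zero hz))

theorem riesz_continuation [NeZero m] (φ : 𝓢(Space m, ℂ)) {μ : ℂ}
    (h0 : ∀ l : ℕ, μ ≠ -(2 * l)) (h1 : ∀ n : ℕ, μ ≠ m + n) :
    (Real.pi : ℂ) ^ (μ / 2) * (Complex.Gamma (μ / 2))⁻¹ * angularFp (fun _ => 1) φ μ =
      (Real.pi : ℂ) ^ ((m - μ) / 2) * (Complex.Gamma ((m - μ) / 2))⁻¹ *
        angularFp (fun _ => 1) (𝓕 φ) (m - μ) := by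
  refine radialFp_continuation (hasRadialExpansion_angular_mul_schwartz (.const 1) φ)
    (hasRadialExpansion_angular_mul_schwartz (.const 1) (𝓕 φ))
    (a := fun μ => (Real.pi : ℂ) ^ (μ / 2) * (Complex.Gamma (μ / 2))⁻¹)
    (b := fun μ => (Real.pi : ℂ) ^ ((m - μ) / 2) * (Complex.Gamma ((m - μ) / 2))⁻¹)
    (differentiable_pi_cpow_mul_Gamma_inv (by fun_prop))
    (differentiable_pi_cpow_mul_Gamma_inv (by fun_prop)) (fun μ hμ0 hμ1 => ?_) (fun n hn => ?_)
    (fun n hn => absurd (by linear_combination -hn) (h1 n))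
  · simp only [one_mul]
    exact riesz_strip φ hμ0 hμ1
  · simp only [one_mul]
    rcases Nat.even_or_odd n with ⟨l, rfl⟩ | hodd
    · exact absurd (by push_cast at hn; linear_combination hn) (h0 l)
    · exact sphereIntegral_taylorAngular_of_odd _ hodd

theorem riesz_direction_continuation [NeZero m] (φ : 𝓢(Space m, ℂ)) (j : Fin m) {μ : ℂ}
    (h0 : ∀ l : ℕ, μ ≠ -(2 * l + 1)) (h1 : ∀ n : ℕ, μ ≠ m + n) :
    (Real.pi : ℂ) ^ ((μ + 1) / 2) * (Complex.Gamma ((μ + 1) / 2))⁻¹ *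
        angularFp (direction j) φ μ =
      Complex.I * ((Real.pi : ℂ) ^ ((m + 1 - μ) / 2) * (Complex.Gamma ((m + 1 - μ) / 2))⁻¹) *
        angularFp (direction j) (𝓕 φ) (m - μ) := by
  refine radialFp_continuation (hasRadialExpansion_angular_mul_schwartz (isAngular_direction j) φ)
    (hasRadialExpansion_angular_mul_schwartz (isAngular_direction j) (𝓕 φ))
    (a := fun μ => (Real.pi : ℂ) ^ ((μ + 1) / 2) * (Complex.Gamma ((μ + 1) / 2))⁻¹)
    (b := fun μ => Complex.I * ((Real.pi : ℂ) ^ ((m + 1 - μ) / 2) *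
      (Complex.Gamma ((m + 1 - μ) / 2))⁻¹))
    (differentiable_pi_cpow_mul_Gamma_inv (by fun_prop))
    ((differentiable_pi_cpow_mul_Gamma_inv (by fun_prop)).const_mul _)
    (fun μ hμ0 hμ1 => riesz_direction_strip φ j hμ0 hμ1) (fun n hn => ?_)
    (fun n hn => absurd (by linear_combination -hn) (h1 n))
  rcases Nat.even_or_odd n with heven | ⟨l, rfl⟩
  · exact sphereIntegral_direction_mul_taylorAngular_of_even _ heven j
  · exact absurd (by push_cast at hn; linear_combination hn) (h0 l)

/-! ### Derivatives of the delta distribution -/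

theorem apply_zero_eq_integral_fourier (φ : 𝓢(Space m, ℂ)) : φ 0 = ∫ ξ, 𝓕 φ ξ := by
  have h : 𝓕⁻ (𝓕 φ) = φ := fourierInv_fourier_eq φ
  nth_rw 1 [← h]
  rw [SchwartzMap.fourierInv_coe, Real.fourierInv_eq']
  simp

theorem lineDeriv_single_comm (φ : 𝓢(Space m, ℂ)) (j k : Fin m) :
    (∂_{EuclideanSpace.single j (1 : ℝ)} (∂_{EuclideanSpace.single k (1 : ℝ)} φ : 𝓢(Space m, ℂ)) :
      𝓢(Space m, ℂ)) =
    ∂_{EuclideanSpace.single k (1 : ℝ)} (∂_{EuclideanSpace.single j (1 : ℝ)} φ :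
      𝓢(Space m, ℂ)) := by
  refine (fourierEquiv ℂ 𝓢(Space m, ℂ)).injective ?_
  simp only [fourierEquiv_apply]
  ext ξ
  simp only [fourier_lineDeriv_single]
  ring

theorem laplacian_eq_sum_single (φ : 𝓢(Space m, ℂ)) :
    Δ φ = ∑ j : Fin m, (∂_{EuclideanSpace.single j (1 : ℝ)}
      (∂_{EuclideanSpace.single j (1 : ℝ)} φ : 𝓢(Space m, ℂ)) : 𝓢(Space m, ℂ)) := by
  rw [SchwartzMap.laplacian_eq_sum (EuclideanSpace.basisFun (Fin m) ℝ)]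
  simp only [EuclideanSpace.basisFun_apply]

theorem fourier_neg_laplacian (φ : 𝓢(Space m, ℂ)) (ξ : Space m) :
    𝓕 (-Δ φ) ξ = (2 * Real.pi * ‖ξ‖) ^ 2 * 𝓕 φ ξ := by
  have h1 : 𝓕 (-Δ φ) = -∑ j : Fin m, 𝓕 (∂_{EuclideanSpace.single j (1 : ℝ)}
      (∂_{EuclideanSpace.single j (1 : ℝ)} φ : 𝓢(Space m, ℂ)) : 𝓢(Space m, ℂ)) := by
    rw [laplacian_eq_sum_single, ← fourierCLM_apply (R := ℂ), map_neg, map_sum]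
    rfl
  have h2 : ((‖ξ‖ : ℂ)) ^ 2 = ∑ j : Fin m, (ξ j : ℂ) ^ 2 := by
    rw [← Complex.ofReal_pow, EuclideanSpace.real_norm_sq_eq]
    push_cast
    rfl
  rw [h1, mul_pow, h2, Finset.mul_sum, Finset.sum_mul, neg_apply, sum_apply,
    ← Finset.sum_neg_distrib]
  refine Finset.sum_congr rfl fun j _ => ?_
  rw [fourier_lineDeriv_single, fourier_lineDeriv_single]
  linear_combination -(2 * Real.pi * (ξ j : ℂ)) ^ 2 * 𝓕 φ ξ * Complex.I_sq

theorem fourier_neg_laplacian_iterate (φ : 𝓢(Space m, ℂ)) (l : ℕ) (ξ : Space m) :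
    𝓕 ((fun ψ : 𝓢(Space m, ℂ) => -Δ ψ)^[l] φ) ξ = (2 * Real.pi * ‖ξ‖) ^ (2 * l) * 𝓕 φ ξ := by
  induction l with
  | zero => simp
  | succ l ih => rw [Function.iterate_succ_apply', fourier_neg_laplacian, ih]; ring

theorem negLaplaceDelta_apply (l : ℕ) (φ : 𝓢(Space m, ℂ)) :
    negLaplaceDelta m l φ = ((fun ψ : 𝓢(Space m, ℂ) => -Δ ψ)^[l] φ) 0 := by
  have h : ∀ (l : ℕ) (u : 𝓢'(Space m, ℂ)) (φ : 𝓢(Space m, ℂ)),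
      ((fun u : 𝓢'(Space m, ℂ) => -Δ u)^[l] u) φ =
        u ((fun ψ : 𝓢(Space m, ℂ) => -Δ ψ)^[l] φ) := by
    intro l
    induction l with
    | zero => simp
    | succ l ih =>
      intro u φ
      rw [Function.iterate_succ_apply, ih, Function.iterate_succ_apply']
      rw [neg_apply, TemperedDistribution.laplacian_apply_apply, map_neg]
  rw [negLaplaceDelta, h, TemperedDistribution.delta_apply]

/-- Contraction of the Clifford relations with a symmetric array. -/
theorem sum_e_mul_e_mul {M : Fin m → Fin m → Cl m} (hM : ∀ j k, M j k = M k j) :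
    ∑ j, ∑ k, (e j : Cl m) * (e k * M j k) = -∑ j, M j j := by
  have h1 : ∑ j, ∑ k, (e j : Cl m) * (e k * M j k) = ∑ j, ∑ k, (e k : Cl m) * (e j * M j k) := by
    rw [Finset.sum_comm]
    exact Finset.sum_congr rfl fun j _ => Finset.sum_congr rfl fun k _ => by rw [hM]
  have h2 : (2 : ℂ) • ∑ j, ∑ k, (e j : Cl m) * (e k * M j k) = (2 : ℂ) • -∑ j, M j j := by
    rw [two_smul]
    nth_rw 2 [h1]
    rw [← Finset.sum_add_distrib, two_smul, ← Finset.sum_neg_distrib, ← Finset.sum_add_distrib]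
    refine Finset.sum_congr rfl fun j _ => ?_
    rw [← Finset.sum_add_distrib, Finset.sum_eq_single j]
    · rw [← mul_assoc, e_mul_self, neg_one_mul]
    · intro k _ hk
      rw [← mul_assoc, ← mul_assoc, ← add_mul, e_mul_e_add hk.symm, zero_mul]
    · simp
  exact smul_right_injective _ (two_ne_zero (α := ℂ)) h2

theorem dirac_apply (u : 𝓢'(Space m, Cl m)) (φ : 𝓢(Space m, ℂ)) :
    dirac u φ = -∑ j : Fin m, e j * u (∂_{EuclideanSpace.single j (1 : ℝ)} φ : 𝓢(Space m, ℂ)) := by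
  rw [dirac, sum_apply, ← Finset.sum_neg_distrib]
  refine Finset.sum_congr rfl fun j _ => ?_
  rw [leftMul_apply, TemperedDistribution.lineDerivOp_apply_apply, map_neg, mul_neg]

theorem dirac_dirac_apply (u : 𝓢'(Space m, Cl m)) (φ : 𝓢(Space m, ℂ)) :
    dirac (dirac u) φ = u (-Δ φ) := by
  rw [dirac_apply, map_neg, laplacian_eq_sum_single, map_sum,
    ← sum_e_mul_e_mul (M := fun j k => u (∂_{EuclideanSpace.single k (1 : ℝ)}
      (∂_{EuclideanSpace.single j (1 : ℝ)} φ : 𝓢(Space m, ℂ)) : 𝓢(Space m, ℂ)))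
      fun j k => by rw [lineDeriv_single_comm], ← Finset.sum_neg_distrib]
  refine Finset.sum_congr rfl fun j _ => ?_
  rw [dirac_apply, mul_neg, neg_neg, Finset.mul_sum]

theorem dirac_iterate_two_mul_apply (l : ℕ) (u : 𝓢'(Space m, Cl m)) (φ : 𝓢(Space m, ℂ)) :
    (dirac^[2 * l] u) φ = u ((fun ψ : 𝓢(Space m, ℂ) => -Δ ψ)^[l] φ) := by
  induction l generalizing u with
  | zero => simp
  | succ l ih =>
    rw [show 2 * (l + 1) = 2 * l + 1 + 1 by ring, Function.iterate_succ_apply,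
      Function.iterate_succ_apply, ih, dirac_dirac_apply, Function.iterate_succ_apply']

theorem diracIterDelta_apply (l : ℕ) (φ : 𝓢(Space m, ℂ)) :
    diracIterDelta m (2 * l + 1) φ = -∑ j : Fin m,
      (((fun ψ : 𝓢(Space m, ℂ) => -Δ ψ)^[l]
        (∂_{EuclideanSpace.single j (1 : ℝ)} φ : 𝓢(Space m, ℂ))) 0) • e j := by
  rw [diracIterDelta, Function.iterate_succ_apply', dirac_apply]
  congr 1
  refine Finset.sum_congr rfl fun j _ => ?_
  rw [dirac_iterate_two_mul_apply, tensor_apply, TemperedDistribution.delta_apply, mul_smul_comm,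
    mul_one]

theorem pi_cpow_mul_two_pi_pow (z : ℂ) (l : ℕ) (n : ℕ) (hn : n = 2 * l) :
    (Real.pi : ℂ) ^ (z - l) * ((2 * Real.pi : ℂ) ^ n) = 2 ^ n * (Real.pi : ℂ) ^ (z + l) := by
  have hpi : (Real.pi : ℂ) ≠ 0 := by exact_mod_cast Real.pi_pos.ne'
  rw [mul_pow, show z + l = (z - l) + (n : ℕ) by rw [hn]; push_cast; ring,
    Complex.cpow_add _ _ hpi, Complex.cpow_natCast]
  ring

theorem Tstar_apply [NeZero m] {μ : ℂ} (hμ : ∀ n : ℕ, μ ≠ m + n) (φ : 𝓢(Space m, ℂ)) :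
    Tstar m (μ - m) φ = (Real.pi : ℂ) ^ ((m - μ) / 2) * (Complex.Gamma ((m - μ) / 2))⁻¹ *
      angularFp (fun _ => 1) (𝓕 φ) (m - μ) := by
  rw [Tstar]
  split_ifs with h
  · obtain ⟨l, hl, hle⟩ : ∃ l : ℕ, μ - m = -(m : ℂ) - 2 * l ∧ h.choose = l :=
      ⟨h.choose, h.choose_spec, rfl⟩
    have hμl : μ = -(2 * l) := by linear_combination hl
    have hre : 0 < ((m : ℂ) - μ).re := by
      have : (0 : ℝ) < m := by exact_mod_cast Nat.pos_of_ne_zero (NeZero.ne m)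
      rw [hμl]
      simp only [Complex.sub_re, Complex.neg_re, Complex.mul_re, Complex.natCast_re,
        Complex.re_ofNat, Complex.im_ofNat, zero_mul, sub_zero]
      have : (0 : ℝ) ≤ l := l.cast_nonneg
      linarith
    rw [hle, smul_apply, negLaplaceDelta_apply, apply_zero_eq_integral_fourier,
      angularFp_eq_integral (.const 1) _ hre]
    have e1 : ∫ ξ, 𝓕 ((fun ψ : 𝓢(Space m, ℂ) => -Δ ψ)^[l] φ) ξ =
        (2 * Real.pi : ℂ) ^ (2 * l) * ∫ x, (‖x‖ : ℂ) ^ (m - μ - m) * (1 * 𝓕 φ x) := by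
      rw [← integral_const_mul]
      refine integral_congr_ae (Eventually.of_forall fun ξ => ?_)
      simp only [fourier_neg_laplacian_iterate]
      rw [show (m : ℂ) - μ - m = ((2 * l : ℕ) : ℂ) by rw [hμl]; push_cast; ring,
        Complex.cpow_natCast]
      ring
    have h2 := pi_cpow_mul_two_pi_pow ((m : ℂ) / 2) l (2 * l) rfl
    rw [e1, smul_eq_mul, show ((m : ℂ) - μ) / 2 = m / 2 + l by rw [hμl]; ring]
    have h3 : (2 : ℂ) ^ (2 * l) ≠ 0 := pow_ne_zero _ two_ne_zero
    rw [div_mul_eq_mul_div, ← mul_assoc, h2, mul_assoc, mul_div_mul_left _ _ h3]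
    ring
  · have h0 : ∀ l : ℕ, μ ≠ -(2 * l) := fun l hl => h ⟨l, by rw [hl]; ring⟩
    have hne : ∀ l : ℕ, μ / 2 ≠ -l := fun l hl => h0 l (by linear_combination 2 * hl)
    rw [smul_apply, smul_eq_mul, sub_add_cancel, div_eq_mul_inv]
    have := fpDist_cpow_mul_angular (.const 1) (μ := μ) (fun φ n hn => ?_)
      (pi_cpow_mul_Gamma_inv_ne_zero hne) (fun φ => riesz_continuation φ h0 hμ) φ
    · simp only [mul_one] at this
      exact this
    · simp only [one_mul]
      rcases Nat.even_or_odd n with ⟨l, rfl⟩ | hodd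
      · exact absurd (by push_cast at hn; linear_combination hn) (h0 l)
      · exact sphereIntegral_taylorAngular_of_odd _ hodd

theorem Ustar_apply [NeZero m] {μ : ℂ} (hμ : ∀ n : ℕ, μ ≠ m + n) (φ : 𝓢(Space m, ℂ)) :
    Ustar m (μ - m) φ = ∑ j, (Complex.I * ((Real.pi : ℂ) ^ ((m + 1 - μ) / 2) *
      (Complex.Gamma ((m + 1 - μ) / 2))⁻¹) * angularFp (direction j) (𝓕 φ) (m - μ)) • e j := by
  rw [Ustar]
  split_ifs with h
  · obtain ⟨l, hl, hle⟩ : ∃ l : ℕ, μ - m = -(m : ℂ) - 2 * l - 1 ∧ h.choose = l :=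
      ⟨h.choose, h.choose_spec, rfl⟩
    have hμl : μ = -(2 * l + 1) := by linear_combination hl
    have hre : 0 < ((m : ℂ) - μ).re := by
      have : (0 : ℝ) < m := by exact_mod_cast Nat.pos_of_ne_zero (NeZero.ne m)
      rw [hμl]
      simp only [Complex.sub_re, Complex.neg_re, Complex.mul_re, Complex.natCast_re,
        Complex.re_ofNat, Complex.im_ofNat, zero_mul, sub_zero, Complex.add_re, Complex.one_re]
      have : (0 : ℝ) ≤ l := l.cast_nonneg
      linarith
    rw [hle, smul_apply, diracIterDelta_apply, smul_neg, neg_smul, neg_neg, Finset.smul_sum]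
    refine Finset.sum_congr rfl fun j _ => ?_
    rw [smul_smul, apply_zero_eq_integral_fourier,
      angularFp_eq_integral (isAngular_direction j) _ hre]
    congr 1
    have e1 : ∫ ξ, 𝓕 ((fun ψ : 𝓢(Space m, ℂ) => -Δ ψ)^[l]
          (∂_{EuclideanSpace.single j (1 : ℝ)} φ : 𝓢(Space m, ℂ))) ξ =
        Complex.I * (2 * Real.pi : ℂ) ^ (2 * l) * (2 * Real.pi) *
          ∫ x, (‖x‖ : ℂ) ^ (m - μ - m) * (direction j x * 𝓕 φ x) := by
      rw [← integral_const_mul]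
      refine integral_congr_ae ?_
      filter_upwards [ae_ne_zero] with ξ hξ
      have hx : (‖ξ‖ : ℂ) ≠ 0 := by simpa using hξ
      rw [fourier_neg_laplacian_iterate, fourier_lineDeriv_single,
        show (m : ℂ) - μ - m = ((2 * l + 1 : ℕ) : ℂ) by rw [hμl]; push_cast; ring,
        Complex.cpow_natCast, direction]
      push_cast
      field_simp
      ring
    have h2 := pi_cpow_mul_two_pi_pow ((m : ℂ) / 2) l (2 * l) rfl
    have hpi : (Real.pi : ℂ) ≠ 0 := by exact_mod_cast Real.pi_pos.ne'
    have h3 : (2 : ℂ) ^ (2 * l) ≠ 0 := pow_ne_zero _ two_ne_zero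
    rw [e1, show ((m : ℂ) + 1 - μ) / 2 = m / 2 + l + 1 by rw [hμl]; ring,
      Complex.cpow_add _ 1 hpi, Complex.cpow_one, pow_succ]
    rw [div_eq_mul_inv, mul_inv, mul_inv]
    set X := ∫ x, (‖x‖ : ℂ) ^ (m - μ - m) * (direction j x * 𝓕 φ x)
    have h4 : ((2 : ℂ) ^ (2 * l))⁻¹ * (2 : ℂ) ^ (2 * l) = 1 := inv_mul_cancel₀ h3
    set G := (Complex.Gamma ((m : ℂ) / 2 + l + 1))⁻¹
    linear_combination (((2 : ℂ) ^ (2 * l))⁻¹ * G * Complex.I * Real.pi * X) * h2 +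
      ((Real.pi : ℂ) ^ ((m : ℂ) / 2 + l) * G * Complex.I * Real.pi * X) * h4
  · have h0 : ∀ l : ℕ, μ ≠ -(2 * l + 1) := fun l hl => h ⟨l, by rw [hl]; ring⟩
    have hne : ∀ l : ℕ, (μ + 1) / 2 ≠ -l := fun l hl => h0 l (by linear_combination 2 * hl)
    rw [smul_apply, U, sum_apply, Finset.smul_sum]
    refine Finset.sum_congr rfl fun j _ => ?_
    rw [tensor_apply, smul_smul, show μ - m + m + 1 = μ + 1 by ring, div_eq_mul_inv]
    congr 1
    refine fpDist_cpow_mul_angular (isAngular_direction j) (μ := μ) (fun φ n hn => ?_)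
      (pi_cpow_mul_Gamma_inv_ne_zero hne) (fun φ => riesz_direction_continuation φ j h0 hμ) φ
    rcases Nat.even_or_odd n with heven | ⟨l, rfl⟩
    · exact sphereIntegral_direction_mul_taylorAngular_of_even _ heven j
    · exact absurd (by push_cast at hn; linear_combination hn) (h0 l)

theorem sphereArea_eq (m : ℕ) : ((2 / sphereArea (m + 1) : ℝ) : ℂ) =
    ((Real.pi : ℂ) ^ (((m : ℂ) + 1) / 2) * (Complex.Gamma (((m : ℂ) + 1) / 2))⁻¹)⁻¹ := by
  have h1 : ((m : ℂ) + 1) / 2 = (((m + 1 : ℕ) : ℝ) / 2 : ℝ) := by push_cast; ring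
  rw [h1, Complex.Gamma_ofReal, ← Complex.ofReal_cpow Real.pi_pos.le, sphereArea]
  have h2 : 0 < Real.Gamma (((m + 1 : ℕ) : ℝ) / 2) := Real.Gamma_pos_of_pos (by positivity)
  have h3 : 0 < Real.pi ^ (((m + 1 : ℕ) : ℝ) / 2) := by have := Real.pi_pos; positivity
  rw [← Complex.ofReal_inv, ← Complex.ofReal_mul, ← Complex.ofReal_inv]
  congr 1
  field_simp

/-- The symbol of the `j`-th component of the Hilbert transform. -/
noncomputable def hilbertSymbol (j : Fin m) (ξ : Space m) : ℂ := -Complex.I * direction j ξ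

theorem isAngular_hilbertSymbol (j : Fin m) : IsAngular (hilbertSymbol (m := m) j) :=
  (IsAngular.const _).mul (isAngular_direction j)

theorem hilbertKernel_apply [NeZero m] (φ : 𝓢(Space m, ℂ)) :
    hilbertKernel m φ = ∑ j, (∫ ξ, hilbertSymbol j ξ * 𝓕 φ ξ) • e j := by
  have hm : (0 : ℝ) < m := by exact_mod_cast Nat.pos_of_ne_zero (NeZero.ne m)
  have h := Ustar_apply (m := m) (μ := 0) (fun n hn => by
    have := congrArg Complex.re hn
    simp only [Complex.add_re, Complex.natCast_re, Complex.zero_re] at this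
    have : (0 : ℝ) ≤ n := n.cast_nonneg
    linarith) φ
  rw [zero_sub] at h
  rw [hilbertKernel, smul_apply, h, Finset.smul_sum]
  refine Finset.sum_congr rfl fun j _ => ?_
  have hne : (Real.pi : ℂ) ^ (((m : ℂ) + 1) / 2) * (Complex.Gamma (((m : ℂ) + 1) / 2))⁻¹ ≠ 0 := by
    refine pi_cpow_mul_Gamma_inv_ne_zero fun l hl => ?_
    have := congrArg Complex.re hl
    rw [Complex.div_ofNat_re, Complex.add_re, Complex.one_re, Complex.natCast_re, Complex.neg_re,
      Complex.natCast_re] at this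
    have : (0 : ℝ) ≤ l := l.cast_nonneg
    linarith
  have e1 : angularFp (direction j) (𝓕 φ) ((m : ℂ) - 0) = ∫ ξ, direction j ξ * 𝓕 φ ξ := by
    rw [angularFp_eq_integral (isAngular_direction j) _ (by simpa using hm)]
    simp
  have e2 : ∫ ξ, hilbertSymbol j ξ * 𝓕 φ ξ = -Complex.I * ∫ ξ, direction j ξ * 𝓕 φ ξ := by
    rw [← integral_const_mul]
    congr 1
    ext ξ
    rw [hilbertSymbol]
    ring
  rw [smul_smul, Complex.ofReal_neg, sphereArea_eq, e1, e2, sub_zero]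
  congr 1
  linear_combination (-(Complex.I * ∫ ξ, direction j ξ * 𝓕 φ ξ)) * inv_mul_cancel₀ hne

/-! ### Correlation of a bounded function with a Schwartz function -/

section Correlation

variable {F : Type} [NormedAddCommGroup F] [NormedSpace ℝ F]

theorem exists_norm_le_inv_one_add_pow (X : 𝓢(Space m, F)) (k : ℕ) :
    ∃ C, 0 ≤ C ∧ ∀ x, ‖X x‖ ≤ C * ((1 + ‖x‖) ^ k)⁻¹ := by
  refine ⟨2 ^ k * (Finset.Iic (k, 0)).sup (fun m => SchwartzMap.seminorm ℝ m.1 m.2) X,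
    by positivity, fun x => ?_⟩
  have h := SchwartzMap.one_add_le_sup_seminorm_apply (𝕜 := ℝ) (m := (k, 0)) (k := k) (n := 0)
    le_rfl le_rfl X x
  simp only [norm_iteratedFDeriv_zero] at h
  rw [← div_eq_mul_inv, le_div_iff₀ (by positivity), mul_comm]
  exact h

theorem integrable_inv_one_add_pow :
    Integrable fun x : Space m => ((1 + ‖x‖) ^ (m + 1))⁻¹ := by
  have h := integrable_one_add_norm (E := Space m) (μ := volume) (r := (m : ℝ) + 1) (by simp)
  refine h.congr (Eventually.of_forall fun x => ?_)
  have hx : 0 ≤ 1 + ‖x‖ := by positivity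
  simp only [Real.rpow_neg hx]
  rw [← Nat.cast_add_one, Real.rpow_natCast]

/-- The correlation `∫ w(ζ) X(ζ - η) dζ`. -/
noncomputable def correlation (w : Space m → ℝ) (X : 𝓢(Space m, F)) (η : Space m) : F :=
  ∫ ζ, w ζ • X (ζ - η)

variable {w : Space m → ℝ}

theorem integrable_correlation (hw : Measurable w) {D : ℝ} (hD : ∀ x, |w x| ≤ D)
    (X : 𝓢(Space m, F)) (η : Space m) : Integrable fun ζ => w ζ • X (ζ - η) := by
  have h := (X.integrable (μ := volume)).comp_sub_right η
  exact h.bdd_smul D hw.aestronglyMeasurable (Eventually.of_forall hD)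

theorem exists_norm_correlation_le {D : ℝ} (hD : ∀ x, |w x| ≤ D)
    (X : 𝓢(Space m, F)) : ∃ C, ∀ η, ‖correlation w X η‖ ≤ C := by
  refine ⟨∫ ζ, D * ‖X ζ‖, fun η => ?_⟩
  rw [← integral_sub_right_eq_self (fun ζ => D * ‖X ζ‖) η]
  refine norm_integral_le_of_norm_le
    (((X.integrable (μ := volume)).norm.const_mul D).comp_sub_right η)
    (Eventually.of_forall fun ζ => ?_)
  rw [norm_smul, Real.norm_eq_abs]
  gcongr
  exact hD ζ

theorem hasFDerivAt_correlation (hw : Measurable w) {D : ℝ} (hD : ∀ x, |w x| ≤ D)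
    (X : 𝓢(Space m, F)) (η : Space m) :
    HasFDerivAt (correlation w X)
      (correlation w (-SchwartzMap.fderivCLM ℝ (Space m) F X) η) η := by
  set X' := -SchwartzMap.fderivCLM ℝ (Space m) F X with hX'
  have hD0 : 0 ≤ D := (abs_nonneg _).trans (hD 0)
  obtain ⟨C, hC0, hC⟩ := exists_norm_le_inv_one_add_pow X' (m + 1)
  refine hasFDerivAt_integral_of_dominated_of_fderiv_le (Metric.ball_mem_nhds η one_pos)
    (F := fun z ζ => w ζ • X (ζ - z)) (F' := fun z ζ => w ζ • X' (ζ - z))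
    (bound := fun ζ => D * (C * 2 ^ (m + 1)) * ((1 + ‖ζ - η‖) ^ (m + 1))⁻¹)
    (Eventually.of_forall fun z => (integrable_correlation hw hD X z).aestronglyMeasurable)
    (integrable_correlation hw hD X η) (integrable_correlation hw hD X' η).aestronglyMeasurable
    (Eventually.of_forall fun ζ z hz => ?_)
    ((integrable_inv_one_add_pow.comp_sub_right η).const_mul _)
    (Eventually.of_forall fun ζ z _ => ?_)
  · have h1 : 1 + ‖ζ - η‖ ≤ 2 * (1 + ‖ζ - z‖) := by
      have h2 : ‖ζ - η‖ ≤ ‖ζ - z‖ + ‖z - η‖ := norm_sub_le_norm_sub_add_norm_sub _ _ _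
      have h3 : ‖z - η‖ < 1 := by simpa [dist_eq_norm] using hz
      linarith [norm_nonneg (ζ - z)]
    have h4 : ((1 + ‖ζ - z‖) ^ (m + 1))⁻¹ ≤ 2 ^ (m + 1) * ((1 + ‖ζ - η‖) ^ (m + 1))⁻¹ := by
      rw [← div_eq_mul_inv, inv_eq_one_div, div_le_div_iff₀ (by positivity) (by positivity),
        one_mul, ← mul_pow]
      gcongr
    rw [norm_smul, Real.norm_eq_abs]
    calc |w ζ| * ‖X' (ζ - z)‖ ≤ D * (C * (2 ^ (m + 1) * ((1 + ‖ζ - η‖) ^ (m + 1))⁻¹)) := by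
          gcongr
          · exact hD ζ
          · exact (hC _).trans (by gcongr)
      _ = _ := by ring
  · have h1 : HasFDerivAt (fun z => X (ζ - z)) (X' (ζ - z)) z := by
      have := (X.hasFDerivAt (ζ - z)).comp z ((hasFDerivAt_id z).const_sub ζ)
      refine this.congr_fderiv ?_
      ext v
      simp [hX', SchwartzMap.fderivCLM_apply]
    exact h1.const_smul (w ζ)

end Correlation

theorem contDiff_correlation {w : Space m → ℝ} (hw : Measurable w) {D : ℝ}
    (hD : ∀ x, |w x| ≤ D) (n : ℕ) :
    ∀ {F : Type} [NormedAddCommGroup F] [NormedSpace ℝ F] (X : 𝓢(Space m, F)),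
      ContDiff ℝ n (correlation w X) ∧ ∃ C, ∀ x, ‖iteratedFDeriv ℝ n (correlation w X) x‖ ≤ C := by
  induction n with
  | zero =>
    intro F _ _ X
    refine ⟨contDiff_zero.2 (continuous_iff_continuousAt.2 fun η =>
      (hasFDerivAt_correlation hw hD X η).continuousAt), ?_⟩
    simpa using exists_norm_correlation_le hD X
  | succ n ih =>
    intro F _ _ X
    obtain ⟨h1, C, hC⟩ := ih (-SchwartzMap.fderivCLM ℝ (Space m) F X)
    refine ⟨?_, C, fun x => ?_⟩
    · rw [Nat.cast_add, Nat.cast_one, contDiff_succ_iff_hasFDerivAt]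
      exact ⟨_, h1, hasFDerivAt_correlation hw hD X⟩
    · have : fderiv ℝ (correlation w X) =
          correlation w (-SchwartzMap.fderivCLM ℝ (Space m) F X) :=
        funext fun η => (hasFDerivAt_correlation hw hD X η).fderiv
      rw [← norm_iteratedFDeriv_fderiv, this]
      exact hC x

theorem hasTemperateGrowth_correlation {w : Space m → ℝ} (hw : Measurable w) {D : ℝ}
    (hD : ∀ x, |w x| ≤ D) (X : 𝓢(Space m, ℂ)) : (correlation w X).HasTemperateGrowth := by
  refine ⟨contDiff_infty.2 fun n => (contDiff_correlation hw hD n X).1, fun n => ?_⟩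
  obtain ⟨C, hC⟩ := (contDiff_correlation hw hD n X).2
  exact ⟨0, C, fun x => by simpa using hC x⟩

/-! ### The symbol of the truncated Hilbert transform -/

/-- The correlation of the symbol of the Hilbert transform with the Fourier transform of `Y`. -/
noncomputable def truncatedSymbol (Y : 𝓢(Space m, ℂ)) (j : Fin m) (η : Space m) : ℂ :=
  ∫ ζ, hilbertSymbol j ζ * 𝓕 Y (ζ - η)

theorem truncatedSymbol_eq_correlation (Y : 𝓢(Space m, ℂ)) (j : Fin m) (η : Space m) :
    truncatedSymbol Y j η =
      -Complex.I * correlation (fun ζ => ζ j / ‖ζ‖) (𝓕 Y : 𝓢(Space m, ℂ)) η := by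
  rw [truncatedSymbol, correlation, ← integral_const_mul]
  congr 1
  ext ζ
  rw [hilbertSymbol, direction, Complex.real_smul]
  ring

theorem measurable_apply_div_norm (j : Fin m) : Measurable fun ζ : Space m => ζ j / ‖ζ‖ :=
  Measurable.div (EuclideanSpace.proj (𝕜 := ℝ) j).continuous.measurable measurable_norm

theorem abs_apply_div_norm_le (j : Fin m) (ζ : Space m) : |ζ j / ‖ζ‖| ≤ 1 := by
  rw [abs_div, abs_norm]
  exact div_le_one_of_le₀ (abs_apply_le_norm ζ j) (norm_nonneg ζ)

theorem hasTemperateGrowth_truncatedSymbol (Y : 𝓢(Space m, ℂ)) (j : Fin m) :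
    (truncatedSymbol Y j).HasTemperateGrowth := by
  rw [funext (truncatedSymbol_eq_correlation Y j)]
  exact (Function.HasTemperateGrowth.const (-Complex.I)).mul
    (hasTemperateGrowth_correlation (measurable_apply_div_norm j) (abs_apply_div_norm_le j) _)

theorem exists_norm_truncatedSymbol_le (Y : 𝓢(Space m, ℂ)) (j : Fin m) :
    ∃ C, ∀ η, ‖truncatedSymbol Y j η‖ ≤ C := by
  obtain ⟨C, hC⟩ := exists_norm_correlation_le (abs_apply_div_norm_le j)
    (𝓕 Y : 𝓢(Space m, ℂ))
  exact ⟨C, fun η => by simpa [truncatedSymbol_eq_correlation] using hC η⟩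

theorem norm_hilbertSymbol_le (j : Fin m) (ξ : Space m) : ‖hilbertSymbol j ξ‖ ≤ 1 := by
  rw [hilbertSymbol, direction, norm_mul, norm_neg, Complex.norm_I, one_mul, Complex.norm_real]
  exact abs_apply_div_norm_le j ξ

theorem continuousAt_hilbertSymbol (j : Fin m) {ξ : Space m} (hξ : ξ ≠ 0) :
    ContinuousAt (hilbertSymbol j) ξ := by
  refine continuousAt_const.mul (Complex.continuous_ofReal.continuousAt.comp ?_)
  exact (EuclideanSpace.proj (𝕜 := ℝ) j).continuous.continuousAt.div
    continuous_norm.continuousAt (norm_ne_zero_iff.2 hξ)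

theorem tendsto_truncatedSymbol (Y : 𝓢(Space m, ℂ)) (j : Fin m) {ξ : Space m} (hξ : ξ ≠ 0) :
    Tendsto (fun R : ℝ => truncatedSymbol Y j (R • ξ)) atTop (𝓝 (hilbertSymbol j ξ * Y 0)) := by
  have h1 : ∀ R : ℝ, truncatedSymbol Y j (R • ξ) =
      ∫ ζ, hilbertSymbol j (ζ + R • ξ) * 𝓕 Y ζ := fun R => by
    rw [truncatedSymbol, ← integral_add_right_eq_self _ (R • ξ)]
    simp
  rw [apply_zero_eq_integral_fourier, ← integral_const_mul]
  simp only [h1]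
  refine tendsto_integral_filter_of_dominated_convergence (fun ζ => ‖𝓕 Y ζ‖)
    (Eventually.of_forall fun R => ?_) (Eventually.of_forall fun R => Eventually.of_forall
      fun ζ => ?_) ((𝓕 Y : 𝓢(Space m, ℂ)).integrable (μ := volume)).norm
    (Eventually.of_forall fun ζ => ?_)
  · exact (((isAngular_hilbertSymbol j).measurable.comp (measurable_add_const _)).mul
      (𝓕 Y : 𝓢(Space m, ℂ)).continuous.measurable).aestronglyMeasurable
  · rw [norm_mul]
    exact mul_le_of_le_one_left (norm_nonneg _) (norm_hilbertSymbol_le j _)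
  · refine Tendsto.mul_const _ ?_
    have h2 : Tendsto (fun R : ℝ => R⁻¹ • ζ + ξ) atTop (𝓝 ξ) := by
      have := (tendsto_inv_atTop_zero (𝕜 := ℝ)).smul_const ζ
      simpa using this.add_const ξ
    refine ((continuousAt_hilbertSymbol j hξ).tendsto.comp h2).congr' ?_
    filter_upwards [eventually_gt_atTop 0] with R hR
    rw [Function.comp_apply, ← (isAngular_hilbertSymbol j).smul_eq R _ hR, smul_add, smul_smul,
      mul_inv_cancel₀ hR.ne', one_smul]

/-! ### Decay of the truncation error -/

/-- The kernel `y_j / |y| ^ (m + 1)`. -/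
noncomputable def rieszKernel (j : Fin m) (y : Space m) : ℝ := y j / ‖y‖ * (‖y‖ ^ m)⁻¹

/-- On test functions vanishing near the origin, the symbol of the Hilbert transform is the
Fourier transform of a function. -/
theorem exists_integral_hilbertSymbol_mul_fourier [NeZero m] (j : Fin m) :
    ∃ c : ℂ, ∀ ψ : 𝓢(Space m, ℂ), (∀ᶠ y in 𝓝 0, ψ y = 0) →
      ∫ ξ, hilbertSymbol j ξ * 𝓕 ψ ξ = c * ∫ y, (rieszKernel j y : ℂ) * ψ y := by
  have hm : (0 : ℝ) < m := by exact_mod_cast Nat.pos_of_ne_zero (NeZero.ne m)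
  set a : ℂ := (Real.pi : ℂ) ^ (((0 : ℂ) + 1) / 2) * (Complex.Gamma (((0 : ℂ) + 1) / 2))⁻¹ with ha
  set b : ℂ := Complex.I * ((Real.pi : ℂ) ^ (((m : ℂ) + 1 - 0) / 2) *
    (Complex.Gamma (((m : ℂ) + 1 - 0) / 2))⁻¹) with hb
  have hb0 : b ≠ 0 := by
    refine mul_ne_zero Complex.I_ne_zero (pi_cpow_mul_Gamma_inv_ne_zero fun l hl => ?_)
    have := congrArg Complex.re hl
    rw [Complex.div_ofNat_re, sub_zero, Complex.add_re, Complex.one_re, Complex.natCast_re,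
      Complex.neg_re, Complex.natCast_re] at this
    have : (0 : ℝ) ≤ l := l.cast_nonneg
    linarith
  refine ⟨-Complex.I * (b⁻¹ * a), fun ψ hψ => ?_⟩
  have h1 := riesz_direction_continuation ψ j (μ := 0)
    (fun l hl => by
      have := congrArg Complex.re hl
      simp at this
      have : (0 : ℝ) ≤ l := l.cast_nonneg
      linarith)
    (fun n hn => by
      have := congrArg Complex.re hn
      simp at this
      have : (0 : ℝ) ≤ n := n.cast_nonneg
      linarith)
  have hR : RadialBound ψ 1 := by
    refine ⟨ψ.continuous.measurable, ?_, (hasRadialExpansion_schwartz ψ).far⟩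
    obtain ⟨δ, hδ, hψ⟩ := Metric.eventually_nhds_iff_ball.1 hψ
    obtain ⟨C, hC⟩ := (radialBound_schwartz ψ).near
    refine ⟨|C| * δ⁻¹, fun x hx hx1 => ?_⟩
    by_cases h : ‖x‖ < δ
    · rw [hψ x (by simpa using h), norm_zero]
      positivity
    · have h2 : 1 ≤ δ⁻¹ * ‖x‖ := by
        rw [← div_eq_inv_mul, one_le_div hδ]
        exact not_lt.1 h
      have h3 := hC x hx hx1
      rw [pow_zero, mul_one] at h3
      rw [pow_one, mul_assoc]
      exact (h3.trans (le_abs_self C)).trans (le_mul_of_one_le_right (abs_nonneg C) h2)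
  have e1 : angularFp (direction j) ψ 0 = ∫ y, (rieszKernel j y : ℂ) * ψ y := by
    have h2 := (hasRadialFinitePart_angularFp (isAngular_direction j) ψ (s := 0) fun n hn => by
      have : n = 0 := by simpa using hn
      rw [this]
      exact sphereIntegral_direction_mul_taylorAngular_of_even _ Even.zero j).unique
        ((hR.mul_angular (isAngular_direction j)).hasRadialFinitePart (by simp))
    rw [h2]
    congr 1
    ext y
    rw [rieszKernel, direction, zero_sub, Complex.cpow_neg, Complex.cpow_natCast]
    push_cast
    ring
  have e2 : angularFp (direction j) (𝓕 ψ) ((m : ℂ) - 0) = ∫ ξ, direction j ξ * 𝓕 ψ ξ := by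
    rw [angularFp_eq_integral (isAngular_direction j) _ (by simpa using hm)]
    simp
  have e3 : ∫ ξ, hilbertSymbol j ξ * 𝓕 ψ ξ = -Complex.I * ∫ ξ, direction j ξ * 𝓕 ψ ξ := by
    rw [← integral_const_mul]
    congr 1
    ext ξ
    rw [hilbertSymbol]
    ring
  rw [e1, e2] at h1
  rw [e3, mul_assoc, mul_assoc, h1, inv_mul_cancel_left₀ hb0]

/-- The character `y ↦ exp (2 π i ⟨y, η⟩)`. -/
noncomputable def character (η y : Space m) : ℂ :=
  Complex.exp ((2 * Real.pi * inner ℝ y η : ℝ) * Complex.I)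

theorem contDiff_character (η : Space m) : ContDiff ℝ (⊤ : ℕ∞) (character η) := by
  refine Complex.contDiff_exp.comp (ContDiff.mul (Complex.ofRealCLM.contDiff.comp ?_)
    contDiff_const)
  exact contDiff_const.mul (contDiff_id.inner ℝ contDiff_const)

theorem norm_character (η y : Space m) : ‖character η y‖ = 1 := Complex.norm_exp_ofReal_mul_I _

theorem fourier_eq_integral (ψ : 𝓢(Space m, ℂ)) (ζ : Space m) :
    𝓕 ψ ζ = ∫ y, character (-ζ) y * ψ y := by
  rw [SchwartzMap.fourier_coe, Real.fourier_eq']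
  simp [character]

theorem fourierInv_eq_integral (ψ : 𝓢(Space m, ℂ)) (ζ : Space m) :
    𝓕⁻ ψ ζ = ∫ y, character ζ y * ψ y := by
  rw [SchwartzMap.fourierInv_coe, Real.fourierInv_eq']
  simp [character]

theorem character_add (η ζ y : Space m) :
    character (η + ζ) y = character η y * character ζ y := by
  rw [character, character, character, ← Complex.exp_add, inner_add_right]
  push_cast
  ring_nf

theorem character_add_right (η y z : Space m) :
    character η (y + z) = character η y * character η z := by
  rw [character, character, character, ← Complex.exp_add, inner_add_left]
  push_cast
  ring_nf

theorem character_zero (y : Space m) : character 0 y = 1 := by simp [character]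

theorem character_comm (η y : Space m) : character η y = character y η := by
  rw [character, character, real_inner_comm]

theorem fourier_of_eq_character_mul {ψ θ : 𝓢(Space m, ℂ)} {η : Space m}
    (h : ∀ y, ψ y = character η y * θ y) (ζ : Space m) : 𝓕 ψ ζ = 𝓕 θ (ζ - η) := by
  rw [fourier_eq_integral, fourier_eq_integral]
  congr 1
  ext y
  rw [h, ← mul_assoc, ← character_add]
  congr 2
  abel

theorem contDiff_rieszKernel_mul (j : Fin m) {θ : Space m → ℂ} (hθ : ContDiff ℝ (⊤ : ℕ∞) θ)
    (h0 : ∀ᶠ y in 𝓝 0, θ y = 0) :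
    ContDiff ℝ (⊤ : ℕ∞) fun y => (rieszKernel j y : ℂ) * θ y := by
  refine contDiff_iff_contDiffAt.2 fun y => ?_
  by_cases hy : y = 0
  · subst hy
    refine contDiffAt_const (c := (0 : ℂ)).congr_of_eventuallyEq ?_
    filter_upwards [h0] with y hy
    rw [hy, mul_zero]
  · refine ContDiffAt.mul (Complex.ofRealCLM.contDiff.contDiffAt.comp y ?_) hθ.contDiffAt
    have hn : ContDiffAt ℝ (⊤ : ℕ∞) (fun y : Space m => ‖y‖) y := contDiffAt_norm ℝ hy
    have hy' : ‖y‖ ≠ 0 := norm_ne_zero_iff.2 hy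
    exact ((EuclideanSpace.proj (𝕜 := ℝ) j).contDiff.contDiffAt.div hn hy').mul
      ((hn.pow m).inv (pow_ne_zero _ hy'))

theorem exists_schwartz_decay [NeZero m] (j : Fin m) {θ : 𝓢(Space m, ℂ)} (hc : HasCompactSupport θ)
    (h0 : ∀ᶠ y in 𝓝 0, θ y = 0) (M : ℕ) :
    ∃ C, ∀ η, ‖η‖ ^ M * ‖truncatedSymbol θ j η‖ ≤ C := by
  obtain ⟨c, hcc⟩ := exists_integral_hilbertSymbol_mul_fourier j
  set K : 𝓢(Space m, ℂ) := (hc.mul_left (f := fun y => (rieszKernel j y : ℂ))).toSchwartzMap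
    (contDiff_rieszKernel_mul j (θ.smooth ⊤) h0) with hK
  have hKa : ∀ y, K y = (rieszKernel j y : ℂ) * θ y := fun y => rfl
  have h1 : ∀ η, truncatedSymbol θ j η = c * 𝓕⁻ K η := fun η => by
    set ψ : 𝓢(Space m, ℂ) := (hc.mul_left (f := character η)).toSchwartzMap
      ((contDiff_character η).mul (θ.smooth ⊤)) with hψ
    have hψa : ∀ y, ψ y = character η y * θ y := fun y => rfl
    have h2 := hcc ψ (h0.mono fun y hy => by rw [hψa, hy, mul_zero])
    simp only [fourier_of_eq_character_mul hψa] at h2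
    rw [truncatedSymbol, h2, fourierInv_eq_integral]
    congr 2
    ext y
    rw [hψa, hKa]
    ring
  obtain ⟨C, hC⟩ := (𝓕⁻ K : 𝓢(Space m, ℂ)).decay M 0
  refine ⟨‖c‖ * C, fun η => ?_⟩
  rw [h1, norm_mul, mul_left_comm]
  gcongr
  simpa using hC.2 η

theorem fourier_of_eq_dilation {ψ θ : 𝓢(Space m, ℂ)} {R : ℝ} (hR : 0 < R)
    (h : ∀ y, ψ y = θ (R⁻¹ • y)) (ζ : Space m) : 𝓕 ψ ζ = R ^ m • 𝓕 θ (R • ζ) := by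
  have h1 := Measure.integral_comp_inv_smul_of_nonneg (volume : Measure (Space m))
    (fun y => character (-(R • ζ)) y * θ y) hR.le
  rw [finrank_euclideanSpace, Fintype.card_fin] at h1
  rw [fourier_eq_integral, fourier_eq_integral, ← h1]
  congr 1
  ext y
  rw [h, character, character, inner_neg_right, inner_neg_right, inner_smul_left, inner_smul_right]
  congr 5
  simp only [conj_trivial]
  field_simp

theorem truncatedSymbol_of_eq_dilation {ψ θ : 𝓢(Space m, ℂ)} {R : ℝ} (hR : 0 < R)
    (h : ∀ y, ψ y = θ (R⁻¹ • y)) (j : Fin m) (η : Space m) :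
    truncatedSymbol ψ j η = truncatedSymbol θ j (R • η) := by
  have h1 := Measure.integral_comp_smul_of_nonneg (volume : Measure (Space m))
    (fun ζ => hilbertSymbol j ζ * 𝓕 θ (ζ - R • η)) R (hR := hR.le)
  rw [finrank_euclideanSpace, Fintype.card_fin] at h1
  have hR' : R ^ m ≠ 0 := by positivity
  rw [truncatedSymbol, truncatedSymbol, ← smul_inv_smul₀ hR' (∫ ζ, hilbertSymbol j ζ *
    𝓕 θ (ζ - R • η)), ← h1, ← integral_smul]
  congr 1
  ext ζ
  rw [fourier_of_eq_dilation hR h, (isAngular_hilbertSymbol j).smul_eq R ζ hR, smul_sub,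
    mul_smul_comm]

theorem truncatedSymbol_sub (ψ θ : 𝓢(Space m, ℂ)) (j : Fin m) (η : Space m) :
    truncatedSymbol (ψ - θ) j η = truncatedSymbol ψ j η - truncatedSymbol θ j η := by
  simp only [truncatedSymbol_eq_correlation]
  rw [← mul_sub, correlation, correlation, correlation, ← integral_sub]
  · congr 2
    ext ζ
    rw [← smul_sub, ← sub_apply]
    congr 2
    exact map_sub (fourierCLM ℂ 𝓢(Space m, ℂ)) ψ θ
  · exact integrable_correlation (measurable_apply_div_norm j) (abs_apply_div_norm_le j) _ _
  · exact integrable_correlation (measurable_apply_div_norm j) (abs_apply_div_norm_le j) _ _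

/-- A cutoff function, as a Schwartz function. -/
noncomputable def IsCutoff.toSchwartz {χ : Space m → ℝ} (hχ : IsCutoff χ) : 𝓢(Space m, ℂ) :=
  (hχ.compact.comp_left (g := fun t : ℝ => (t : ℂ)) (by simp)).toSchwartzMap
    (Complex.ofRealCLM.contDiff.comp hχ.smooth)

theorem IsCutoff.toSchwartz_apply {χ : Space m → ℝ} (hχ : IsCutoff χ) (y : Space m) :
    hχ.toSchwartz y = χ y := rfl

theorem IsCutoff.hasCompactSupport_toSchwartz {χ : Space m → ℝ} (hχ : IsCutoff χ) :
    HasCompactSupport hχ.toSchwartz :=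
  hχ.compact.comp_left (g := fun t : ℝ => (t : ℂ)) (by simp)

theorem IsCutoff.dilate {χ : Space m → ℝ} (hχ : IsCutoff χ) {R : ℝ} (hR : 0 < R) :
    IsCutoff fun y => χ (R⁻¹ • y) where
  smooth := hχ.smooth.comp (contDiff_const_smul _)
  compact := hχ.compact.comp_smul (inv_ne_zero hR.ne')
  eq_one := by
    have h : Tendsto (fun y : Space m => R⁻¹ • y) (𝓝 0) (𝓝 0) := by
      have := (continuous_const_smul R⁻¹ (T := Space m)).tendsto 0
      rwa [smul_zero] at this
    exact h.eventually hχ.eq_one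

/-- The symbol of the Hilbert transform with truncated kernel. -/
noncomputable def IsCutoff.symbol {χ : Space m → ℝ} (hχ : IsCutoff χ) (j : Fin m) :
    Space m → ℂ :=
  truncatedSymbol hχ.toSchwartz j

theorem IsCutoff.symbol_dilate {χ : Space m → ℝ} (hχ : IsCutoff χ) {R : ℝ} (hR : 0 < R)
    (j : Fin m) (η : Space m) : (hχ.dilate hR).symbol j η = hχ.symbol j (R • η) :=
  truncatedSymbol_of_eq_dilation hR (fun _ => rfl) j η

theorem IsCutoff.tendsto_symbol {χ : Space m → ℝ} (hχ : IsCutoff χ) (j : Fin m) {ξ : Space m}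
    (hξ : ξ ≠ 0) :
    Tendsto (fun R : ℝ => hχ.symbol j (R • ξ)) atTop (𝓝 (hilbertSymbol j ξ)) := by
  have h := tendsto_truncatedSymbol hχ.toSchwartz j hξ
  rwa [hχ.toSchwartz_apply, hχ.eq_one.self_of_nhds, Complex.ofReal_one, mul_one] at h

theorem IsCutoff.symbol_decay [NeZero m] {χ : Space m → ℝ} (hχ : IsCutoff χ) (j : Fin m)
    (M : ℕ) : ∃ C, ∀ η, 1 ≤ ‖η‖ → ‖η‖ ^ M * ‖hχ.symbol j η - hilbertSymbol j η‖ ≤ C := by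
  have h2 := hχ.dilate two_pos
  obtain ⟨C, hC⟩ := exists_schwartz_decay j (θ := h2.toSchwartz - hχ.toSchwartz)
    (h2.hasCompactSupport_toSchwartz.sub hχ.hasCompactSupport_toSchwartz)
    (by filter_upwards [h2.eq_one, hχ.eq_one] with y h1 h3
        rw [sub_apply, h2.toSchwartz_apply, hχ.toSchwartz_apply, h1, h3, sub_self]) (M + 1)
  have hd : ∀ η, truncatedSymbol (h2.toSchwartz - hχ.toSchwartz) j η =
      hχ.symbol j ((2 : ℝ) • η) - hχ.symbol j η := fun η => by
    rw [truncatedSymbol_sub, ← hχ.symbol_dilate two_pos]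
    rfl
  have hC0 : 0 ≤ C := (mul_nonneg (by positivity) (norm_nonneg _)).trans (hC 0)
  refine ⟨C * 2, fun η hη => ?_⟩
  have hη0 : η ≠ 0 := norm_pos_iff.1 (by linarith)
  have hn : ∀ n : ℕ, ‖η‖ ^ M * ‖hχ.symbol j η - hχ.symbol j ((2 : ℝ) ^ n • η)‖ ≤ C * 2 :=
    fun n => by
    have hstep : ∀ i : ℕ, ‖η‖ ^ M *
        ‖hχ.symbol j ((2 : ℝ) ^ (i + 1) • η) - hχ.symbol j ((2 : ℝ) ^ i • η)‖ ≤
        C * (1 / 2) ^ i := fun i => by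
      have h := hC ((2 : ℝ) ^ i • η)
      rw [hd, smul_smul, ← pow_succ', norm_smul, norm_pow, Real.norm_ofNat] at h
      have h1 : (1 : ℝ) ≤ 2 ^ i := one_le_pow₀ one_le_two
      rw [one_div, inv_pow, ← div_eq_mul_inv, le_div_iff₀ (by positivity)]
      refine le_trans ?_ h
      rw [mul_right_comm]
      gcongr
      calc ‖η‖ ^ M * 2 ^ i ≤ (2 ^ i * ‖η‖) ^ M * (2 ^ i * ‖η‖) := by
            gcongr
            · exact le_mul_of_one_le_left (norm_nonneg _) h1
            · exact le_mul_of_one_le_right (by positivity) hη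
        _ = _ := (pow_succ _ _).symm
    have hs := Finset.sum_range_sub (fun i => hχ.symbol j ((2 : ℝ) ^ i • η)) n
    rw [pow_zero, one_smul] at hs
    rw [norm_sub_rev, ← hs]
    calc _ ≤ ‖η‖ ^ M * ∑ i ∈ Finset.range n,
          ‖hχ.symbol j ((2 : ℝ) ^ (i + 1) • η) - hχ.symbol j ((2 : ℝ) ^ i • η)‖ := by
          gcongr; exact norm_sum_le _ _
      _ ≤ ∑ i ∈ Finset.range n, C * (1 / 2) ^ i := by
          rw [Finset.mul_sum]; exact Finset.sum_le_sum fun i _ => hstep i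
      _ ≤ C * 2 := by rw [← Finset.mul_sum]; gcongr; exact sum_geometric_two_le n
  have hl : Tendsto (fun n : ℕ => hχ.symbol j ((2 : ℝ) ^ n • η)) atTop (𝓝 (hilbertSymbol j η)) :=
    (hχ.tendsto_symbol j hη0).comp (tendsto_pow_atTop_atTop_of_one_lt one_lt_two)
  exact le_of_tendsto (((tendsto_const_nhds.sub hl).norm).const_mul _) (Eventually.of_forall hn)

/-! ### Convolution with the truncated kernel -/

theorem fourier_of_eq_mul {Y φ ψ : 𝓢(Space m, ℂ)} (h : ∀ y, ψ y = Y y * φ y) (ζ : Space m) :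
    𝓕 ψ ζ = ∫ η, 𝓕 Y (ζ - η) * 𝓕 φ η := by
  have hφ : ∀ y, φ y = ∫ η, character y η * 𝓕 φ η := fun y => by
    rw [← fourierInv_eq_integral (𝓕 φ : 𝓢(Space m, ℂ))]
    exact congrArg (fun f : 𝓢(Space m, ℂ) => f y) (fourierInv_fourier_eq φ).symm
  have hint : Integrable (fun p : Space m × Space m =>
      character (-ζ) p.1 * character p.1 p.2 * (Y p.1 * 𝓕 φ p.2)) (volume.prod volume) := by
    have h1 := (Y.integrable (μ := volume)).mul_prod
      ((𝓕 φ : 𝓢(Space m, ℂ)).integrable (μ := volume))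
    refine h1.bdd_mul (c := 1) ?_ (Eventually.of_forall fun p => by
      rw [norm_mul, norm_character, norm_character, one_mul])
    refine Continuous.aestronglyMeasurable ?_
    unfold character
    fun_prop
  rw [fourier_eq_integral]
  calc ∫ y, character (-ζ) y * ψ y
      = ∫ y, ∫ η, character (-ζ) y * character y η * (Y y * 𝓕 φ η) := by
        congr 1
        ext y
        rw [h, hφ, ← integral_const_mul, ← integral_const_mul]
        congr 1
        ext η
        ring
    _ = ∫ η, ∫ y, character (-ζ) y * character y η * (Y y * 𝓕 φ η) :=
        integral_integral_swap hint
    _ = _ := by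
        congr 1
        ext η
        rw [fourier_eq_integral Y, ← integral_mul_const]
        congr 1
        ext y
        rw [show -(ζ - η) = -ζ + η by abel, character_add, character_comm y η]
        ring

theorem fourier_of_eq_translation {φ ψ : 𝓢(Space m, ℂ)} {x : Space m}
    (h : ∀ y, ψ y = φ (x + y)) (ζ : Space m) : 𝓕 ψ ζ = character ζ x * 𝓕 φ ζ := by
  rw [fourier_eq_integral, fourier_eq_integral,
    ← integral_add_left_eq_self (fun y => character (-ζ) y * φ y) x, ← integral_const_mul]
  congr 1
  ext y
  rw [h, character_add_right, ← mul_assoc, ← mul_assoc, ← character_add, add_neg_cancel,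
    character_zero, one_mul]

theorem integral_hilbertSymbol_mul_fourier_mul (Y φ : 𝓢(Space m, ℂ)) {ψ : 𝓢(Space m, ℂ)}
    {x : Space m} (h : ∀ y, ψ y = Y y * φ (x + y)) (j : Fin m) :
    ∫ ζ, hilbertSymbol j ζ * 𝓕 ψ ζ =
      𝓕⁻ (SchwartzMap.smulLeftCLM ℂ (truncatedSymbol Y j) (𝓕 φ)) x := by
  set φx : 𝓢(Space m, ℂ) := SchwartzMap.compSubConstCLM ℂ (-x) φ with hφx
  have hφxa : ∀ y, φx y = φ (x + y) := fun y => by simp [hφx, add_comm]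
  have h1 : ∀ ζ, 𝓕 ψ ζ = ∫ η, 𝓕 Y (ζ - η) * 𝓕 φx η :=
    fourier_of_eq_mul fun y => by rw [h, hφxa]
  have hint : Integrable (fun p : Space m × Space m =>
      hilbertSymbol j p.1 * (𝓕 Y (p.1 - p.2) * 𝓕 φx p.2)) (volume.prod volume) := by
    have h2 := ((𝓕 φx : 𝓢(Space m, ℂ)).integrable (μ := volume)).convolution_integrand
      (ContinuousLinearMap.mul ℝ ℂ) ((𝓕 Y : 𝓢(Space m, ℂ)).integrable (μ := volume))
    refine (h2.bdd_mul (c := 1)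
      ((isAngular_hilbertSymbol j).measurable.comp measurable_fst).aestronglyMeasurable
      (Eventually.of_forall fun p => norm_hilbertSymbol_le j p.1)).congr
      (Eventually.of_forall fun p => ?_)
    simp only [ContinuousLinearMap.mul_apply', Function.comp_apply]
    ring
  rw [fourierInv_eq_integral]
  calc ∫ ζ, hilbertSymbol j ζ * 𝓕 ψ ζ
      = ∫ ζ, ∫ η, hilbertSymbol j ζ * (𝓕 Y (ζ - η) * 𝓕 φx η) := by
        congr 1
        ext ζ
        rw [h1, integral_const_mul]
    _ = ∫ η, ∫ ζ, hilbertSymbol j ζ * (𝓕 Y (ζ - η) * 𝓕 φx η) := integral_integral_swap hint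
    _ = _ := by
        congr 1
        ext η
        rw [SchwartzMap.smulLeftCLM_apply_apply (hasTemperateGrowth_truncatedSymbol Y j),
          fourier_of_eq_translation hφxa, truncatedSymbol, smul_eq_mul, ← integral_mul_const,
          ← integral_const_mul]
        congr 1
        ext ζ
        rw [character_comm η x]
        ring

/-! ### Calculus of radial finite parts -/

theorem RadialBound.integrableOn [NeZero m] {f : Space m → ℂ} {N : ℕ} (hf : RadialBound f N)
    (s : ℂ) {ε : ℝ} (hε : 0 < ε) :
    IntegrableOn (fun x => (‖x‖ : ℂ) ^ (s - m) * f x) {x : Space m | ε < ‖x‖} := by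
  refine integrableOn_norm_gt hf.measurable hε ?_ hf.far
  obtain ⟨C, hC⟩ := hf.near
  refine ⟨|C|, fun x hx hx1 => (hC x (norm_pos_iff.1 (hε.trans hx)) hx1).trans ?_⟩
  calc C * ‖x‖ ^ N ≤ |C| * 1 := by
        gcongr
        · exact le_abs_self C
        · exact pow_le_one₀ (norm_nonneg _) hx1.le
    _ = _ := mul_one _

theorem IsAngular.radialBound_indicator {A : Space m → ℂ} (hA : IsAngular A) :
    RadialBound ((Metric.ball 0 1).indicator A) 0 := by
  obtain ⟨D, hD⟩ := hA.bounded
  refine ⟨hA.measurable.indicator measurableSet_ball, ⟨D, fun x _ _ => ?_⟩,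
    fun M => ⟨0, fun x hx => ?_⟩⟩
  · rw [pow_zero, mul_one]
    exact (norm_indicator_le_norm_self _ _).trans (hD x)
  · rw [Set.indicator_of_notMem (by simpa using hx)]
    simp

theorem HasRadialFinitePart.congr {f g : Space m → ℂ} {s v : ℂ} (h : HasRadialFinitePart f s v)
    (hfg : ∀ x, x ≠ 0 → f x = g x) : HasRadialFinitePart g s v := by
  refine HasFinitePart.congr' h ?_
  filter_upwards [self_mem_nhdsWithin] with ε hε
  refine setIntegral_congr_fun (measurableSet_norm_gt ε) fun x hx => ?_
  have hε' : (0 : ℝ) < ε := hε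
  simp only [hfg x (norm_pos_iff.1 (hε'.trans hx))]

theorem HasRadialFinitePart.add {f g : Space m → ℂ} {s v w : ℂ} (hf : HasRadialFinitePart f s v)
    (hg : HasRadialFinitePart g s w)
    (hfi : ∀ ε : ℝ, 0 < ε → IntegrableOn (fun x => (‖x‖ : ℂ) ^ (s - m) * f x) {x | ε < ‖x‖})
    (hgi : ∀ ε : ℝ, 0 < ε → IntegrableOn (fun x => (‖x‖ : ℂ) ^ (s - m) * g x) {x | ε < ‖x‖}) :
    HasRadialFinitePart (fun x => f x + g x) s (v + w) := by
  refine (HasFinitePart.add hf hg).congr' ?_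
  filter_upwards [self_mem_nhdsWithin] with ε hε
  simp only [mul_add]
  exact (integral_add (hfi ε hε) (hgi ε hε)).symm

theorem HasRadialFinitePart.sum {ι : Type*} {S : Finset ι} {f : ι → Space m → ℂ} {s : ℂ}
    {v : ι → ℂ} (hf : ∀ i ∈ S, HasRadialFinitePart (f i) s (v i))
    (hfi : ∀ i ∈ S, ∀ ε : ℝ, 0 < ε →
      IntegrableOn (fun x => (‖x‖ : ℂ) ^ (s - m) * f i x) {x | ε < ‖x‖}) :
    HasRadialFinitePart (fun x => ∑ i ∈ S, f i x) s (∑ i ∈ S, v i) := by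
  refine (HasFinitePart.sum hf).congr' ?_
  filter_upwards [self_mem_nhdsWithin] with ε hε
  simp only [Finset.mul_sum]
  exact (integral_finsetSum _ fun i hi => hfi i hi ε hε).symm

theorem norm_cpow_add_natCast_mul {x : Space m} (hx : x ≠ 0) (s a : ℂ) (n : ℕ) :
    (‖x‖ : ℂ) ^ (s + n - m) * a = (‖x‖ : ℂ) ^ (s - m) * ((‖x‖ : ℂ) ^ n * a) := by
  have hx0 : (‖x‖ : ℂ) ≠ 0 := by simpa using hx
  rw [show s + n - m = (s - m) + n by ring, Complex.cpow_add _ _ hx0, Complex.cpow_natCast,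
    mul_assoc]

theorem HasRadialFinitePart.pow_mul {f : Space m → ℂ} {s v : ℂ} {n : ℕ}
    (h : HasRadialFinitePart f (s + n) v) :
    HasRadialFinitePart (fun x => (‖x‖ : ℂ) ^ n * f x) s v := by
  refine HasFinitePart.congr' h ?_
  filter_upwards [self_mem_nhdsWithin] with ε hε
  refine setIntegral_congr_fun (measurableSet_norm_gt ε) fun x hx => ?_
  have hε' : (0 : ℝ) < ε := hε
  exact norm_cpow_add_natCast_mul (norm_pos_iff.1 (hε'.trans hx)) s _ n

theorem setIntegral_norm_gt_comp_smul {f : Space m → ℂ} (z : ℂ) {R : ℝ} (hR : 0 < R) (ε : ℝ) :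
    ∫ x in {x : Space m | ε < ‖x‖}, (‖x‖ : ℂ) ^ (z - m) * f (R • x) =
      (R : ℂ) ^ (-z) * ∫ x in {x : Space m | R * ε < ‖x‖}, (‖x‖ : ℂ) ^ (z - m) * f x := by
  have hR' : (R : ℂ) ≠ 0 := by exact_mod_cast hR.ne'
  rw [← integral_indicator (measurableSet_norm_gt _), ← integral_indicator (measurableSet_norm_gt _)]
  have h1 := Measure.integral_comp_smul_of_nonneg (volume : Measure (Space m))
    ({x : Space m | R * ε < ‖x‖}.indicator fun x => (‖x‖ : ℂ) ^ (z - m) * f x) R (hR := hR.le)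
  rw [finrank_euclideanSpace, Fintype.card_fin] at h1
  have h2 : ∀ x : Space m, {x : Space m | R * ε < ‖x‖}.indicator
      (fun x => (‖x‖ : ℂ) ^ (z - m) * f x) (R • x) = (R : ℂ) ^ (z - m) *
      {x : Space m | ε < ‖x‖}.indicator (fun x => (‖x‖ : ℂ) ^ (z - m) * f (R • x)) x := fun x => by
    have e1 : R • x ∈ {x : Space m | R * ε < ‖x‖} ↔ x ∈ {x : Space m | ε < ‖x‖} := by
      simp only [Set.mem_ofPred_eq, norm_smul, Real.norm_of_nonneg hR.le, mul_lt_mul_iff_right₀ hR]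
    by_cases h : x ∈ {x : Space m | ε < ‖x‖}
    · rw [Set.indicator_of_mem (e1.2 h), Set.indicator_of_mem h, norm_smul,
        Real.norm_of_nonneg hR.le, Complex.ofReal_mul,
        Complex.mul_cpow_ofReal_nonneg hR.le (norm_nonneg _), mul_assoc]
    · rw [Set.indicator_of_notMem (fun h' => h (e1.1 h')), Set.indicator_of_notMem h, mul_zero]
  simp only [h2] at h1
  rw [integral_const_mul, Complex.real_smul] at h1
  have h3 : (R : ℂ) ^ (-z) = ((R : ℂ) ^ (z - m))⁻¹ * ((R ^ m)⁻¹ : ℝ) := by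
    rw [← Complex.cpow_neg, Complex.ofReal_inv, Complex.ofReal_pow, ← Complex.cpow_natCast,
      ← Complex.cpow_neg, ← Complex.cpow_add _ _ hR']
    congr 1
    ring
  rw [h3, mul_assoc, ← h1, inv_mul_cancel_left₀ (by simp [Complex.cpow_eq_zero_iff, hR'])]

theorem HasRadialFinitePart.comp_smul {f : Space m → ℂ} {z v : ℂ} (h : HasRadialFinitePart f z v)
    {R : ℝ} (hR : 0 < R) :
    HasRadialFinitePart (fun x => f (R • x)) z ((R : ℂ) ^ (-z) * v) := by
  refine (HasFinitePart.const_smul ((R : ℂ) ^ (-z)) (HasFinitePart.comp_mul hR h)).congr'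
    (Eventually.of_forall fun ε => ?_)
  exact (setIntegral_norm_gt_comp_smul z hR ε).symm

/-! ### Multipliers approximating a homogeneous symbol -/

/-- A smooth bounded function `q` asymptotic to the homogeneous function `k` at infinity. -/
structure IsApproximateSymbol (k q : Space m → ℂ) : Prop where
  angular : IsAngular k
  smooth : ContDiff ℝ (⊤ : ℕ∞) q
  bounded : ∃ C, ∀ x, ‖q x‖ ≤ C
  decay : ∀ M : ℕ, ∃ C, ∀ x, 1 ≤ ‖x‖ → ‖x‖ ^ M * ‖q x - k x‖ ≤ C

namespace IsApproximateSymbol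

variable {k q : Space m → ℂ}

theorem tendsto {ξ : Space m} (h : IsApproximateSymbol k q) (hξ : ξ ≠ 0) :
    Tendsto (fun R : ℝ => q (R • ξ)) atTop (𝓝 (k ξ)) := by
  obtain ⟨C, hC⟩ := h.decay 1
  have hpos := norm_pos_iff.2 hξ
  rw [tendsto_iff_norm_sub_tendsto_zero]
  have h1 : Tendsto (fun R : ℝ => C * (R * ‖ξ‖)⁻¹) atTop (𝓝 0) := by
    have := ((tendsto_id.atTop_mul_const hpos).inv_tendsto_atTop).const_mul C
    simpa using this
  refine squeeze_zero' (Eventually.of_forall fun _ => norm_nonneg _) ?_ h1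
  filter_upwards [eventually_ge_atTop ‖ξ‖⁻¹, eventually_gt_atTop 0] with R hR hR0
  have hn : ‖R • ξ‖ = R * ‖ξ‖ := by rw [norm_smul, Real.norm_of_nonneg hR0.le]
  have h2 := hC (R • ξ) (by rw [hn]; rwa [inv_le_iff_one_le_mul₀ hpos] at hR)
  rw [pow_one, hn, h.angular.smul_eq R ξ hR0] at h2
  rw [← div_eq_mul_inv, le_div_iff₀ (by positivity), mul_comm]
  exact h2

theorem hasRadialExpansion (h : IsApproximateSymbol k q) {B : Space m → ℂ} (hB : IsAngular B) :
    HasRadialExpansion (fun x => B x * (q x - k x))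
      (fun n x => B x * (taylorAngular q n x - if n = 0 then k x else 0)) := by
  refine HasRadialExpansion.mul_angular (f := fun x => q x - k x)
    (A := fun n x => taylorAngular q n x - if n = 0 then k x else 0)
    ⟨h.smooth.continuous.measurable.sub h.angular.measurable, fun n => ?_, fun N => ?_, h.decay⟩ hB
  · split_ifs
    · exact (isAngular_taylorAngular q n).sub h.angular
    · exact (isAngular_taylorAngular q n).sub (.const 0)
  · rcases N with _ | N
    · obtain ⟨C, hC⟩ := h.bounded
      obtain ⟨D, hD⟩ := h.angular.bounded
      exact ⟨C + D, fun x _ _ => by simpa using (norm_sub_le _ _).trans (add_le_add (hC x) (hD x))⟩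
    · obtain ⟨C, hC⟩ := exists_norm_sub_taylor_le h.smooth (N + 1)
      refine ⟨C, fun x hx hx1 => ?_⟩
      convert hC x hx hx1 using 2
      simp only [mul_sub, Finset.sum_sub_distrib]
      rw [Finset.sum_range_succ' (fun n => (‖x‖ : ℂ) ^ n * if n = 0 then k x else 0)]
      simp

theorem radialBound_dilate (h : IsApproximateSymbol k q) {B : Space m → ℂ} (hB : IsAngular B)
    {R : ℝ} (hR : 1 ≤ R) : RadialBound (fun x => B x * (q (R • x) - k (R • x))) 0 := by
  refine RadialBound.mul_angular (F := fun x => q (R • x) - k (R • x)) ⟨?_, ?_, fun M => ?_⟩ hB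
  · exact (h.smooth.continuous.measurable.sub h.angular.measurable).comp
      (measurable_const_smul R)
  · obtain ⟨C, hC⟩ := h.bounded
    obtain ⟨D, hD⟩ := h.angular.bounded
    exact ⟨C + D, fun x _ _ => by
      simpa using (norm_sub_le _ _).trans (add_le_add (hC (R • x)) (hD (R • x)))⟩
  · obtain ⟨C, hC⟩ := h.decay M
    refine ⟨C, fun x hx => le_trans ?_ (hC (R • x) ?_)⟩
    all_goals rw [norm_smul, Real.norm_of_nonneg (by linarith)]
    · gcongr
      exact le_mul_of_one_le_left (norm_nonneg _) hR
    · nlinarith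

/-- The part of `B(x) (q(R x) - k(R x))` away from the origin. -/
noncomputable def outerError (k q B : Space m → ℂ) (R : ℝ) (x : Space m) : ℂ :=
  (Metric.ball 0 1)ᶜ.indicator (fun x => B x * (q (R • x) - k (R • x))) x

theorem radialBound_outerError (h : IsApproximateSymbol k q) {B : Space m → ℂ} (hB : IsAngular B)
    {R : ℝ} (hR : 1 ≤ R) (N : ℕ) : RadialBound (outerError k q B R) N where
  measurable := (h.radialBound_dilate hB hR).measurable.indicator measurableSet_ball.compl
  near := ⟨0, fun x _ hx1 => by
    rw [outerError, Set.indicator_of_notMem (by simpa using hx1)]; simp⟩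
  far M := by
    obtain ⟨C, hC⟩ := (h.radialBound_dilate hB hR).far M
    refine ⟨C, fun x hx => ?_⟩
    rw [outerError, Set.indicator_of_mem (by simpa using hx)]
    exact hC x hx

theorem tendsto_integral_outerError [NeZero m] (h : IsApproximateSymbol k q) {B : Space m → ℂ}
    (hB : IsAngular B) (z : ℂ) :
    Tendsto (fun R : ℝ => ∫ x, (‖x‖ : ℂ) ^ (z - m) * outerError k q B R x) atTop (𝓝 0) := by
  obtain ⟨M, hM⟩ := exists_nat_gt z.re
  obtain ⟨C, hC⟩ := h.decay M
  obtain ⟨D, hD⟩ := hB.bounded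
  have hD0 : 0 ≤ D := (norm_nonneg _).trans (hD 0)
  have hi : Integrable ((Metric.ball (0 : Space m) 1)ᶜ.indicator fun x =>
      D * C * ‖x‖ ^ (z.re - M - m)) :=
    IntegrableOn.integrable_indicator ((integrable_norm_rpow_compl_ball (m := m)
      (σ := z.re - M) (by linarith)).const_mul (D * C)) measurableSet_ball.compl
  rw [show (0 : ℂ) = ∫ _x : Space m, (0 : ℂ) by simp]
  refine tendsto_integral_filter_of_dominated_convergence _ ?_ ?_ hi ?_
  · filter_upwards [eventually_ge_atTop 1] with R hR
    exact ((measurable_norm_cpow _).mul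
      (h.radialBound_outerError hB hR 0).measurable).aestronglyMeasurable
  · filter_upwards [eventually_ge_atTop 1] with R hR
    refine Eventually.of_forall fun x => ?_
    by_cases hx : x ∈ (Metric.ball (0 : Space m) 1)ᶜ
    · have hx1 : 1 ≤ ‖x‖ := by simpa using hx
      have hx0 : 0 < ‖x‖ := by linarith
      rw [outerError, Set.indicator_of_mem hx, Set.indicator_of_mem hx, norm_mul, norm_mul,
        norm_norm_cpow (norm_pos_iff.1 hx0)]
      have hn : ‖R • x‖ = R * ‖x‖ := by rw [norm_smul, Real.norm_of_nonneg (by linarith)]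
      have h2 := hC (R • x) (by rw [hn]; nlinarith)
      have h3 : ‖x‖ ^ M * ‖q (R • x) - k (R • x)‖ ≤ C := by
        refine le_trans ?_ h2
        rw [hn]
        gcongr
        exact le_mul_of_one_le_left (norm_nonneg _) hR
      calc _ ≤ ‖x‖ ^ (z - m).re * (D * ‖q (R • x) - k (R • x)‖) := by gcongr; exact hD x
        _ = D * (‖x‖ ^ M * ‖q (R • x) - k (R • x)‖) * ‖x‖ ^ (z.re - M - m) := by
          rw [show (z - m).re = z.re - M - m + M by simp; ring, Real.rpow_add hx0, Real.rpow_natCast]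
          ring
        _ ≤ D * C * ‖x‖ ^ (z.re - M - m) := by gcongr
    · rw [outerError, Set.indicator_of_notMem hx, Set.indicator_of_notMem hx]
      simp
  · filter_upwards [ae_ne_zero] with x hx
    by_cases hx' : x ∈ (Metric.ball (0 : Space m) 1)ᶜ
    · have h1 : Tendsto (fun R : ℝ => q (R • x) - k (R • x)) atTop (𝓝 (k x - k x)) := by
        refine (h.tendsto hx).sub (tendsto_const_nhds.congr' ?_)
        filter_upwards [eventually_gt_atTop 0] with R hR
        rw [h.angular.smul_eq R x hR]
      rw [sub_self] at h1
      simp only [outerError, Set.indicator_of_mem hx']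
      simpa using (h1.const_mul (B x)).const_mul ((‖x‖ : ℂ) ^ (z - m))
    · simp only [outerError, Set.indicator_of_notMem hx', mul_zero]
      exact tendsto_const_nhds

theorem exists_hasRadialFinitePart_error [NeZero m] (h : IsApproximateSymbol k q)
    {B : Space m → ℂ} (hB : IsAngular B) {z : ℂ} (hz : ∀ l : ℕ, z + l ≠ 0) :
    ∃ C : ℂ, ∀ R : ℝ, 0 < R →
      HasRadialFinitePart (fun x => B x * (q (R • x) - k (R • x))) z ((R : ℂ) ^ (-z) * C) := by
  refine ⟨_, fun R hR => (((h.hasRadialExpansion hB).hasRadialFinitePart_radialFp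
    fun l hl => absurd hl (hz l)).comp_smul hR).congr fun x _ => ?_⟩
  rw [hB.smul_eq R x hR]

/-- The finite part of the `n`-th Taylor term of a test function. -/
theorem exists_hasFinitePart_indicator [NeZero m] (h : IsApproximateSymbol k q)
    {B : Space m → ℂ} (hB : IsAngular B) {z : ℂ} (hz : ∀ l : ℕ, z + l ≠ 0) :
    ∃ W : ℝ → ℂ, (∀ R : ℝ, 1 ≤ R → HasRadialFinitePart
      (fun x => q (R • x) * (Metric.ball 0 1).indicator B x) z (W R)) ∧
      HasFinitePart atTop W (sphereIntegral (fun x => B x * k x) / z) := by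
  have hz0 : z ≠ 0 := by simpa using hz 0
  obtain ⟨C, hC⟩ := h.exists_hasRadialFinitePart_error hB hz
  obtain ⟨N, hN⟩ := exists_nat_gt (-z.re)
  have hBk := hB.mul h.angular
  refine ⟨fun R => sphereIntegral (fun x => B x * k x) / z + ((R : ℂ) ^ (-z) * C +
    -∫ x, (‖x‖ : ℂ) ^ (z - m) * outerError k q B R x), fun R hR => ?_, ?_⟩
  · have hR0 : 0 < R := by linarith
    have b1 := hBk.radialBound_indicator
    have b2 := h.radialBound_dilate hB hR
    have b3 := (h.radialBound_outerError hB hR N).mul_angular (.const (-1))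
    have h3 := b3.hasRadialFinitePart (s := z) (by linarith)
    simp only [neg_one_mul, mul_neg, integral_neg] at h3 b3
    have h23 := (hC R hR0).add h3 (fun ε hε => b2.integrableOn z hε)
      (fun ε hε => b3.integrableOn z hε)
    refine ((hasRadialFinitePart_indicator_angular hBk fun h => absurd h hz0).add h23
      (fun ε hε => b1.integrableOn z hε) (fun ε hε => ?_)).congr fun x hx => ?_
    · simp only [mul_add]
      exact (b2.integrableOn z hε).add (b3.integrableOn z hε)
    · rw [outerError]
      by_cases hb : x ∈ Metric.ball (0 : Space m) 1
      · rw [Set.indicator_of_mem hb, Set.indicator_of_mem hb,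
          Set.indicator_of_notMem (by simpa using hb), h.angular.smul_eq R x hR0]
        ring
      · rw [Set.indicator_of_notMem hb, Set.indicator_of_notMem hb,
          Set.indicator_of_mem (by exact hb)]
        ring
  · have h1 : HasFinitePart atTop (fun R : ℝ => (R : ℂ) ^ (-z) * C) 0 :=
      HasFinitePart.cpow_smul (neg_ne_zero.2 hz0) C
    have h2 := (HasFinitePart.of_tendsto (tendsto_const_nhds
      (x := sphereIntegral (fun x => B x * k x) / z))).add (h1.add (HasFinitePart.of_tendsto (h.tendsto_integral_outerError hB z).neg))
    simpa using h2

theorem tendsto_integral_radialBound [NeZero m] (h : IsApproximateSymbol k q) {F : Space m → ℂ}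
    {N : ℕ} (hF : RadialBound F N) {s : ℂ} (hs : -(N : ℝ) < s.re) :
    Tendsto (fun R : ℝ => ∫ x, (‖x‖ : ℂ) ^ (s - m) * (q (R • x) * F x)) atTop
      (𝓝 (∫ x, (‖x‖ : ℂ) ^ (s - m) * (k x * F x))) := by
  obtain ⟨C, hC⟩ := h.bounded
  refine tendsto_integral_filter_of_dominated_convergence (fun x => C * (‖x‖ ^ (s.re - m) * ‖F x‖))
    (Eventually.of_forall fun R => ?_) (Eventually.of_forall fun R => ?_)
    ((hF.integrable_rpow hs).const_mul C) ?_
  · exact ((measurable_norm_cpow _).mul ((h.smooth.continuous.measurable.comp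
      (measurable_const_smul R)).mul hF.measurable)).aestronglyMeasurable
  · filter_upwards [ae_ne_zero] with x hx
    rw [norm_mul, norm_mul, norm_norm_cpow hx, mul_left_comm C]
    simp only [Complex.sub_re, Complex.natCast_re]
    gcongr
    exact hC _
  · filter_upwards [ae_ne_zero] with x hx
    exact ((h.tendsto hx).mul_const (F x)).const_mul _

theorem radialBound_mul (h : IsApproximateSymbol k q) {F : Space m → ℂ} {N : ℕ}
    (hF : RadialBound F N) (R : ℝ) : RadialBound (fun x => q (R • x) * F x) N where
  measurable := (h.smooth.continuous.measurable.comp (measurable_const_smul R)).mul hF.measurable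
  near := by
    obtain ⟨D, hD⟩ := h.bounded
    obtain ⟨C, hC⟩ := hF.near
    refine ⟨D * C, fun x hx hx1 => ?_⟩
    rw [norm_mul, mul_assoc]
    exact mul_le_mul (hD _) (hC x hx hx1) (norm_nonneg _) ((norm_nonneg _).trans (hD x))
  far M := by
    obtain ⟨D, hD⟩ := h.bounded
    obtain ⟨C, hC⟩ := hF.far M
    refine ⟨D * C, fun x hx => ?_⟩
    rw [norm_mul, mul_left_comm]
    exact mul_le_mul (hD _) (hC x hx) (by positivity) ((norm_nonneg _).trans (hD x))

theorem hasFinitePart_angularFp [NeZero m] (h : IsApproximateSymbol k q) {Ω : Space m → ℂ}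
    (hΩ : IsAngular Ω) {ψ : 𝓢(Space m, ℂ)} {Ψ : ℝ → 𝓢(Space m, ℂ)}
    (hΨ : ∀ R x, 0 < R → Ψ R x = q (R • x) * ψ x) {s : ℂ} (hs : ∀ n : ℕ, s + n ≠ 0) :
    HasFinitePart atTop (fun R => angularFp Ω (Ψ R) s) (angularFp (fun x => k x * Ω x) ψ s) := by
  obtain ⟨N, hN⟩ := exists_nat_gt (-s.re)
  have hN' : -(N : ℝ) < s.re := by linarith
  set A : ℕ → Space m → ℂ := fun n x => Ω x * taylorAngular ψ n x with hA
  have hAa : ∀ n, IsAngular (A n) := fun n => hΩ.mul (isAngular_taylorAngular ψ n)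
  have hexp : HasRadialExpansion (fun x => Ω x * ψ x) A :=
    hasRadialExpansion_angular_mul_schwartz hΩ ψ
  set r := radialRemainder N (fun x => Ω x * ψ x) A with hr
  have hrb : RadialBound r N := hexp.radialBound N
  have hsn : ∀ (n l : ℕ), s + n + l ≠ 0 := fun n l => by
    have := hs (n + l)
    push_cast at this
    rwa [add_assoc]
  choose W hW hWlim using fun n : ℕ => h.exists_hasFinitePart_indicator (hAa n) (hsn n)
  have hv : angularFp (fun x => k x * Ω x) ψ s = (∫ x, (‖x‖ : ℂ) ^ (s - m) * (k x * r x)) +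
      ∑ n ∈ Finset.range N, sphereIntegral (fun x => A n x * k x) / (s + n) := by
    have hexp' : HasRadialExpansion (fun x => k x * (Ω x * ψ x)) (fun n x => k x * A n x) :=
      hexp.mul_angular h.angular
    have h1 := (hasRadialFinitePart_angularFp (h.angular.mul hΩ) ψ
      (fun n hn => absurd hn (hs n))).unique ((hexp'.hasRadialFinitePart hN'
      (fun n hn => absurd hn (hs n))).congr fun x _ => (mul_assoc _ _ _).symm)
    rw [h1, radialValue]
    congr 1
    · congr 1
      ext x
      congr 1
      simp only [hr, radialRemainder, mul_sub, Finset.mul_sum]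
      congr 1
      refine Finset.sum_congr rfl fun n _ => ?_
      simp only [Set.indicator]
      split_ifs
      · ring
      · simp
    · simp only [mul_comm (k _)]
  have hV : ∀ R : ℝ, 1 ≤ R → angularFp Ω (Ψ R) s =
      (∫ x, (‖x‖ : ℂ) ^ (s - m) * (q (R • x) * r x)) + ∑ n ∈ Finset.range N, W n R :=
    fun R hR => by
    have hR0 : 0 < R := by linarith
    have hb := h.radialBound_mul hrb R
    have hi : ∀ n ∈ Finset.range N, ∀ ε : ℝ, 0 < ε → IntegrableOn (fun x =>
        (‖x‖ : ℂ) ^ (s - m) * ((‖x‖ : ℂ) ^ n *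
          (q (R • x) * (Metric.ball 0 1).indicator (A n) x))) {x | ε < ‖x‖} := fun n _ ε hε => by
      refine ((h.radialBound_mul (hAa n).radialBound_indicator R).integrableOn (s + n) hε).congr_fun (fun x hx => ?_)
        (measurableSet_norm_gt ε)
      exact norm_cpow_add_natCast_mul (norm_pos_iff.1 (hε.trans hx)) s _ n
    refine (hasRadialFinitePart_angularFp hΩ (Ψ R) fun n hn => absurd hn (hs n)).unique
      (((hb.hasRadialFinitePart hN').add (HasRadialFinitePart.sum
        (fun n _ => (hW n R hR).pow_mul) hi) (fun ε hε => hb.integrableOn s hε)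
        (fun ε hε => ?_)).congr fun x _ => ?_)
    · simp only [Finset.mul_sum]
      exact integrable_finsetSum _ fun n hn => hi n hn ε hε
    · rw [hΨ R x hR0, hr, radialRemainder, mul_sub, Finset.mul_sum, sub_add, mul_left_comm,
        ← Finset.sum_sub_distrib, Finset.sum_eq_zero, sub_zero]
      intro n _
      ring
  rw [hv]
  refine ((HasFinitePart.of_tendsto (h.tendsto_integral_radialBound hrb hN')).add
    (HasFinitePart.sum fun n _ => hWlim n)).congr' ?_
  filter_upwards [eventually_ge_atTop 1] with R hR
  exact (hV R hR).symm

theorem tendsto_angularFp [NeZero m] (h : IsApproximateSymbol k q) {Ω : Space m → ℂ}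
    (hΩ : IsAngular Ω) {ψ : 𝓢(Space m, ℂ)} {Ψ : ℝ → 𝓢(Space m, ℂ)}
    (hΨ : ∀ R x, 0 < R → Ψ R x = q (R • x) * ψ x) {s : ℂ} (hs : 0 < s.re) :
    Tendsto (fun R => angularFp Ω (Ψ R) s) atTop
      (𝓝 (angularFp (fun x => k x * Ω x) ψ s)) := by
  rw [angularFp_eq_integral (h.angular.mul hΩ) ψ hs]
  have h1 := h.tendsto_integral_radialBound ((radialBound_schwartz ψ).mul_angular hΩ) (s := s)
    (by simpa using hs)
  simp only [← mul_assoc (k _)] at h1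
  refine h1.congr' ?_
  filter_upwards [eventually_gt_atTop 0] with R hR
  rw [angularFp_eq_integral hΩ _ hs]
  congr 1
  ext x
  rw [hΨ R x hR]
  ring

end IsApproximateSymbol

theorem IsCutoff.isApproximateSymbol [NeZero m] {χ : Space m → ℝ} (hχ : IsCutoff χ) (j : Fin m) :
    IsApproximateSymbol (hilbertSymbol j) (hχ.symbol j) where
  angular := isAngular_hilbertSymbol j
  smooth := (hasTemperateGrowth_truncatedSymbol _ j).1
  bounded := exists_norm_truncatedSymbol_le _ j
  decay := hχ.symbol_decay j

/-! ### Hilbert transforms of homogeneous distributions -/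

theorem angularFp_const_mul [NeZero m] {A : Space m → ℂ} (hA : IsAngular A) (c : ℂ)
    (ψ : 𝓢(Space m, ℂ)) {s : ℂ} (hs : ∀ n : ℕ, s + n ≠ 0) :
    angularFp (fun x => c * A x) ψ s = c * angularFp A ψ s := by
  refine (hasRadialFinitePart_angularFp ((IsAngular.const c).mul hA) ψ
    fun n hn => absurd hn (hs n)).unique ?_
  refine (HasFinitePart.const_smul c (hasRadialFinitePart_angularFp hA ψ
    fun n hn => absurd hn (hs n))).congr' (Eventually.of_forall fun ε => ?_)
  simp only [smul_eq_mul]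
  rw [← integral_const_mul]
  congr 1
  ext x
  ring

theorem angularFp_hilbertSymbol [NeZero m] (j : Fin m) (ψ : 𝓢(Space m, ℂ)) {s : ℂ}
    (hs : ∀ n : ℕ, s + n ≠ 0) :
    angularFp (fun x => hilbertSymbol j x * 1) ψ s =
      -Complex.I * angularFp (direction j) ψ s := by
  rw [← angularFp_const_mul (isAngular_direction j) _ ψ hs]
  simp only [mul_one]
  rfl

theorem sum_direction_mul_self {x : Space m} (hx : x ≠ 0) :
    ∑ j, direction j x * direction j x = 1 := by
  have h1 : ∑ j, direction j x * direction j x = ((∑ j, x j ^ 2 / ‖x‖ ^ 2 : ℝ) : ℂ) := by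
    rw [Complex.ofReal_sum]
    refine Finset.sum_congr rfl fun j _ => ?_
    rw [direction, ← Complex.ofReal_mul]
    congr 1
    ring
  rw [h1, ← Finset.sum_div, ← EuclideanSpace.real_norm_sq_eq, div_self (by simpa using hx),
    Complex.ofReal_one]

theorem sum_angularFp_hilbertSymbol_mul_direction [NeZero m] (ψ : 𝓢(Space m, ℂ)) {s : ℂ}
    (hs : ∀ n : ℕ, s + n ≠ 0) :
    ∑ j : Fin m, angularFp (fun x => hilbertSymbol j x * direction j x) ψ s =
      -Complex.I * angularFp (fun _ => 1) ψ s := by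
  rw [← angularFp_const_mul (.const 1) _ ψ hs]
  have hA : ∀ j : Fin m, IsAngular fun x => hilbertSymbol j x * direction j x :=
    fun j => (isAngular_hilbertSymbol j).mul (isAngular_direction j)
  refine ((HasRadialFinitePart.sum (S := Finset.univ)
    (fun j _ => hasRadialFinitePart_angularFp (hA j) ψ fun n hn => absurd hn (hs n))
    fun j _ ε hε => ((radialBound_schwartz ψ).mul_angular (hA j)).integrableOn s hε).congr
    fun x hx => ?_).unique (hasRadialFinitePart_angularFp ((IsAngular.const _).mul (.const 1)) ψ
      fun n hn => absurd hn (hs n))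
  rw [← Finset.sum_mul, ← sum_direction_mul_self hx, Finset.mul_sum]
  congr 1
  refine Finset.sum_congr rfl fun j _ => ?_
  rw [hilbertSymbol]
  ring

/-- `u` is the inverse Fourier transform of `|ξ| ^ (s - m) (a + b ξ / |ξ|)`. -/
def HasSymbol (u : 𝓢'(Space m, Cl m)) (s a b : ℂ) : Prop :=
  ∀ φ : 𝓢(Space m, ℂ), u φ = (a * angularFp (fun _ => 1) (𝓕 φ) s) • (1 : Cl m) +
    ∑ j, (b * angularFp (direction j) (𝓕 φ) s) • e j

/-- The Fourier transform of the convolution of `φ` with the truncated Hilbert kernel. -/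
noncomputable def IsCutoff.multiply {χ : Space m → ℝ} (hχ : IsCutoff χ) (j : Fin m)
    (ψ : 𝓢(Space m, ℂ)) (R : ℝ) : 𝓢(Space m, ℂ) :=
  SchwartzMap.smulLeftCLM ℂ (fun ξ => hχ.symbol j (R • ξ)) ψ

theorem IsCutoff.multiply_apply {χ : Space m → ℝ} (hχ : IsCutoff χ) (j : Fin m)
    (ψ : 𝓢(Space m, ℂ)) {R : ℝ} (hR : 0 < R) (ξ : Space m) :
    hχ.multiply j ψ R ξ = hχ.symbol j (R • ξ) * ψ ξ := by
  have h : (fun ξ => hχ.symbol j (R • ξ)).HasTemperateGrowth := by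
    rw [← funext (hχ.symbol_dilate hR j)]
    exact hasTemperateGrowth_truncatedSymbol _ j
  rw [multiply, SchwartzMap.smulLeftCLM_apply_apply h, smul_eq_mul]

theorem hilbertKernel_cutShift [NeZero m] {χ : Space m → ℝ} (hχ : IsCutoff χ) {R : ℝ}
    (hR : 0 < R) (φ : 𝓢(Space m, ℂ)) (x : Space m) :
    hilbertKernel m (cutShift χ R φ x) = ∑ j, 𝓕⁻ (hχ.multiply j (𝓕 φ) R) x • e j := by
  rw [hilbertKernel_apply]
  refine Finset.sum_congr rfl fun j _ => ?_
  rw [integral_hilbertSymbol_mul_fourier_mul (hχ.dilate hR).toSchwartz φ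
    (fun y => by rw [cutShift_apply hχ hR]; rfl), IsCutoff.multiply,
    ← funext (hχ.symbol_dilate hR j)]
  rfl

/-- The convolution of the truncated Hilbert kernel with a distribution with symbol. -/
noncomputable def IsCutoff.truncConv {χ : Space m → ℝ} (hχ : IsCutoff χ) (s a b : ℂ)
    (ψ : 𝓢(Space m, ℂ)) (R : ℝ) : Cl m :=
  ∑ j, (a * angularFp (fun _ => 1) (hχ.multiply j ψ R) s) • e j +
    ∑ j, ∑ k, (b * angularFp (direction k) (hχ.multiply j ψ R) s) • (e j * e k)

theorem HasSymbol.isTruncConv [NeZero m] {u : 𝓢'(Space m, Cl m)} {s a b : ℂ}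
    (hu : HasSymbol u s a b) {χ : Space m → ℝ} (hχ : IsCutoff χ) {R : ℝ} (hR : 0 < R)
    (φ : 𝓢(Space m, ℂ)) :
    IsTruncConv (hilbertKernel m) u χ R φ (hχ.truncConv s a b (𝓕 φ) R) := by
  refine ⟨m, fun j => 𝓕⁻ (hχ.multiply j (𝓕 φ) R), e, hilbertKernel_cutShift hχ hR φ, ?_⟩
  rw [IsCutoff.truncConv, ← Finset.sum_add_distrib]
  refine Finset.sum_congr rfl fun j _ => ?_
  rw [hu, fourier_fourierInv_eq, mul_add, Finset.mul_sum]
  simp only [mul_smul_comm, mul_one]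

/-- The limit of `IsCutoff.truncConv`. -/
theorem HasSymbol.apply_eq [NeZero m] {w : 𝓢'(Space m, Cl m)} {s a b : ℂ}
    (hw : HasSymbol w s (Complex.I * b) (-Complex.I * a)) (hs : ∀ n : ℕ, s + n ≠ 0)
    (φ : 𝓢(Space m, ℂ)) :
    w φ = ∑ j, (a * angularFp (fun x => hilbertSymbol j x * 1) (𝓕 φ) s) • e j +
      ∑ j, ∑ k, (b * angularFp (fun x => hilbertSymbol j x * direction k x) (𝓕 φ) s) •
        (e j * e k) := by
  have h1 := sum_e_mul_e_mul (m := m) (M := fun j k =>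
    (b * angularFp (fun x => hilbertSymbol j x * direction k x) (𝓕 φ) s) • (1 : Cl m))
    fun j k => by
      simp only [hilbertSymbol]
      congr 3
      ext x
      ring
  simp only [mul_smul_comm, mul_one] at h1
  rw [hw, h1, ← Finset.sum_smul, ← Finset.mul_sum, sum_angularFp_hilbertSymbol_mul_direction _ hs,
    ← neg_smul, add_comm]
  congr 1
  · refine Finset.sum_congr rfl fun j _ => ?_
    rw [angularFp_hilbertSymbol j _ hs]
    congr 1
    ring
  · congr 1
    ring

theorem HasSymbol.isHilbertTransform [NeZero m] {u w : 𝓢'(Space m, Cl m)} {s a b : ℂ}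
    (hu : HasSymbol u s a b) (hw : HasSymbol w s (Complex.I * b) (-Complex.I * a))
    (hs : ∀ n : ℕ, s + n ≠ 0) : IsHilbertTransform u w := by
  intro χ hχ φ
  refine ⟨hχ.truncConv s a b (𝓕 φ), fun R hR => hu.isTruncConv hχ hR φ, ?_⟩
  have hfp : ∀ (j : Fin m) {Ω : Space m → ℂ}, IsAngular Ω →
      HasFinitePart atTop (fun R => angularFp Ω (hχ.multiply j (𝓕 φ) R) s)
        (angularFp (fun x => hilbertSymbol j x * Ω x) (𝓕 φ) s) := fun j Ω hΩ =>
    (hχ.isApproximateSymbol j).hasFinitePart_angularFp hΩ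
      (fun R x hR => hχ.multiply_apply j _ hR x) hs
  rw [hw.apply_eq hs]
  exact (HasFinitePart.sum fun j _ => ((hfp j (.const 1)).const_smul a).smul_const (e j)).add
    (HasFinitePart.sum fun j _ => HasFinitePart.sum fun k _ =>
      ((hfp j (isAngular_direction k)).const_smul b).smul_const (e j * e k))

theorem HasSymbol.isOrdinaryConv [NeZero m] {u w : 𝓢'(Space m, Cl m)} {s a b : ℂ}
    (hu : HasSymbol u s a b) (hw : HasSymbol w s (Complex.I * b) (-Complex.I * a))
    (hs : 0 < s.re) : IsOrdinaryConv (hilbertKernel m) u w := by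
  intro χ hχ φ
  refine ⟨hχ.truncConv s a b (𝓕 φ), fun R hR => hu.isTruncConv hχ hR φ, ?_⟩
  have hlim : ∀ (j : Fin m) {Ω : Space m → ℂ}, IsAngular Ω →
      Tendsto (fun R => angularFp Ω (hχ.multiply j (𝓕 φ) R) s) atTop
        (𝓝 (angularFp (fun x => hilbertSymbol j x * Ω x) (𝓕 φ) s)) := fun j Ω hΩ =>
    (hχ.isApproximateSymbol j).tendsto_angularFp hΩ
      (fun R x hR => hχ.multiply_apply j _ hR x) hs
  rw [hw.apply_eq (add_natCast_ne_zero hs)]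
  exact (tendsto_finsetSum _ fun j _ => ((hlim j (.const 1)).const_mul a).smul_const (e j)).add
    (tendsto_finsetSum _ fun j _ => tendsto_finsetSum _ fun k _ =>
      ((hlim j (isAngular_direction k)).const_mul b).smul_const (e j * e k))

/-! ### The symbols of the fundamental solutions -/

theorem hasSymbol_homogeneous [NeZero m] {μ : ℂ} (hμ : ∀ n : ℕ, μ ≠ m + n) (a b : ℂ) :
    HasSymbol ((a * ((2 : ℂ) ^ (-μ) * Complex.Gamma ((m + -μ) / 2) /
        (Real.pi : ℂ) ^ ((m - -μ) / 2))) • tensor (Tstar m (-m - -μ)) 1 -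
      (b * ((2 : ℂ) ^ (-μ) * Complex.Gamma ((m + -μ + 1) / 2) /
        (Real.pi : ℂ) ^ ((m - -μ + 1) / 2))) • Ustar m (-m - -μ)) (m - μ)
      ((2 : ℂ) ^ (-μ) * (Real.pi : ℂ) ^ (-μ) * a)
      (-Complex.I * ((2 : ℂ) ^ (-μ) * (Real.pi : ℂ) ^ (-μ) * b)) := by
  intro φ
  have hpi : (Real.pi : ℂ) ≠ 0 := by exact_mod_cast Real.pi_pos.ne'
  have hpc : ∀ z : ℂ, (Real.pi : ℂ) ^ z ≠ 0 := fun z => by simp [Complex.cpow_eq_zero_iff, hpi]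
  have hΓ : Complex.Gamma ((m - μ) / 2) ≠ 0 := Complex.Gamma_ne_zero fun l hl =>
    hμ (2 * l) (by push_cast; linear_combination -2 * hl)
  have hΓ' : Complex.Gamma ((m + 1 - μ) / 2) ≠ 0 := Complex.Gamma_ne_zero fun l hl =>
    hμ (2 * l + 1) (by push_cast; linear_combination -2 * hl)
  have e1 : (Real.pi : ℂ) ^ ((m - μ) / 2) =
      (Real.pi : ℂ) ^ (-μ) * (Real.pi : ℂ) ^ ((m - -μ) / 2) := by
    rw [← Complex.cpow_add _ _ hpi]; ring_nf
  have e2 : (Real.pi : ℂ) ^ ((m + 1 - μ) / 2) =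
      (Real.pi : ℂ) ^ (-μ) * (Real.pi : ℂ) ^ ((m - -μ + 1) / 2) := by
    rw [← Complex.cpow_add _ _ hpi]; ring_nf
  have h1 := hpc ((m - -μ) / 2)
  have h2 := hpc ((m - -μ + 1) / 2)
  rw [sub_apply, smul_apply, smul_apply, tensor_apply, show -(m : ℂ) - -μ = μ - m by ring,
    Tstar_apply hμ, Ustar_apply hμ, smul_smul, sub_eq_add_neg, Finset.smul_sum,
    ← Finset.sum_neg_distrib, e1, e2, show (m : ℂ) + -μ + 1 = m + 1 - μ by ring,
    show (m : ℂ) + -μ = m - μ by ring]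
  congr 1
  · congr 1
    field_simp
  · refine Finset.sum_congr rfl fun j _ => ?_
    rw [smul_smul, ← neg_smul]
    congr 1
    field_simp

theorem exists_hasSymbol_fund [NeZero m] {μ : ℂ} (hμ : ∀ n : ℕ, μ ≠ m + n) :
    ∃ a b : ℂ, HasSymbol (fundE m μ) (m - μ) a (-Complex.I * b) ∧
      HasSymbol (fundF m μ) (m - μ) b (-Complex.I * a) :=
  ⟨_, _, hasSymbol_homogeneous hμ _ _, hasSymbol_homogeneous hμ _ _⟩

theorem isHilbertPair_fundE_fundF [NeZero m] {μ : ℂ} (hμ : ∀ n : ℕ, μ ≠ m + n) :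
    IsHilbertPair (fundE m μ) (fundF m μ) ∧
    (μ.re < m → IsOrdinaryConv (hilbertKernel m) (fundE m μ) (fundF m μ) ∧
      IsOrdinaryConv (hilbertKernel m) (fundF m μ) (fundE m μ)) := by
  obtain ⟨a, b, hE, hF⟩ := exists_hasSymbol_fund hμ
  have hI : ∀ c : ℂ, Complex.I * (-Complex.I * c) = c := fun c => by
    linear_combination -c * Complex.I_sq
  have hs : ∀ n : ℕ, (m : ℂ) - μ + n ≠ 0 := fun n hn => hμ n (by linear_combination -hn)
  have hE' : HasSymbol (fundE m μ) (m - μ) (Complex.I * (-Complex.I * a)) (-Complex.I * b) := by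
    rwa [hI]
  have hF' : HasSymbol (fundF m μ) (m - μ) (Complex.I * (-Complex.I * b)) (-Complex.I * a) := by
    rwa [hI]
  refine ⟨⟨hE.isHilbertTransform hF' hs, hF.isHilbertTransform hE' hs⟩, fun hre => ?_⟩
  have hre' : 0 < ((m : ℂ) - μ).re := by simpa using hre
  exact ⟨hE.isOrdinaryConv hF' hre', hF.isOrdinaryConv hE' hre'⟩

end DiracHilbert

theorem proposition5p2 (m : ℕ) (hm : 1 ≤ m) (μ : ℂ) (hμ : ∀ n : ℕ, μ ≠ (m : ℂ) + n) :
    DiracHilbert.IsHilbertPair (DiracHilbert.fundE m μ) (DiracHilbert.fundF m μ) ∧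
    (μ.re < m →
      DiracHilbert.IsOrdinaryConv (DiracHilbert.hilbertKernel m)
        (DiracHilbert.fundE m μ) (DiracHilbert.fundF m μ) ∧
      DiracHilbert.IsOrdinaryConv (DiracHilbert.hilbertKernel m)
        (DiracHilbert.fundF m μ) (DiracHilbert.fundE m μ)) := by
  have : NeZero m := ⟨by omega⟩
  exact DiracHilbert.isHilbertPair_fundE_fundF hμ
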